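/- Let $K$ be a field of characteristic $0$ (for instance $K=\mathbb Q$) with algebraic closure $\overline K$ and $\mathrm{Gal}_K=\mathrm{Gal}(\overline K/K)$. The Segre cubic over $K$ is the threefold $\Sigma\subset\mathbb P^5_K$ given by $\sum_{i=1}^6 x_i=\sum_{i=1}^6 x_i^3=0$. A 10-nodal cubic threefold over $K$ is a cubic hypersurface $X\subset\mathbb P^4_K$ such that $X\otimes\overline K$ has exactly ten singular points, all of them ordinary nodes. (i) Every automorphism of $\Sigma\otimes\overline K$ is defined over $K$, that is, $\mathrm{Aut}(\Sigma)=\mathrm{Aut}(\Sigma\otimes\overline K)$, and this group is isomorphic to $S_6$, acting on $\Sigma$ by permutations of the coordinates. (ii) Every $1$-cocycle $\mathrm{Gal}_K\to\mathrm{Aut}(\Sigma\otimes\overline K)=\mathrm{Aut}(\Sigma)$ is a homomorphism. (iii) Every 10-nodal cubic threefold $X$ over $K$ is the twist of $\Sigma$ by a continuous homomorphism $\rho:\mathrm{Gal}_K\to S_6$: there is an isomorphism $\psi:\Sigma\otimes\overline K\to X\otimes\overline K$ with $\psi^{-1}\circ(\sigma\circ\psi\circ\sigma^{-1})=\rho(\sigma)$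 for all $\sigma\in\mathrm{Gal}_K$. (iv) Given such an $X$, the homomorphism $\rho$ in (iii) and a separable (that is, étale) commutative $K$-algebra $L$ of dimension $6$ can be chosen so that $X$ is the subvariety $\mathrm{Tr}(z)=\mathrm{Tr}(z^3)=0$ of $\mathbb P(L)$, where $\mathrm{Tr}=\mathrm{Tr}_{L/K}$ (some $K$-linear isomorphism of $K^5$ with the hyperplane $\mathrm{Tr}(z)=0$ of $L$ takes an equation of $X$ to $\mathrm{Tr}(z^3)$ up to a nonzero constant factor), and so that $L$ corresponds to $\rho$: the $\mathrm{Gal}_K$-set $\mathrm{Hom}_{K\text{-alg}}(L,\overline K)$ is isomorphic to $\{1,\dots,6\}$ with $\mathrm{Gal}_K$ acting through $\rho$. -/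

import Mathlib

open MvPolynomial
open scoped LinearAlgebra.Projectivization

namespace SegreCubic

section Varieties

variable {K : Type*} [Field K] {Ω : Type*} [Field Ω] [Algebra K Ω]
variable {ι κ : Type*}

/-- The projective variety over `K` cut out by a set `S` of homogeneous polynomials with coefficients
in `K`, given by its set of `Ω`-points (`Ω` will be an algebraic closure of `K`): the lines in
`Ω^ι` on which all members of `S` vanish. -/
def zeros (Ω : Type*) [Field Ω] [Algebra K Ω] (S : Set (MvPolynomial ι K)) : Set (ℙ Ω (ι → Ω)) :=
  {p | ∀ f ∈ S, ∀ v ∈ p.submodule, aeval v f = 0}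

/-- A map between projective varieties is a morphism defined over `k` if near every point it is
given by homogeneous polynomials of one degree with coefficients in `k`. (Multiplying the polynomials
by a form that vanishes off the neighbourhood, one may ask that they compute the map wherever they
do not vanish simultaneously.) -/
def IsMorphism (k : Type*) [Field k] [Algebra k Ω] {X : Set (ℙ Ω (ι → Ω))} {Y : Set (ℙ Ω (κ → Ω))}
    (φ : X → Y) : Prop :=
  ∀ p : X, ∃ (d : ℕ) (f : κ → MvPolynomial ι k), (∀ j, (f j).IsHomogeneous d) ∧
    (fun j => aeval p.1.rep (f j)) ≠ 0 ∧
    ∀ (q : X) (h : (fun j => aeval q.1.rep (f j)) ≠ 0),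
      (φ q).1 = Projectivization.mk Ω (fun j => aeval q.1.rep (f j)) h

theorem isMorphism_id (k : Type*) [Field k] [Algebra k Ω] (X : Set (ℙ Ω (ι → Ω))) :
    IsMorphism k (id : X → X) := by
  intro p
  refine ⟨1, fun j => MvPolynomial.X j, fun j => isHomogeneous_X _ _, ?_, ?_⟩
  · simpa using p.1.rep_nonzero
  · intro q h
    simp

theorem IsMorphism.comp {k : Type*} [Field k] [Algebra k Ω] {ν : Type*}
    {X : Set (ℙ Ω (ι → Ω))} {Y : Set (ℙ Ω (κ → Ω))} {Z : Set (ℙ Ω (ν → Ω))}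
    {ψ : Y → Z} {φ : X → Y} (hψ : IsMorphism k ψ) (hφ : IsMorphism k φ) :
    IsMorphism k (ψ ∘ φ) := by
  intro p
  obtain ⟨d, f, hf, hfp, hfφ⟩ := hφ p
  obtain ⟨e, g, hg, hgp, hgψ⟩ := hψ (φ p)
  have key : ∀ q : X, (fun j => aeval q.1.rep (f j)) ≠ 0 → ∃ a : Ωˣ, ∀ j,
      aeval (φ q).1.rep (g j) = (a : Ω) ^ e * aeval q.1.rep (bind₁ f (g j)) := by
    intro q hq
    have h1 := hfφ q hq
    rw [← Projectivization.mk_rep (φ q).1, Projectivization.mk_eq_mk_iff] at h1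
    obtain ⟨a, ha⟩ := h1
    refine ⟨a, fun j => ?_⟩
    have h2 : (φ q).1.rep = fun i => (a : Ω) * aeval q.1.rep (f i) := by
      rw [← ha]; rfl
    rw [h2, aeval_bind₁, aeval_def, aeval_def, eval₂_eq, eval₂_eq, Finset.mul_sum]
    refine Finset.sum_congr rfl fun m hm => ?_
    have hdeg := hg j (mem_support_iff.mp hm)
    rw [← hdeg, Finsupp.weight_apply, Finsupp.sum]
    simp only [Pi.one_apply, smul_eq_mul, mul_one, mul_pow, Finset.prod_mul_distrib,
      Finset.prod_pow_eq_pow_sum]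
    ring
  obtain ⟨i₀, hi₀⟩ := Function.ne_iff.mp hfp
  refine ⟨d + d * e, fun j => f i₀ * bind₁ f (g j), fun j => ?_, ?_, ?_⟩
  · exact (hf i₀).mul (by simpa [aeval_eq_bind₁] using (hg j).aeval f hf)
  · obtain ⟨a, ha⟩ := key p hfp
    intro h0
    apply hgp
    funext j
    have := congrFun h0 j
    simp only [Pi.zero_apply, map_mul] at this hi₀ ⊢
    rw [ha j, (mul_eq_zero.mp this).resolve_left hi₀, mul_zero]
  · intro q hq
    have hq₀ : aeval q.1.rep (f i₀) ≠ 0 := by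
      intro h0
      apply hq
      funext j
      simp [h0]
    have hfq : (fun j => aeval q.1.rep (f j)) ≠ 0 := fun h => hq₀ (congrFun h i₀)
    obtain ⟨a, ha⟩ := key q hfq
    have hgq : (fun j => aeval (φ q).1.rep (g j)) ≠ 0 := by
      intro h0
      apply hq
      funext j
      have := congrFun h0 j
      simp only [Pi.zero_apply, map_mul] at this ⊢
      rw [ha j] at this
      rw [(mul_eq_zero.mp this).resolve_left (pow_ne_zero _ a.ne_zero), mul_zero]
    rw [Function.comp_apply, hgψ (φ q) hgq, Projectivization.mk_eq_mk_iff]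
    refine ⟨a ^ e * (Units.mk0 _ hq₀)⁻¹, ?_⟩
    funext j
    simp only [Units.smul_def, Pi.smul_apply, smul_eq_mul, map_mul, ha j, Units.val_mul,
      Units.val_pow_eq_pow_val, Units.val_inv_eq_inv_val, Units.val_mk0]
    field_simp

/-- The group of automorphisms defined over `k` of the projective variety `X`. -/
def autGroup (k : Type*) [Field k] [Algebra k Ω] (X : Set (ℙ Ω (ι → Ω))) :
    Subgroup (Equiv.Perm X) where
  carrier := {φ | IsMorphism k φ ∧ IsMorphism k φ.symm}
  mul_mem' := fun ha hb => ⟨ha.1.comp hb.1, hb.2.comp ha.2⟩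
  one_mem' := ⟨isMorphism_id k X, isMorphism_id k X⟩
  inv_mem' := fun ha => ⟨ha.2, ha.1⟩

/-- `σ ∈ Gal(Ω/K)` acting coordinatewise on `Ω^ι`, as a `σ`-semilinear map. -/
def galVec (ι : Type*) (σ : Ω ≃ₐ[K] Ω) :
    (ι → Ω) →ₛₗ[(σ.toRingEquiv : Ω →+* Ω)] (ι → Ω) where
  toFun v i := σ (v i)
  map_add' v w := by funext i; simp
  map_smul' a v := by funext i; simp

theorem galVec_injective (σ : Ω ≃ₐ[K] Ω) : Function.Injective (galVec ι σ) := fun _ _ h =>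
  funext fun i => σ.injective (congrFun h i)

/-- The action of `σ ∈ Gal(Ω/K)` on the points of projective space. -/
def galPoint (σ : Ω ≃ₐ[K] Ω) : ℙ Ω (ι → Ω) → ℙ Ω (ι → Ω) :=
  Projectivization.map (galVec ι σ) (galVec_injective σ)

theorem galPoint_one (p : ℙ Ω (ι → Ω)) : galPoint (1 : Ω ≃ₐ[K] Ω) p = p := by
  induction p using Projectivization.ind with
  | h v hv => rfl

theorem galPoint_mul (σ τ : Ω ≃ₐ[K] Ω) (p : ℙ Ω (ι → Ω)) :
    galPoint (σ * τ) p = galPoint σ (galPoint τ p) := by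
  induction p using Projectivization.ind with
  | h v hv => rfl

theorem galPoint_mem (S : Set (MvPolynomial ι K)) (σ : Ω ≃ₐ[K] Ω) {p : ℙ Ω (ι → Ω)}
    (hp : p ∈ zeros Ω S) : galPoint σ p ∈ zeros Ω S := by
  induction p using Projectivization.ind with
  | h v hv =>
    intro f hf w hw
    have hw' : w ∈ Submodule.span Ω {galVec ι σ v} := by
      rwa [galPoint, Projectivization.map_mk, Projectivization.submodule_mk] at hw
    obtain ⟨a, rfl⟩ := Submodule.mem_span_singleton.mp hw'
    have h1 : aeval (σ.symm a • v) f = 0 := hp f hf _ (by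
      rw [Projectivization.submodule_mk]
      exact Submodule.smul_mem _ _ (Submodule.mem_span_singleton_self v))
    have h2 : a • galVec ι σ v = fun i => σ ((σ.symm a • v) i) := by
      funext i
      change a * σ (v i) = σ (σ.symm a * v i)
      simp
    have h3 := comp_aeval_apply (σ.symm a • v) (σ : Ω →ₐ[K] Ω) f
    rw [h1, map_zero] at h3
    rw [h2]
    exact h3.symm

/-- The action of `Gal(Ω/K)` on the `Ω`-points of a projective variety over `K`. -/
def galPerm (S : Set (MvPolynomial ι K)) : (Ω ≃ₐ[K] Ω) →* Equiv.Perm (zeros Ω S) where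
  toFun σ :=
    { toFun := fun p => ⟨galPoint σ p.1, galPoint_mem S σ p.2⟩
      invFun := fun p => ⟨galPoint σ⁻¹ p.1, galPoint_mem S σ⁻¹ p.2⟩
      left_inv := fun p => Subtype.ext (by
        simp only [← galPoint_mul, inv_mul_cancel, galPoint_one])
      right_inv := fun p => Subtype.ext (by
        simp only [← galPoint_mul, mul_inv_cancel, galPoint_one]) }
  map_one' := Equiv.ext fun p => Subtype.ext (galPoint_one p.1)
  map_mul' σ τ := Equiv.ext fun p => Subtype.ext (galPoint_mul σ τ p.1)

/-- A 1-cocycle of `Gal(Ω/K)` with values in the group of automorphisms over `Ω` of the variety over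
`K` cut out by `S`. The Galois group acts on automorphisms by `φ ↦ σ ∘ φ ∘ σ⁻¹`. -/
def IsOneCocycle (S : Set (MvPolynomial ι K)) (c : (Ω ≃ₐ[K] Ω) → autGroup Ω (zeros Ω S)) : Prop :=
  ∀ σ τ, (c (σ * τ) : Equiv.Perm (zeros Ω S)) =
    c σ * (galPerm S σ * c τ * (galPerm S σ)⁻¹)

/-- The variety over `K` cut out by `T` is the twist by `c` of the one cut out by `S`: there is an
isomorphism `ψ` over `Ω` from the second to the first such that `ψ⁻¹ ∘ (σ ∘ ψ ∘ σ⁻¹) = c σ` for all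
`σ` in `Gal(Ω/K)`. -/
def IsTwist (S : Set (MvPolynomial ι K)) (T : Set (MvPolynomial κ K))
    (c : (Ω ≃ₐ[K] Ω) → autGroup Ω (zeros Ω S)) : Prop :=
  ∃ ψ : zeros Ω S ≃ zeros Ω T, IsMorphism Ω ψ ∧ IsMorphism Ω ψ.symm ∧
    ∀ σ p, galPerm T σ (ψ ((galPerm S σ)⁻¹ p)) = ψ ((c σ : Equiv.Perm (zeros Ω S)) p)

end Varieties

section Segre

/-- The equations `∑ xᵢ = ∑ xᵢ³ = 0` in `ℙ⁵` of the Segre cubic, over `K`. -/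
noncomputable def segreEqs (K : Type*) [Field K] : Set (MvPolynomial (Fin 6) K) :=
  {∑ i, X i, ∑ i, X i ^ 3}

/-- The set of points over `Ω` of the Segre cubic. -/
abbrev segre (K Ω : Type*) [Field K] [Field Ω] [Algebra K Ω] : Set (ℙ Ω (Fin 6 → Ω)) :=
  zeros Ω (segreEqs K)

variable {K Ω : Type*} [Field K] [Field Ω] [Algebra K Ω]

/-- The permutation `π` of the six coordinates, as a map on `ℙ⁵`: the `i`-th coordinate of a point
becomes the `π i`-th coordinate of its image. -/
def permPoint (π : Equiv.Perm (Fin 6)) : ℙ Ω (Fin 6 → Ω) → ℙ Ω (Fin 6 → Ω) :=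
  Projectivization.map (LinearMap.funLeft Ω Ω π.symm)
    (LinearMap.funLeft_injective_of_surjective _ _ _ π.symm.surjective)

theorem permPoint_one (p : ℙ Ω (Fin 6 → Ω)) : permPoint 1 p = p := by
  induction p using Projectivization.ind with
  | h v hv => rfl

theorem permPoint_mul (π ρ : Equiv.Perm (Fin 6)) (p : ℙ Ω (Fin 6 → Ω)) :
    permPoint (π * ρ) p = permPoint π (permPoint ρ p) := by
  induction p using Projectivization.ind with
  | h v hv => rfl

theorem permPoint_mem (π : Equiv.Perm (Fin 6)) {p : ℙ Ω (Fin 6 → Ω)} (hp : p ∈ segre K Ω) :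
    permPoint π p ∈ segre K Ω := by
  induction p using Projectivization.ind with
  | h v hv =>
    intro f hf w hw
    have hw' : w ∈ Submodule.span Ω {LinearMap.funLeft Ω Ω π.symm v} := by
      rwa [permPoint, Projectivization.map_mk, Projectivization.submodule_mk] at hw
    obtain ⟨a, rfl⟩ := Submodule.mem_span_singleton.mp hw'
    have h1 : aeval (a • v) f = 0 := hp f hf _ (by
      rw [Projectivization.submodule_mk]
      exact Submodule.smul_mem _ _ (Submodule.mem_span_singleton_self v))
    rcases hf with rfl | rfl
    · rw [← h1]
      simpa [LinearMap.funLeft_apply] using Equiv.sum_comp π.symm (fun i => a * v i)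
    · rw [← h1]
      simpa [LinearMap.funLeft_apply] using Equiv.sum_comp π.symm (fun i => (a * v i) ^ 3)

/-- The action of the symmetric group on the Segre cubic by permutations of the coordinates. -/
def segrePerm (K Ω : Type*) [Field K] [Field Ω] [Algebra K Ω] :
    Equiv.Perm (Fin 6) →* Equiv.Perm (segre K Ω) where
  toFun π :=
    { toFun := fun p => ⟨permPoint π p.1, permPoint_mem π p.2⟩
      invFun := fun p => ⟨permPoint π⁻¹ p.1, permPoint_mem π⁻¹ p.2⟩
      left_inv := fun p => Subtype.ext (by
        simp only [← permPoint_mul, inv_mul_cancel, permPoint_one])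
      right_inv := fun p => Subtype.ext (by
        simp only [← permPoint_mul, mul_inv_cancel, permPoint_one]) }
  map_one' := Equiv.ext fun p => Subtype.ext (permPoint_one p.1)
  map_mul' π ρ := Equiv.ext fun p => Subtype.ext (permPoint_mul π ρ p.1)

end Segre

section Nodal

variable {K : Type*} [Field K]

/-- The vector `v` lies on the hypersurface `F = 0` and all partial derivatives of `F` vanish
at `v`. -/
def IsSingularAt {Ω : Type*} [Field Ω] [Algebra K Ω] {n : ℕ} (F : MvPolynomial (Fin n) K)
    (v : Fin n → Ω) : Prop :=
  aeval v F = 0 ∧ ∀ i, aeval v (pderiv i F) = 0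

/-- The Hessian matrix of `F` at `v`. -/
noncomputable def hessian {Ω : Type*} [Field Ω] [Algebra K Ω] {n : ℕ} (F : MvPolynomial (Fin n) K)
    (v : Fin n → Ω) : Matrix (Fin n) (Fin n) Ω :=
  Matrix.of fun i j => aeval v (pderiv i (pderiv j F))

/-- The point of `ℙ^(n-1)` spanned by `v` is an ordinary node of the hypersurface `F = 0`: it is
singular, and the quadratic form `w ↦ ½ wᵀ H w`, with `H` the Hessian at `v`, is nondegenerate on the
tangent space `Ω^n / Ω v` of projective space at that point. -/
def IsNodeAt {Ω : Type*} [Field Ω] [Algebra K Ω] {n : ℕ} (F : MvPolynomial (Fin n) K)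
    (v : Fin n → Ω) : Prop :=
  IsSingularAt F v ∧ ∀ w, (hessian F v).mulVec w = 0 → w ∈ Submodule.span Ω {v}

/-- `F = 0` is a 10-nodal cubic threefold in `ℙ⁴` over `K`: over the algebraic closure it has exactly
ten singular points, and each of them is an ordinary node. -/
def IsTenNodalCubic (F : MvPolynomial (Fin 5) K) : Prop :=
  F.IsHomogeneous 3 ∧
  {p : ℙ (AlgebraicClosure K) (Fin 5 → AlgebraicClosure K) | IsSingularAt F p.rep}.ncard = 10 ∧
  ∀ p : ℙ (AlgebraicClosure K) (Fin 5 → AlgebraicClosure K),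
    IsSingularAt F p.rep → IsNodeAt F p.rep

/-- The cubic threefold `F = 0` is the subvariety `Tr(z) = Tr(z³) = 0` of `ℙ(L)`: some `K`-linear
identification of `K⁵` with the hyperplane `Tr(z) = 0` of `L` takes the cubic form `F` to
`Tr(z³)`, up to a nonzero constant. -/
def IsTraceCubic (F : MvPolynomial (Fin 5) K) (L : Type*) [CommRing L] [Algebra K L] : Prop :=
  ∃ ℓ : (Fin 5 → K) →ₗ[K] L, Function.Injective ℓ ∧
    LinearMap.range ℓ = LinearMap.ker (Algebra.trace K L) ∧
    ∃ a : K, a ≠ 0 ∧ ∀ x, Algebra.trace K L (ℓ x ^ 3) = a * eval x F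

end Nodal

end SegreCubic

universe u

/-! The linear heart of the proof concerns the cubic `∑ xᵢ³` on the hyperplane `∑ xᵢ = 0`. For a
nonzero vector `v` of the hyperplane, the quadratic form `tri v · ·` has a kernel of dimension at
least three exactly when `v` is a multiple of a root `eᵢ - eⱼ`. A linear isomorphism matching the
cubic with itself up to a factor therefore carries roots to multiples of roots, and the incidences
among the `e₀ - eⱼ` force it to be a permutation of the coordinates times a scalar
(`exists_perm_of_tri_eq`).

Automorphisms. The quadrics through five general points of `ℙ³` parametrize the Segre cubic
(`quad`). Composed with this parametrization, an automorphism is given by coprime forms `g` of one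
degree `m`. The signed maximal minors of the Jacobian of `g`, of degree `4 (m - 1)`, are
proportional to the coordinates of the normal vector at the image point, of degree `2 m`; off
finitely many lines neither vector vanishes, so the degrees agree and `m = 2` (`degree_eq_two`). The
quadrics `g` vanish at the five base points, hence are linear in `quad`. The resulting linear map
preserves the Segre cubic, so also its equation up to a factor (`exists_cube_eq_of_vanish`), and is
a permutation up to a scalar (`exists_eq_segrePerm`). Permutations are defined over `K` and commute
with Galois, which makes cocycles homomorphisms.

Ten-nodal cubics. The tangent cone at one node is a cone over `ℙ¹ × ℙ¹`. The cubic cuts out a curve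
of bidegree `(3, 3)` there, and its nine singular points are the projections of the other nodes.
Counting with a discriminant shows that such a curve consists of three lines of each ruling
(`exists_factorization_of_nine_sing`). Moving both triples to `0, 1, ∞` brings the equation to
`Y₁Y₂Y₃ + Z₁Z₂Z₃ = 0` with `∑ Yᵢ + ∑ Zᵢ = 0`, which is the Segre cubic (`exists_sum_cube`).

Descent. Six linear forms exhibiting `X` as the Segre cubic are changed by `σ` only by a permutation
and a scalar. An explicit rescaling removes the scalar (`exists_equivariant`), leaving a
homomorphism `ρ`. The values of the six forms at a suitable rational vector are distinct and
permuted through `ρ`; they are the roots of a separable polynomial over `K`, and `L` is the algebra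
it defines. -/

namespace SegreCubic

/-! ### Linear maps preserving the Segre cubic form. -/

section SumZero

variable {Ω W : Type*} [Field Ω] [AddCommGroup W] [Module Ω W]

/-- A linear map identifies `W` with the hyperplane `∑ xᵢ = 0` of `Ω⁶`. -/
structure IsSumZeroIso (f : W →ₗ[Ω] (Fin 6 → Ω)) : Prop where
  inj : ∀ w, f w = 0 → w = 0
  sum_eq : ∀ w, ∑ i, f w i = 0
  surj : ∀ x : Fin 6 → Ω, ∑ i, x i = 0 → ∃ w, f w = x

/-- The vector `eᵢ - eⱼ`. -/
def rootVec (Ω : Type*) [Field Ω] (i j : Fin 6) : Fin 6 → Ω := Pi.single i 1 - Pi.single j 1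

theorem rootVec_apply (i j k : Fin 6) :
    rootVec Ω i j k = (if k = i then 1 else 0) - (if k = j then 1 else 0) := by
  simp [rootVec, Pi.single_apply]

theorem sum_rootVec (i j : Fin 6) : ∑ k, rootVec Ω i j k = 0 := by
  simp [rootVec_apply]

theorem sum_mul_rootVec (x : Fin 6 → Ω) (i j : Fin 6) :
    ∑ k, x k * rootVec Ω i j k = x i - x j := by
  simp [rootVec_apply, mul_sub]

/-- The cubic form of the Segre cubic, polarized. -/
def tri (x y z : Fin 6 → Ω) : Ω := ∑ i, x i * y i * z i

/-- Equality of the cubes of two systems of linear forms can be polarized. -/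
theorem tri_eq_of_cube_eq [CharZero Ω] {f g : W →ₗ[Ω] (Fin 6 → Ω)} {c : Ω}
    (h : ∀ w, ∑ i, g w i ^ 3 = c * ∑ i, f w i ^ 3) (x y z : W) :
    tri (g x) (g y) (g z) = c * tri (f x) (f y) (f z) := by
  have key : ∀ k : W →ₗ[Ω] (Fin 6 → Ω), 6 * tri (k x) (k y) (k z) =
      ∑ i, k (x + y + z) i ^ 3 - ∑ i, k (x + y) i ^ 3 - ∑ i, k (y + z) i ^ 3
        - ∑ i, k (x + z) i ^ 3 + ∑ i, k x i ^ 3 + ∑ i, k y i ^ 3 + ∑ i, k z i ^ 3 := by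
    intro k
    simp only [tri, map_add, Pi.add_apply, Finset.mul_sum, ← Finset.sum_sub_distrib,
      ← Finset.sum_add_distrib]
    exact Finset.sum_congr rfl fun i _ => by ring
  have h6 : (6 : Ω) ≠ 0 := by norm_num
  apply mul_left_cancel₀ h6
  rw [key g, mul_left_comm, key f]
  simp only [h]
  ring

/-- Testing the kernel condition against the vector mapped to `eᵢ - eⱼ` shows that the products of
corresponding coordinates all agree. -/
theorem IsSumZeroIso.mul_eq_mul {f : W →ₗ[Ω] (Fin 6 → Ω)} (hf : IsSumZeroIso f) {v x : W}
    (h : ∀ y, tri (f v) (f x) (f y) = 0) (i j : Fin 6) : f v i * f x i = f v j * f x j := by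
  obtain ⟨w, hw⟩ := hf.surj _ (sum_rootVec i j)
  have := h w
  rw [tri, hw, sum_mul_rootVec] at this
  exact sub_eq_zero.mp this

/-- At most two coordinates of `x` are nonzero. -/
def HasSmallSupport (x : Fin 6 → Ω) : Prop :=
  ∀ i j k, i ≠ j → i ≠ k → j ≠ k → x i ≠ 0 → x j ≠ 0 → x k = 0

/-- Kernel vectors have constant product with `f v`. If no coordinate of `f v` is zero, one
coordinate of `f x` determines the rest. If one is zero, the constant is zero, so `f x` lives on the
at most three zeros of `f v`, and one of those coordinates follows from the sum being zero. -/
theorem IsSumZeroIso.exists_small_determining {f : W →ₗ[Ω] (Fin 6 → Ω)} (hf : IsSumZeroIso f)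
    {v : W} (hv : ¬ HasSmallSupport (f v)) :
    ∃ J : Finset (Fin 6), J.card ≤ 2 ∧ ∀ x, (∀ y, tri (f v) (f x) (f y) = 0) →
      (∀ j ∈ J, f x j = 0) → x = 0 := by
  simp only [HasSmallSupport, not_forall] at hv
  obtain ⟨i, j, k, hij, hik, hjk, hi, hj, hk⟩ := hv
  have hcard : (Finset.univ \ {i, j, k} : Finset (Fin 6)).card = 3 := by
    rw [Finset.card_sdiff_of_subset (Finset.subset_univ _),
      Finset.card_eq_three.mpr ⟨i, j, k, hij, hik, hjk, rfl⟩]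
    simp
  by_cases h0 : ∃ i₀, f v i₀ = 0
  · obtain ⟨i₀, hi₀⟩ := h0
    have hmem : i₀ ∈ (Finset.univ \ {i, j, k} : Finset (Fin 6)) := by
      simp only [Finset.mem_sdiff, Finset.mem_univ, true_and, Finset.mem_insert,
        Finset.mem_singleton, not_or]
      refine ⟨?_, ?_, ?_⟩ <;> rintro rfl <;> contradiction
    refine ⟨(Finset.univ \ {i, j, k}).erase i₀, ?_, fun x hx hx0 => hf.inj x ?_⟩
    · rw [Finset.card_erase_of_mem hmem]; omega
    have h2 : ∀ c, c ≠ i₀ → f x c = 0 := by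
      intro c hc
      by_cases hcS : f v c = 0
      · refine hx0 c (Finset.mem_erase.mpr ⟨hc, ?_⟩)
        simp only [Finset.mem_sdiff, Finset.mem_univ, true_and, Finset.mem_insert,
          Finset.mem_singleton, not_or]
        refine ⟨?_, ?_, ?_⟩ <;> rintro rfl <;> contradiction
      · have h1 := hf.mul_eq_mul hx c i₀
        rw [hi₀, zero_mul] at h1
        exact (mul_eq_zero.mp h1).resolve_left hcS
    have h3 : f x i₀ = 0 := by
      rw [← hf.sum_eq x, Finset.sum_eq_single i₀ (fun i _ hi => h2 i hi) (by simp)]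
    funext c
    by_cases hc : c = i₀
    · rw [hc, h3]; rfl
    · exact h2 c hc
  · push Not at h0
    refine ⟨{0}, by simp, fun x hx hx0 => hf.inj x (funext fun c => ?_)⟩
    have h1 := hf.mul_eq_mul hx c 0
    rw [hx0 0 (by simp), mul_zero] at h1
    exact (mul_eq_zero.mp h1).resolve_left (h0 c)

/-- Otherwise two coordinates would embed the span of the three vectors `k a`, which lie in the
kernel of the form attached to `v`, in a space of dimension at most two. -/
theorem IsSumZeroIso.hasSmallSupport {f : W →ₗ[Ω] (Fin 6 → Ω)} (hf : IsSumZeroIso f)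
    {v : W} {k : Fin 3 → W} (hk : LinearIndependent Ω k)
    (h : ∀ a y, tri (f v) (f (k a)) (f y) = 0) :
    HasSmallSupport (f v) := by
  by_contra hlt
  obtain ⟨J, hJ, hJ0⟩ := hf.exists_small_determining hlt
  let r : W →ₗ[Ω] (J → Ω) := (LinearMap.funLeft Ω Ω ((↑) : J → Fin 6)).comp f
  have hlin : LinearIndependent Ω (fun a => r (k a)) := by
    rw [Fintype.linearIndependent_iff]
    intro g hg
    have h0 : ∑ a, g a • k a = 0 := by
      apply hJ0
      · intro y
        have : tri (f v) (f (∑ a, g a • k a)) (f y) = ∑ a, g a * tri (f v) (f (k a)) (f y) := by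
          simp only [tri, map_sum, map_smul, Finset.sum_apply, Pi.smul_apply, smul_eq_mul,
            Finset.mul_sum, Finset.sum_mul]
          rw [Finset.sum_comm]
          exact Finset.sum_congr rfl fun _ _ => Finset.sum_congr rfl fun _ _ => by ring
        rw [this]
        simp [h]
      · intro j hj
        have := congrFun hg ⟨j, hj⟩
        simpa [r, LinearMap.funLeft_apply] using this
    exact Fintype.linearIndependent_iff.mp hk g h0
  have := hlin.fintype_card_le_finrank
  simp at this
  omega

theorem exists_three_others (i j : Fin 6) (hij : i ≠ j) : ∃ k l m n : Fin 6,
    k ≠ l ∧ k ≠ m ∧ k ≠ n ∧ l ≠ m ∧ l ≠ n ∧ m ≠ n ∧ k ≠ i ∧ l ≠ i ∧ m ≠ i ∧ n ≠ i ∧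
      k ≠ j ∧ l ≠ j ∧ m ≠ j ∧ n ≠ j := by
  revert i j; decide

/-- Converse to `IsSumZeroIso.hasSmallSupport` for roots: the roots on the four remaining indices
have support disjoint from `eᵢ - eⱼ`, so they lie in the kernel, and they span a space of dimension
three. -/
theorem IsSumZeroIso.exists_linearIndependent {f : W →ₗ[Ω] (Fin 6 → Ω)} (hf : IsSumZeroIso f)
    {v : W} {i j : Fin 6} (hij : i ≠ j) (hv : f v = rootVec Ω i j) :
    ∃ k : Fin 3 → W, LinearIndependent Ω k ∧ ∀ a y, tri (f v) (f (k a)) (f y) = 0 := by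
  obtain ⟨k, l, m, n, h1, h2, h3, h4, h5, h6, hki, hli, hmi, hni, hkj, hlj, hmj, hnj⟩ :=
    exists_three_others i j hij
  obtain ⟨u, hu⟩ := hf.surj _ (sum_rootVec k l)
  obtain ⟨u', hu'⟩ := hf.surj _ (sum_rootVec k m)
  obtain ⟨u'', hu''⟩ := hf.surj _ (sum_rootVec k n)
  refine ⟨![u, u', u''], ?_, ?_⟩
  · rw [Fintype.linearIndependent_iff]
    intro g hg
    have hg' := congrArg f hg
    simp only [Fin.sum_univ_three, map_add, map_smul, map_zero, Matrix.cons_val] at hg'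
    rw [hu, hu', hu''] at hg'
    have e1 := congrFun hg' l
    have e2 := congrFun hg' m
    have e3 := congrFun hg' n
    simp [rootVec_apply, h4, h5, h6, h1.symm, h2.symm, h3.symm, h4.symm, h5.symm,
      h6.symm] at e1 e2 e3
    intro a
    fin_cases a <;> assumption
  · intro a y
    have : ∀ b, b ≠ i → b ≠ j → k ≠ i → k ≠ j → ∀ x, f x = rootVec Ω k b →
        tri (f v) (f x) (f y) = 0 := by
      intro b hb hb' hk hk' x hx
      rw [tri, hv, hx]
      refine Finset.sum_eq_zero fun c _ => ?_
      rw [rootVec_apply, rootVec_apply]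
      by_cases hc : c = i
      · subst hc; simp [hb.symm, hk.symm]
      · by_cases hc' : c = j
        · subst hc'; simp [hb'.symm, hk'.symm]
        · simp [hc, hc']
    fin_cases a
    · exact this l hli hlj hki hkj u hu
    · exact this m hmi hmj hki hkj u' hu'
    · exact this n hni hnj hki hkj u'' hu''

theorem eq_smul_rootVec {x : Fin 6 → Ω} (hx : x ≠ 0) (hs : ∑ i, x i = 0)
    (h4 : HasSmallSupport x) :
    ∃ (α : Ω) (a b : Fin 6), α ≠ 0 ∧ a ≠ b ∧ x = α • rootVec Ω a b := by
  obtain ⟨a, ha⟩ := Function.ne_iff.mp hx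
  have hb : ∃ b, b ≠ a ∧ x b ≠ 0 := by
    by_contra hcon
    push Not at hcon
    rw [Finset.sum_eq_single a (fun i _ hi => hcon i hi) (by simp)] at hs
    exact ha hs
  obtain ⟨b, hba, hb⟩ := hb
  have hc : ∀ c, c ≠ a → c ≠ b → x c = 0 := by
    intro c hca hcb
    exact h4 a b c hba.symm hca.symm hcb.symm ha hb
  have hab : x b = - x a := by
    have := Finset.sum_eq_add a b hba.symm (f := x) (s := Finset.univ)
      (fun c _ hc' => hc c hc'.1 hc'.2) (by simp) (by simp)
    rw [hs] at this
    exact eq_neg_of_add_eq_zero_right this.symm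
  refine ⟨x a, a, b, ha, hba.symm, funext fun c => ?_⟩
  simp only [Pi.smul_apply, rootVec_apply, smul_eq_mul]
  by_cases h1 : c = a
  · subst h1; simp [hba.symm]
  · by_cases h2 : c = b
    · subst h2; simp [hba, hab]
    · simp [h1, h2, hc c h1 h2]

/-- Two roots whose difference is a root share an index, with the same sign. -/
theorem smul_rootVec_adjacent {α : Ω} {a b : Fin 6} (hα : α ≠ 0) (hab : a ≠ b)
    {v : Fin 6 → Ω} (hs : ∑ i, v i = 0)
    (hv : HasSmallSupport v)
    (hd : HasSmallSupport (α • rootVec Ω a b - v))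
    (hne : ∀ c : Ω, v ≠ c • rootVec Ω a b) :
    (∃ c, c ≠ a ∧ c ≠ b ∧ v = α • rootVec Ω a c) ∨
      ∃ c, c ≠ a ∧ c ≠ b ∧ v = α • rootVec Ω c b := by
  obtain ⟨β, c, d, hβ, hcd, rfl⟩ :=
    eq_smul_rootVec (fun h => hne 0 (by rw [h, zero_smul])) hs hv
  have val : ∀ k, (α • rootVec Ω a b - β • rootVec Ω c d) k =
      α * ((if k = a then 1 else 0) - (if k = b then 1 else 0)) -
        β * ((if k = c then 1 else 0) - (if k = d then 1 else 0)) := by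
    intro k; simp [rootVec_apply]
  by_cases hca : c = a
  · subst hca
    by_cases hdb : d = b
    · subst hdb; exact absurd rfl (hne β)
    left
    refine ⟨d, hcd.symm, hdb, ?_⟩
    -- Two coordinates of the difference are visibly nonzero, so every third one vanishes. At the
    -- shared index this compares `α` with `β`. The other cases use the same device.
    have h1 := hd b d c (Ne.symm hdb) hab.symm hcd.symm
      (by rw [val]; simp [hab.symm, Ne.symm hdb, hα]) (by rw [val]; simp [hcd.symm, hdb, hβ])
    rw [val] at h1
    simp [hab, hcd, sub_eq_zero] at h1
    rw [h1]
  by_cases hdb : d = b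
  · subst hdb
    right
    refine ⟨c, hca, hcd, ?_⟩
    have h1 := hd a c d (Ne.symm hca) hab hcd
      (by rw [val]; simp [hab, Ne.symm hca, hα]) (by rw [val]; simp [hca, hcd, hβ])
    rw [val] at h1
    simp [hab.symm, hcd.symm] at h1
    have : α = β := by linear_combination -h1
    rw [this]
  by_cases hcb : c = b
  · subst hcb
    by_cases hda : d = a
    · subst hda
      refine absurd (funext fun k => ?_) (hne (-β))
      simp only [Pi.smul_apply, rootVec_apply, smul_eq_mul]; ring
    · right
      have h1 := hd a d c (Ne.symm hda) hab hcd.symm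
        (by rw [val]; simp [hab, Ne.symm hda, hα]) (by rw [val]; simp [hcd.symm, hda, hβ])
      rw [val] at h1
      simp [hab.symm, hcd] at h1
      refine ⟨d, hda, hdb, funext fun k => ?_⟩
      simp only [Pi.smul_apply, rootVec_apply, smul_eq_mul]
      linear_combination (-(if k = c then 1 else 0) + (if k = d then 1 else 0)) * h1
  by_cases hda : d = a
  · subst hda
    left
    have h1 := hd b c d (Ne.symm hcb) hab.symm hcd
      (by rw [val]; simp [hab.symm, Ne.symm hcb, hα]) (by rw [val]; simp [hcd, hcb, hβ])
    rw [val] at h1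
    simp [hab, hcd.symm] at h1
    refine ⟨c, hca, hcb, funext fun k => ?_⟩
    simp only [Pi.smul_apply, rootVec_apply, smul_eq_mul]
    linear_combination ((if k = c then 1 else 0) - (if k = d then 1 else 0)) * h1
  · exfalso
    have h1 := hd a b c hab (Ne.symm hca) (Ne.symm hcb)
      (by rw [val]; simp [hab, Ne.symm hca, Ne.symm hda, hα])
      (by rw [val]; simp [hab.symm, Ne.symm hcb, Ne.symm hdb, hα])
    rw [val] at h1
    simp [hca, hcb, hcd, hβ] at h1

/-- Two identifications of a space with the hyperplane `∑ xᵢ = 0` under which the cubics `∑ xᵢ³`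
correspond up to a factor differ by a permutation of the coordinates and a scalar. -/
theorem exists_perm_of_tri_eq [CharZero Ω] {f g : W →ₗ[Ω] (Fin 6 → Ω)} (hf : IsSumZeroIso f)
    (hg : IsSumZeroIso g) {c : Ω}
    (h : ∀ x y z, tri (g x) (g y) (g z) = c * tri (f x) (f y) (f z)) :
    ∃ (κ : Ω) (π : Equiv.Perm (Fin 6)), κ ≠ 0 ∧ ∀ w i, g w (π i) = κ * f w i := by
  have hsm : ∀ (w : W) (i j : Fin 6), i ≠ j → f w = rootVec Ω i j → HasSmallSupport (g w) := by
    intro w i j hij hw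
    obtain ⟨k, hk, hk0⟩ := hf.exists_linearIndependent hij hw
    exact hg.hasSmallSupport hk fun a y => by rw [h, hk0, mul_zero]
  -- The `r j` with `j ≠ 0` form a basis of `W`; they and their differences map to roots under `f`,
  -- so to multiples of roots under `g`. The value `r 0 = 0` is harmless.
  choose r hr using fun j : Fin 6 => hf.surj _ (sum_rootVec (0 : Fin 6) j)
  have hdiff : ∀ i j, f (r i - r j) = rootVec Ω j i := by
    intro i j
    rw [map_sub, hr, hr, rootVec, rootVec, rootVec]; abel
  have hsr : ∀ j, j ≠ 0 → HasSmallSupport (g (r j)) := fun j hj => hsm _ _ _ hj.symm (hr j)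
  have hsd : ∀ i j, i ≠ j → HasSmallSupport (g (r i) - g (r j)) := by
    intro i j hij
    rw [← map_sub]
    exact hsm _ _ _ hij.symm (hdiff i j)
  have hind : ∀ i j, i ≠ 0 → j ≠ 0 → i ≠ j → ∀ c : Ω, g (r i) ≠ c • g (r j) := by
    intro i j hi hj hij c hc
    have h0 : r i - c • r j = 0 := hg.inj _ (by rw [map_sub, map_smul, hc, sub_self])
    have h1 := congrFun (congrArg f h0) i
    rw [map_sub, map_smul, hr, hr, map_zero] at h1
    simp [rootVec_apply, hi, hij] at h1
  have hne : ∀ j, j ≠ 0 → g (r j) ≠ 0 := by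
    intro j hj h0
    have h1 := congrFun (congrArg f (hg.inj _ h0)) j
    rw [hr, map_zero] at h1
    simp [rootVec_apply, hj] at h1
  obtain ⟨α, a, b, hα, hab, h1⟩ := eq_smul_rootVec (hne 1 (by decide)) (hg.sum_eq _)
    (hsr 1 (by decide))
  have adj : ∀ (i : Fin 6) (α : Ω) (a b : Fin 6), α ≠ 0 → a ≠ b → i ≠ 0 →
      g (r i) = α • rootVec Ω a b → ∀ j, j ≠ 0 → j ≠ i →
      (∃ c, c ≠ a ∧ c ≠ b ∧ g (r j) = α • rootVec Ω a c) ∨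
        ∃ c, c ≠ a ∧ c ≠ b ∧ g (r j) = α • rootVec Ω c b := by
    intro i α a b hα hab hi hri j hj hji
    refine smul_rootVec_adjacent hα hab (hg.sum_eq _) (hsr j hj) ?_ ?_
    · rw [← hri]; exact hsd i j hji.symm
    · intro c hc
      refine hind j i hj hi hji (c * α⁻¹) ?_
      rw [hri, smul_smul, mul_assoc, inv_mul_cancel₀ hα, mul_one, hc]
  -- Pairwise adjacent roots could share an index either in a star or in a mixed configuration. With
  -- two of them sharing the positive index `a`, a third not sharing it would have to meet both at
  -- negative indices, which is impossible as `2 ≠ 0`. A shared negative index is turned into a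
  -- positive one by replacing `α` with `-α`.
  have star : ∃ (α : Ω) (a : Fin 6), α ≠ 0 ∧ ∀ j, j ≠ 0 → ∃ b, b ≠ a ∧
      g (r j) = α • rootVec Ω a b := by
    have main : ∀ (α : Ω) (a b c : Fin 6), α ≠ 0 → a ≠ b → c ≠ a → c ≠ b →
        g (r 1) = α • rootVec Ω a b → g (r 2) = α • rootVec Ω a c →
        ∀ j, j ≠ 0 → ∃ b, b ≠ a ∧ g (r j) = α • rootVec Ω a b := by
      intro α a b c hα hab hca hcb h1 h2 j hj
      by_cases hj1 : j = 1
      · exact ⟨b, hab.symm, by rw [hj1, h1]⟩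
      by_cases hj2 : j = 2
      · exact ⟨c, hca, by rw [hj2, h2]⟩
      rcases adj 1 α a b hα hab (by decide) h1 j hj hj1 with ⟨d, hda, hdb, hd⟩ | ⟨d, hda, hdb, hd⟩
      · exact ⟨d, hda, hd⟩
      exfalso
      rcases adj 2 α a c hα hca.symm (by decide) h2 j hj hj2 with
        ⟨e, hea, hec, he⟩ | ⟨e, hea, hec, he⟩
      · have := congrFun (hd.symm.trans he) a
        simp [rootVec_apply, hda.symm, hab, hea.symm] at this
        exact hα this.symm
      · have := congrFun (hd.symm.trans he) b
        by_cases hbe : b = e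
        · simp [rootVec_apply, hdb.symm, hbe.symm, hcb.symm] at this
          have h2 : (2 : Ω) * α = 0 := by linear_combination -this
          simp [hα] at h2
        · simp [rootVec_apply, hdb.symm, hbe, hcb.symm, hα] at this
    rcases adj 1 α a b hα hab (by decide) h1 2 (by decide) (by decide) with
      ⟨c, hca, hcb, hc⟩ | ⟨c, hca, hcb, hc⟩
    · exact ⟨α, a, hα, main α a b c hα hab hca hcb h1 hc⟩
    · have hneg : ∀ a b, α • rootVec Ω a b = (-α) • rootVec Ω b a := by
        intro a b
        rw [rootVec, rootVec, neg_smul, ← smul_neg, neg_sub]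
      rw [hneg] at h1 hc
      exact ⟨-α, b, neg_ne_zero.mpr hα,
        main (-α) b a c (neg_ne_zero.mpr hα) hab.symm hcb hca h1 hc⟩
  obtain ⟨α, a, hα, hstar⟩ := star
  choose! p hp using hstar
  -- The centre of the star is the image of the index `0`, which all `e₀ - eⱼ` share.
  let π : Fin 6 → Fin 6 := fun j => if j = 0 then a else p j
  have hinj : Function.Injective π := by
    intro i j hij
    by_contra hne'
    by_cases hi : i = 0
    · have hj : j ≠ 0 := fun hj => hne' (hi.trans hj.symm)
      simp only [π, hi, hj, if_true, if_false] at hij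
      exact (hp j hj).1 hij.symm
    · by_cases hj : j = 0
      · simp only [π, hi, hj, if_true, if_false] at hij
        exact (hp i hi).1 hij
      · simp only [π, hi, hj, if_false] at hij
        refine hind i j hi hj hne' 1 ?_
        rw [(hp i hi).2, (hp j hj).2, hij, one_smul]
  refine ⟨α, Equiv.ofBijective π (Finite.injective_iff_bijective.mp hinj), hα, fun w i => ?_⟩
  -- As the coordinates of `f w` sum to zero, `f w = -∑ (f w)ⱼ (e₀ - eⱼ)`.
  have hw : w = ∑ j, (-f w j) • r j := by
    rw [← sub_eq_zero]
    apply hf.inj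
    funext k
    simp only [map_sub, map_sum, map_smul, hr, Pi.sub_apply, Finset.sum_apply, Pi.smul_apply,
      rootVec_apply, smul_eq_mul, mul_sub, Finset.sum_sub_distrib, Pi.zero_apply]
    simp only [← Finset.sum_mul, Finset.sum_neg_distrib, hf.sum_eq]
    simp
  have hgr : ∀ j, g (r j) = α • rootVec Ω a (π j) := by
    intro j
    by_cases hj : j = 0
    · have h0 : r j = 0 := hf.inj _ (by rw [hr, hj, rootVec, sub_self])
      rw [h0, map_zero]
      simp [π, hj, rootVec]
    · simp only [π, hj, if_false]; exact (hp j hj).2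
  have : g w (π i) = ∑ j, (-f w j) * (α * rootVec Ω a (π j) (π i)) := by
    conv_lhs => rw [hw]
    simp [map_sum, hgr]
  rw [Equiv.ofBijective_apply, this]
  simp only [rootVec_apply, hinj.eq_iff, mul_sub, Finset.sum_sub_distrib]
  simp only [← Finset.sum_mul, Finset.sum_neg_distrib, hf.sum_eq]
  simp [mul_comm]

/-- Three numbers with sum `s` have sum of cubes `s³` minus three times the product of their
pairwise sums, and the two halves of `x` have opposite sums. This is the shape `Y₁Y₂Y₃ + Z₁Z₂Z₃ = 0`
used throughout. -/
theorem sum_cube_eq (x : Fin 6 → Ω) (hx : ∑ i, x i = 0) : ∑ i, x i ^ 3 =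
    -3 * ((x 1 + x 2) * (x 0 + x 2) * (x 0 + x 1) + (x 4 + x 5) * (x 3 + x 5) * (x 3 + x 4)) := by
  simp only [Fin.sum_univ_six] at hx ⊢
  have h : x 5 = -(x 0 + x 1 + x 2 + x 3 + x 4) := by linear_combination hx
  rw [h]; ring

/-- A cubic form that vanishes on the Segre cubic is a multiple of its equation. -/
theorem exists_cube_eq_of_vanish [CharZero Ω] {f g : W →ₗ[Ω] (Fin 6 → Ω)} (hf : IsSumZeroIso f)
    (h : ∀ w, ∑ i, f w i ^ 3 = 0 → ∑ i, g w i ^ 3 = 0) :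
    ∃ c : Ω, ∀ w, ∑ i, g w i ^ 3 = c * ∑ i, f w i ^ 3 := by
  have hE : ∀ v : Fin 6 → Ω, ∑ i, v i = 0 → ∃ w, f w = v := hf.surj
  -- The basis is chosen so that the coordinates `a, b, c, d, e` are half of `x₁ + x₂`, `x₀ + x₂`,
  -- `x₀ + x₁`, `x₄ + x₅`, `x₃ + x₅`.
  obtain ⟨E₁, h₁⟩ := hE ![-1, 1, 1, -1, -1, 1] (by simp [Fin.sum_univ_six])
  obtain ⟨E₂, h₂⟩ := hE ![1, -1, 1, -1, -1, 1] (by simp [Fin.sum_univ_six])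
  obtain ⟨E₃, h₃⟩ := hE ![1, 1, -1, -1, -1, 1] (by simp [Fin.sum_univ_six])
  obtain ⟨E₄, h₄⟩ := hE ![0, 0, 0, -2, 0, 2] (by simp [Fin.sum_univ_six])
  obtain ⟨E₅, h₅⟩ := hE ![0, 0, 0, 0, -2, 2] (by simp [Fin.sum_univ_six])
  let w (a b c d e : Ω) : W := a • E₁ + b • E₂ + c • E₃ + d • E₄ + e • E₅
  have hw : ∀ a b c d e, f (w a b c d e) = ![-a + b + c, a - b + c, a + b - c,
      -a - b - c - 2 * d, -a - b - c - 2 * e, a + b + c + 2 * d + 2 * e] := by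
    intro a b c d e
    funext i
    simp only [w, map_add, map_smul, h₁, h₂, h₃, h₄, h₅]
    fin_cases i <;> simp <;> ring
  have hf3 : ∀ a b c d e, ∑ i, f (w a b c d e) i ^ 3 =
      -24 * (a * b * c - d * e * (a + b + c + d + e)) := by
    intro a b c d e
    rw [sum_cube_eq _ (hf.sum_eq _), hw]
    simp
    ring
  have hsurj : ∀ x, ∃ a b c d e, x = w a b c d e := by
    intro x
    refine ⟨(f x 1 + f x 2) / 2, (f x 0 + f x 2) / 2, (f x 0 + f x 1) / 2, (f x 4 + f x 5) / 2,
      (f x 3 + f x 5) / 2, ?_⟩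
    rw [← sub_eq_zero]
    apply hf.inj
    have hs := hf.sum_eq x
    rw [Fin.sum_univ_six] at hs
    have e3 : f x 3 = -(f x 0 + f x 1 + f x 2 + f x 4 + f x 5) := by linear_combination hs
    rw [map_sub, hw]
    funext i
    fin_cases i <;> simp [e3] <;> ring
  let t (x y z : W) : Ω := tri (g x) (g y) (g z)
  have hg3 : ∀ a b c d e, ∑ i, g (w a b c d e) i ^ 3 =
      a ^ 3 * t E₁ E₁ E₁ + b ^ 3 * t E₂ E₂ E₂ + c ^ 3 * t E₃ E₃ E₃ + d ^ 3 * t E₄ E₄ E₄ +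
      e ^ 3 * t E₅ E₅ E₅ + 3 * (a ^ 2 * b * t E₁ E₁ E₂ + a ^ 2 * c * t E₁ E₁ E₃ +
      a ^ 2 * d * t E₁ E₁ E₄ + a ^ 2 * e * t E₁ E₁ E₅ + b ^ 2 * a * t E₂ E₂ E₁ +
      b ^ 2 * c * t E₂ E₂ E₃ + b ^ 2 * d * t E₂ E₂ E₄ + b ^ 2 * e * t E₂ E₂ E₅ +
      c ^ 2 * a * t E₃ E₃ E₁ + c ^ 2 * b * t E₃ E₃ E₂ + c ^ 2 * d * t E₃ E₃ E₄ +
      c ^ 2 * e * t E₃ E₃ E₅ + d ^ 2 * a * t E₄ E₄ E₁ + d ^ 2 * b * t E₄ E₄ E₂ +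
      d ^ 2 * c * t E₄ E₄ E₃ + d ^ 2 * e * t E₄ E₄ E₅ + e ^ 2 * a * t E₅ E₅ E₁ +
      e ^ 2 * b * t E₅ E₅ E₂ + e ^ 2 * c * t E₅ E₅ E₃ + e ^ 2 * d * t E₅ E₅ E₄) +
      6 * (a * b * c * t E₁ E₂ E₃ + a * b * d * t E₁ E₂ E₄ + a * b * e * t E₁ E₂ E₅ +
      a * c * d * t E₁ E₃ E₄ + a * c * e * t E₁ E₃ E₅ + a * d * e * t E₁ E₄ E₅ +
      b * c * d * t E₂ E₃ E₄ + b * c * e * t E₂ E₃ E₅ + b * d * e * t E₂ E₄ E₅ +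
      c * d * e * t E₃ E₄ E₅) := by
    intro a b c d e
    simp only [w, t, tri, map_add, map_smul, Pi.add_apply, Pi.smul_apply, smul_eq_mul,
      Finset.mul_sum, ← Finset.sum_add_distrib]
    exact Finset.sum_congr rfl fun i _ => by ring
  have pol : ∀ x y z : W, (∀ p q r : Ω, ∑ i, f (p • x + q • y + r • z) i ^ 3 = 0) →
      t x y z = 0 := by
    intro x y z hxyz
    have key : 6 * t x y z =
        ∑ i, g ((1 : Ω) • x + (1 : Ω) • y + (1 : Ω) • z) i ^ 3
        - ∑ i, g ((1 : Ω) • x + (1 : Ω) • y + (0 : Ω) • z) i ^ 3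
        - ∑ i, g ((0 : Ω) • x + (1 : Ω) • y + (1 : Ω) • z) i ^ 3
        - ∑ i, g ((1 : Ω) • x + (0 : Ω) • y + (1 : Ω) • z) i ^ 3
        + ∑ i, g ((1 : Ω) • x + (0 : Ω) • y + (0 : Ω) • z) i ^ 3
        + ∑ i, g ((0 : Ω) • x + (1 : Ω) • y + (0 : Ω) • z) i ^ 3
        + ∑ i, g ((0 : Ω) • x + (0 : Ω) • y + (1 : Ω) • z) i ^ 3 := by
      simp only [t, tri, map_add, map_smul, Pi.add_apply, Pi.smul_apply, smul_eq_mul,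
        Finset.mul_sum, ← Finset.sum_add_distrib, ← Finset.sum_sub_distrib]
      exact Finset.sum_congr rfl fun i _ => by ring
    simp only [h _ (hxyz _ _ _)] at key
    simpa using key
  -- The cubic contains the six linear subspaces where one of `a, b, c` and one of `d, e` vanish, so
  -- the polarized form of `g` is zero on each. This kills 29 of the 35 coefficients.
  have van : ∀ a b c d e a' b' c' d' e' a'' b'' c'' d'' e'' : Ω,
      (a = 0 ∧ a' = 0 ∧ a'' = 0 ∨ b = 0 ∧ b' = 0 ∧ b'' = 0 ∨ c = 0 ∧ c' = 0 ∧ c'' = 0) →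
      (d = 0 ∧ d' = 0 ∧ d'' = 0 ∨ e = 0 ∧ e' = 0 ∧ e'' = 0) →
      t (w a b c d e) (w a' b' c' d' e') (w a'' b'' c'' d'' e'') = 0 := by
    intro a b c d e a' b' c' d' e' a'' b'' c'' d'' e'' hY hZ
    refine pol _ _ _ fun p q r => ?_
    have : p • w a b c d e + q • w a' b' c' d' e' + r • w a'' b'' c'' d'' e'' =
        w (p * a + q * a' + r * a'') (p * b + q * b' + r * b'') (p * c + q * c' + r * c'')
          (p * d + q * d' + r * d'') (p * e + q * e' + r * e'') := by
      simp only [w]; module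
    rw [this, hf3]
    rcases hY with ⟨h1, h2, h3⟩ | ⟨h1, h2, h3⟩ | ⟨h1, h2, h3⟩ <;>
      rcases hZ with ⟨h4, h5, h6⟩ | ⟨h4, h5, h6⟩ <;> simp [h1, h2, h3, h4, h5, h6]
  have w1 : E₁ = w 1 0 0 0 0 := by simp [w]
  have w2 : E₂ = w 0 1 0 0 0 := by simp [w]
  have w3 : E₃ = w 0 0 1 0 0 := by simp [w]
  have w4 : E₄ = w 0 0 0 1 0 := by simp [w]
  have w5 : E₅ = w 0 0 0 0 1 := by simp [w]
  have hg4 : ∀ a b c d e, ∑ i, g (w a b c d e) i ^ 3 = 6 * a * b * c * t E₁ E₂ E₃ +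
      d * e * (6 * a * t E₁ E₄ E₅ + 6 * b * t E₂ E₄ E₅ + 6 * c * t E₃ E₄ E₅ +
        3 * d * t E₄ E₄ E₅ + 3 * e * t E₅ E₅ E₄) := by
    intro a b c d e
    have z : t E₁ E₁ E₁ = 0 ∧ t E₂ E₂ E₂ = 0 ∧ t E₃ E₃ E₃ = 0 ∧ t E₄ E₄ E₄ = 0 ∧
        t E₅ E₅ E₅ = 0 ∧ t E₁ E₁ E₂ = 0 ∧ t E₁ E₁ E₃ = 0 ∧ t E₁ E₁ E₄ = 0 ∧ t E₁ E₁ E₅ = 0 ∧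
        t E₂ E₂ E₁ = 0 ∧ t E₂ E₂ E₃ = 0 ∧ t E₂ E₂ E₄ = 0 ∧ t E₂ E₂ E₅ = 0 ∧ t E₃ E₃ E₁ = 0 ∧
        t E₃ E₃ E₂ = 0 ∧ t E₃ E₃ E₄ = 0 ∧ t E₃ E₃ E₅ = 0 ∧ t E₄ E₄ E₁ = 0 ∧ t E₄ E₄ E₂ = 0 ∧
        t E₄ E₄ E₃ = 0 ∧ t E₅ E₅ E₁ = 0 ∧ t E₅ E₅ E₂ = 0 ∧ t E₅ E₅ E₃ = 0 ∧ t E₁ E₂ E₄ = 0 ∧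
        t E₁ E₂ E₅ = 0 ∧ t E₁ E₃ E₄ = 0 ∧ t E₁ E₃ E₅ = 0 ∧ t E₂ E₃ E₄ = 0 ∧ t E₂ E₃ E₅ = 0 := by
      rw [w1, w2, w3, w4, w5]
      refine ⟨?_, ?_, ?_, ?_, ?_, ?_, ?_, ?_, ?_, ?_, ?_, ?_, ?_, ?_, ?_, ?_, ?_, ?_, ?_, ?_, ?_,
        ?_, ?_, ?_, ?_, ?_, ?_, ?_, ?_⟩ <;> exact van _ _ _ _ _ _ _ _ _ _ _ _ _ _ _
          (by simp) (by simp)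
    obtain ⟨z1, z2, z3, z4, z5, z6, z7, z8, z9, z10, z11, z12, z13, z14, z15, z16, z17, z18, z19,
      z20, z21, z22, z23, z24, z25, z26, z27, z28, z29⟩ := z
    rw [hg3, z1, z2, z3, z4, z5, z6, z7, z8, z9, z10, z11, z12, z13, z14, z15, z16, z17, z18, z19,
      z20, z21, z22, z23, z24, z25, z26, z27, z28, z29]
    ring
  have pt : ∀ a b c d e, a * b * c - d * e * (a + b + c + d + e) = 0 →
      6 * a * b * c * t E₁ E₂ E₃ +
      d * e * (6 * a * t E₁ E₄ E₅ + 6 * b * t E₂ E₄ E₅ + 6 * c * t E₃ E₄ E₅ +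
        3 * d * t E₄ E₄ E₅ + 3 * e * t E₅ E₅ E₄) = 0 := by
    intro a b c d e h0
    rw [← hg4]
    exact h _ (by rw [hf3, h0, mul_zero])
  -- Five points of the cubic supply the linear relations expressing the five remaining coefficients
  -- through that of `a b c`.
  have p1 := pt (-2) 0 0 1 1 (by norm_num)
  have p2 := pt 0 (-2) 0 1 1 (by norm_num)
  have p3 := pt 0 0 (-2) 1 1 (by norm_num)
  have p4 := pt (-3) 0 0 1 2 (by norm_num)
  have p5 := pt 1 1 1 (-1) (-1) (by norm_num)
  refine ⟨-t E₁ E₂ E₃ / 4, fun x => ?_⟩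
  obtain ⟨a, b, c, d, e, rfl⟩ := hsurj x
  rw [hf3, hg4]
  linear_combination d * e * (a * (p5 + p2 / 2 + p3 / 2) + b * (p5 + p1 / 2 + p3 / 2) +
    c * (p5 + p1 / 2 + p2 / 2) + d * (p5 + p2 / 2 + p3 / 2 + 2 * p1 - p4 / 2) +
    e * (p5 + p2 / 2 + p3 / 2 + p4 / 2 - p1))

end SumZero

end SegreCubic

/-! ### Curves of bidegree `(3, 3)` with nine singular points. -/

namespace SegreCubic

section BinaryCubics

variable {Ω : Type*} [Field Ω]

/-- A nonzero family in a principal ideal domain is a multiple of a unimodular one. -/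
theorem exists_unimodular_factor {R ι : Type*} [CommRing R] [IsDomain R] [IsPrincipalIdealRing R]
    [Fintype ι] (P : ι → R) (hP : ∃ i, P i ≠ 0) :
    ∃ (S : R) (Q x : ι → R), S ≠ 0 ∧ (∀ i, P i = S * Q i) ∧ ∑ i, x i * Q i = 1 := by
  set I := Ideal.span (Set.range P) with hI
  obtain ⟨S, hS⟩ := (IsPrincipalIdealRing.principal I).principal
  have h1 : ∀ i, ∃ q, P i = S * q := by
    intro i
    have : P i ∈ I := Ideal.subset_span ⟨i, rfl⟩
    rw [hS, Submodule.mem_span_singleton] at this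
    obtain ⟨q, hq⟩ := this
    exact ⟨q, by rw [← hq, smul_eq_mul, mul_comm]⟩
  choose Q hQ using h1
  have hS0 : S ≠ 0 := by
    rintro rfl
    obtain ⟨i, hi⟩ := hP
    exact hi (by rw [hQ, zero_mul])
  have h2 : S ∈ I := by rw [hS]; exact Submodule.mem_span_singleton_self S
  rw [hI, Ideal.mem_span_range_iff_exists_fun] at h2
  obtain ⟨x, hx⟩ := h2
  refine ⟨S, Q, x, hS0, hQ, mul_left_cancel₀ hS0 ?_⟩
  rw [mul_one]
  conv_rhs => rw [← hx]
  rw [Finset.mul_sum]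
  exact Finset.sum_congr rfl fun i _ => by rw [hQ i]; ring

/-- A singular point `(s; u : v)` of the curve `a u³ + b u² v + c u v² + d v³ = 0`, the coefficients
being polynomials in the first variable. -/
def IsCurveSing (a b c d : Polynomial Ω) (s u v : Ω) : Prop :=
  3 * a.eval s * u ^ 2 + 2 * b.eval s * u * v + c.eval s * v ^ 2 = 0 ∧
  b.eval s * u ^ 2 + 2 * c.eval s * u * v + 3 * d.eval s * v ^ 2 = 0 ∧
  a.derivative.eval s * u ^ 3 + b.derivative.eval s * u ^ 2 * v + c.derivative.eval s * u * v ^ 2 +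
    d.derivative.eval s * v ^ 3 = 0

/-- The discriminant of the binary cubic `a u³ + b u² v + c u v² + d v³`. -/
def cubicDisc {R : Type*} [CommRing R] (a b c d : R) : R :=
  b ^ 2 * c ^ 2 - 4 * (a * c ^ 3) - 4 * (b ^ 3 * d) - 27 * (a ^ 2 * d ^ 2) + 18 * (a * b * (c * d))

theorem natDegree_cubicDisc_le {a b c d : Polynomial Ω} {n : ℕ} (ha : a.natDegree ≤ n)
    (hb : b.natDegree ≤ n) (hc : c.natDegree ≤ n) (hd : d.natDegree ≤ n) :
    (cubicDisc a b c d).natDegree ≤ 4 * n := by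
  have m : ∀ {p q : Polynomial Ω} {i j : ℕ}, p.natDegree ≤ i * n → q.natDegree ≤ j * n →
      (p * q).natDegree ≤ (i + j) * n := by
    intro p q i j hp hq
    rw [add_mul]
    exact Polynomial.natDegree_mul_le_of_le hp hq
  have pw : ∀ {p : Polynomial Ω} (k : ℕ), p.natDegree ≤ n → (p ^ k).natDegree ≤ k * n :=
    fun k hp => Polynomial.natDegree_pow_le_of_le k hp
  have nm : ∀ {p : Polynomial Ω} (k : ℕ), p.natDegree ≤ 4 * n →
      ((k : Polynomial Ω) * p).natDegree ≤ 4 * n := by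
    intro p k hp
    calc _ ≤ 0 + 4 * n := Polynomial.natDegree_mul_le_of_le (Polynomial.natDegree_natCast k).le hp
      _ = _ := zero_add _
  have o : ∀ {p : Polynomial Ω}, p.natDegree ≤ n → p.natDegree ≤ 1 * n := by
    intro p h; rwa [one_mul]
  have sb : ∀ {p q : Polynomial Ω}, p.natDegree ≤ 4 * n → q.natDegree ≤ 4 * n →
      (p - q).natDegree ≤ 4 * n :=
    fun hp hq => (Polynomial.natDegree_sub_le_of_le hp hq).trans (max_self _).le
  unfold cubicDisc
  refine Polynomial.natDegree_add_le_of_degree_le (sb (sb (sb ?_ ?_) ?_) ?_) ?_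
  · exact m (i := 2) (j := 2) (pw 2 hb) (pw 2 hc)
  · exact nm 4 (m (i := 1) (j := 3) (o ha) (pw 3 hc))
  · exact nm 4 (m (i := 3) (j := 1) (pw 3 hb) (o hd))
  · exact nm 27 (m (i := 2) (j := 2) (pw 2 ha) (pw 2 hd))
  · exact nm 18 (m (i := 2) (j := 2) (m (i := 1) (j := 1) (o ha) (o hb))
      (m (i := 1) (j := 1) (o hc) (o hd)))

/-- A binary cubic with vanishing discriminant has a multiple factor, already over the ring of
coefficients. -/
theorem exists_double_root_of_cubicDisc_eq_zero {R : Type*} [CommRing R] [IsDomain R] [CharZero R]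
    {a b c d : R} (h : cubicDisc a b c d = 0) :
    ∃ u v : R, (u ≠ 0 ∨ v ≠ 0) ∧ 3 * a * u ^ 2 + 2 * b * u * v + c * v ^ 2 = 0 ∧
      b * u ^ 2 + 2 * c * u * v + 3 * d * v ^ 2 = 0 := by
  unfold cubicDisc at h
  -- The Hessian covariant `(b² - 3ac) u² + (bc - 9ad) u v + (c² - 3bd) v²` has discriminant `-3`
  -- times that of the cubic. When this is zero and the Hessian is not, the double root of the
  -- Hessian is that of the cubic, and its coordinates are polynomials in the coefficients. When the
  -- Hessian vanishes the cubic is a cube, up to a constant over the fraction field.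
  by_cases h1 : b ^ 2 - 3 * a * c = 0
  · by_cases h2 : c ^ 2 - 3 * b * d = 0
    · have h3 : (9 * a * d - b * c) ^ 2 = 0 := by
        linear_combination 4 * (c ^ 2 - 3 * b * d) * h1 - 3 * h
      have h4 : 9 * a * d - b * c = 0 := by simpa using h3
      by_cases ha : a = 0
      · have hb : b = 0 := by simpa [ha] using h1
        exact ⟨1, 0, Or.inl one_ne_zero, by simp [ha], by simp [hb]⟩
      · refine ⟨-b, 3 * a, Or.inr (mul_ne_zero (OfNat.ofNat_ne_zero 3) ha), ?_, ?_⟩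
        · linear_combination -3 * a * h1
        · linear_combination b * h1 + 3 * a * h4
    · refine ⟨2 * (c ^ 2 - 3 * b * d), 9 * a * d - b * c,
        Or.inl (mul_ne_zero two_ne_zero h2), ?_, ?_⟩
      · linear_combination (-3 * c) * h
      · linear_combination (-9 * d) * h
  · refine ⟨9 * a * d - b * c, 2 * (b ^ 2 - 3 * a * c),
      Or.inr (mul_ne_zero two_ne_zero h1), ?_, ?_⟩
    · linear_combination (-9 * a) * h
    · linear_combination (-3 * b) * h

theorem exists_three_roots [IsAlgClosed Ω] {a b c d : Ω} (ha : a ≠ 0)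
    (h : ∀ u, a * u ^ 3 + b * u ^ 2 + c * u + d = 0 → 3 * a * u ^ 2 + 2 * b * u + c ≠ 0) :
    ∃ x y z : Ω, x ≠ y ∧ x ≠ z ∧ y ≠ z ∧
      b = -a * (x + y + z) ∧ c = a * (x * y + x * z + y * z) ∧ d = -a * (x * y * z) := by
  set P : Cubic Ω := ⟨a, b, c, d⟩
  have hs : (P.toPoly.map (RingHom.id Ω)).Splits := IsAlgClosed.splits _
  obtain ⟨x, y, z, h3⟩ := (Cubic.splits_iff_roots_eq_three (P := P) ha).mp hs
  have hb : b = a * -(x + y + z) := Cubic.b_eq_three_roots (P := P) (φ := RingHom.id Ω) ha h3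
  have hc : c = a * (x * y + x * z + y * z) :=
    Cubic.c_eq_three_roots (P := P) (φ := RingHom.id Ω) ha h3
  have hd : d = a * -(x * y * z) := Cubic.d_eq_three_roots (P := P) (φ := RingHom.id Ω) ha h3
  refine ⟨x, y, z, ?_, ?_, ?_, by rw [hb]; ring, hc, by rw [hd]; ring⟩
  · rintro rfl
    exact h x (by rw [hb, hc, hd]; ring) (by rw [hb, hc]; ring)
  · rintro rfl
    exact h x (by rw [hb, hc, hd]; ring) (by rw [hb, hc]; ring)
  · rintro rfl
    exact h y (by rw [hb, hc, hd]; ring) (by rw [hb, hc]; ring)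

theorem two_mul_card_le_natDegree [CharZero Ω] {D : Polynomial Ω} (hD : D ≠ 0) (T : Finset Ω)
    (h : ∀ x ∈ T, D.eval x = 0 ∧ D.derivative.eval x = 0) : 2 * T.card ≤ D.natDegree := by
  classical
  have hm : ∀ x ∈ T, 2 ≤ D.roots.count x := by
    intro x hx
    rw [Polynomial.count_roots]
    exact (Polynomial.one_lt_rootMultiplicity_iff_isRoot hD).mpr (h x hx)
  have hT : T ⊆ D.roots.toFinset := by
    intro x hx
    rw [Multiset.mem_toFinset, Polynomial.mem_roots hD]
    exact (h x hx).1
  calc 2 * T.card = ∑ x ∈ T, 2 := by rw [Finset.sum_const, smul_eq_mul, mul_comm]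
    _ ≤ ∑ x ∈ T, D.roots.count x := Finset.sum_le_sum hm
    _ ≤ ∑ x ∈ D.roots.toFinset, D.roots.count x :=
        Finset.sum_le_sum_of_subset_of_nonneg hT fun _ _ _ => Nat.zero_le _
    _ = D.roots.card := Multiset.toFinset_sum_count_eq _
    _ ≤ D.natDegree := Polynomial.card_roots' D

theorem card_le_three_of_cubic_roots {a b c d : Ω} (h : ¬ (a = 0 ∧ b = 0 ∧ c = 0 ∧ d = 0))
    (T : Finset Ω) (hT : ∀ u ∈ T, a * u ^ 3 + b * u ^ 2 + c * u + d = 0) : T.card ≤ 3 := by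
  classical
  set P : Cubic Ω := ⟨a, b, c, d⟩
  have hP : P.toPoly ≠ 0 := by
    intro h0
    rw [Cubic.toPoly_eq_zero_iff] at h0
    exact h ⟨congrArg Cubic.a h0, congrArg Cubic.b h0, congrArg Cubic.c h0, congrArg Cubic.d h0⟩
  have hsub : T ⊆ P.toPoly.roots.toFinset := by
    intro u hu
    rw [Multiset.mem_toFinset, Polynomial.mem_roots hP, Polynomial.IsRoot.def]
    simpa [Cubic.toPoly, P] using hT u hu
  calc T.card ≤ P.toPoly.roots.toFinset.card := Finset.card_le_card hsub
    _ ≤ P.toPoly.roots.card := Multiset.toFinset_card_le _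
    _ ≤ P.toPoly.natDegree := Polynomial.card_roots' _
    _ ≤ 3 := by
      exact Polynomial.natDegree_cubic_le

/-- A binary cubic has at most one double root. -/
theorem cubic_eq_zero_of_two_double_roots {a b c d u w : Ω} (huw : u ≠ w) [CharZero Ω]
    (h1 : 3 * a * u ^ 2 + 2 * b * u + c = 0) (h2 : b * u ^ 2 + 2 * c * u + 3 * d = 0)
    (h3 : 3 * a * w ^ 2 + 2 * b * w + c = 0) (h4 : b * w ^ 2 + 2 * c * w + 3 * d = 0) :
    a = 0 ∧ b = 0 ∧ c = 0 ∧ d = 0 := by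
  have hn : u - w ≠ 0 := sub_ne_zero.mpr huw
  have e1 : 3 * a * (u + w) + 2 * b = 0 := mul_left_cancel₀ hn (by linear_combination h1 - h3)
  have e2 : b * (u + w) + 2 * c = 0 := mul_left_cancel₀ hn (by linear_combination h2 - h4)
  have e3 : a * (u - w) ^ 2 = 0 := by
    have : (3 : Ω) * (a * (u - w) ^ 2) = 0 := by
      linear_combination 2 * (h1 + h3) - 2 * e2 - (u + w) * e1
    simpa using this
  have ha : a = 0 := by simpa [hn] using e3
  have hb : b = 0 := by simpa [ha] using e1
  have hc : c = 0 := by simpa [hb] using e2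
  exact ⟨ha, hb, hc, by simpa [hb, hc] using h2⟩

/-- Over a factor that is free of the first variable, a multiple component is singular. -/
theorem isCurveSing_of_double_root [CharZero Ω] {S a b c d u v : Polynomial Ω}
    (h1 : 3 * a * u ^ 2 + 2 * b * u * v + c * v ^ 2 = 0)
    (h2 : b * u ^ 2 + 2 * c * u * v + 3 * d * v ^ 2 = 0) (x : Ω) :
    IsCurveSing (S * a) (S * b) (S * c) (S * d) x (u.eval x) (v.eval x) := by
  have h3 : a * u ^ 3 + b * u ^ 2 * v + c * u * v ^ 2 + d * v ^ 3 = 0 := by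
    have : (3 : Polynomial Ω) * (a * u ^ 3 + b * u ^ 2 * v + c * u * v ^ 2 + d * v ^ 3) = 0 := by
      linear_combination u * h1 + v * h2
    simpa using this
  have h4 : a.derivative * u ^ 3 + b.derivative * u ^ 2 * v + c.derivative * u * v ^ 2 +
      d.derivative * v ^ 3 = 0 := by
    have := congrArg Polynomial.derivative h3
    simp only [Polynomial.derivative_add, Polynomial.derivative_mul, Polynomial.derivative_pow,
      Polynomial.derivative_zero] at this
    simp at this
    have h2' : Polynomial.C (2 : Ω) = 2 := rfl
    have h3' : Polynomial.C (3 : Ω) = 3 := rfl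
    rw [h2', h3'] at this
    linear_combination this - u.derivative * h1 - v.derivative * h2
  have e1 := congrArg (Polynomial.eval x) h1
  have e2 := congrArg (Polynomial.eval x) h2
  have e3 := congrArg (Polynomial.eval x) h3
  have e4 := congrArg (Polynomial.eval x) h4
  simp at e1 e2 e3 e4
  refine ⟨?_, ?_, ?_⟩
  · simp only [Polynomial.eval_mul]; linear_combination S.eval x * e1
  · simp only [Polynomial.eval_mul]; linear_combination S.eval x * e2
  · simp only [Polynomial.derivative_mul, Polynomial.eval_mul, Polynomial.eval_add]
    linear_combination S.eval x * e4 + S.derivative.eval x * e3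

/-- A curve of bidegree `(3, 3)` in `ℙ¹ × ℙ¹` with exactly nine singular points is a union of three
lines of one ruling and three lines of the other. -/
theorem exists_factorization_of_nine_sing [CharZero Ω] [IsAlgClosed Ω] {a b c d : Polynomial Ω}
    (ha : a.natDegree ≤ 3) (hb : b.natDegree ≤ 3) (hc : c.natDegree ≤ 3) (hd : d.natDegree ≤ 3)
    (hfin : {s | ∃ u v, (u ≠ 0 ∨ v ≠ 0) ∧ IsCurveSing a b c d s u v}.Finite)
    (hfib : ∀ s, {u | IsCurveSing a b c d s u 1}.Finite)
    (hinf : ∀ s u, IsCurveSing a b c d s u 0 → u = 0)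
    (p : Fin 9 → Ω × Ω) (hp : Function.Injective p)
    (hsing : ∀ i, IsCurveSing a b c d (p i).1 (p i).2 1) :
    ∃ κ s₁ s₂ s₃ r₁ r₂ r₃ : Ω, κ ≠ 0 ∧ s₁ ≠ s₂ ∧ s₁ ≠ s₃ ∧ s₂ ≠ s₃ ∧ r₁ ≠ r₂ ∧ r₁ ≠ r₃ ∧ r₂ ≠ r₃ ∧
      ∀ x u v, a.eval x * u ^ 3 + b.eval x * u ^ 2 * v + c.eval x * u * v ^ 2 +
        d.eval x * v ^ 3 =
        κ * ((x - s₁) * (x - s₂) * (x - s₃)) * ((u - r₁ * v) * (u - r₂ * v) * (u - r₃ * v)) := by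
  classical
  have hne : ∃ i, ![a, b, c, d] i ≠ 0 := by
    by_contra hcon
    push Not at hcon
    have h0 : a = 0 := hcon 0
    have h1 : b = 0 := hcon 1
    have h2 : c = 0 := hcon 2
    have h3 : d = 0 := hcon 3
    exact one_ne_zero (hinf 0 1 (by simp [IsCurveSing, h0, h1, h2, h3]))
  -- The content `S` collects the lines on which the first variable is constant; the cofactors have
  -- no common zero.
  obtain ⟨S, Q, y, hS0, hQ, hy⟩ := exists_unimodular_factor _ hne
  obtain ⟨a', rfl⟩ : ∃ a', a = S * a' := ⟨_, hQ 0⟩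
  obtain ⟨b', rfl⟩ : ∃ b', b = S * b' := ⟨_, hQ 1⟩
  obtain ⟨c', rfl⟩ : ∃ c', c = S * c' := ⟨_, hQ 2⟩
  obtain ⟨d', rfl⟩ : ∃ d', d = S * d' := ⟨_, hQ 3⟩
  have q0 : Q 0 = a' := (mul_left_cancel₀ hS0 (hQ 0)).symm
  have q1 : Q 1 = b' := (mul_left_cancel₀ hS0 (hQ 1)).symm
  have q2 : Q 2 = c' := (mul_left_cancel₀ hS0 (hQ 2)).symm
  have q3 : Q 3 = d' := (mul_left_cancel₀ hS0 (hQ 3)).symm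
  have hcop : ∀ x, ¬ (a'.eval x = 0 ∧ b'.eval x = 0 ∧ c'.eval x = 0 ∧ d'.eval x = 0) := by
    rintro x ⟨h0, h1, h2, h3⟩
    have := congrArg (Polynomial.eval x) hy
    simp [Fin.sum_univ_four, q0, q1, q2, q3, h0, h1, h2, h3] at this
  have hdeg : ∀ q : Polynomial Ω, (S * q).natDegree ≤ 3 → q ≠ 0 →
      S.natDegree + q.natDegree ≤ 3 := by
    intro q hq hq0
    rwa [Polynomial.natDegree_mul hS0 hq0] at hq
  have hk3 : S.natDegree ≤ 3 := by
    by_contra hk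
    have hz : ∀ q : Polynomial Ω, (S * q).natDegree ≤ 3 → q = 0 := by
      intro q hq
      by_contra hq0
      have := hdeg q hq hq0
      omega
    exact hcop 0 ⟨by rw [hz _ ha]; simp, by rw [hz _ hb]; simp, by rw [hz _ hc]; simp,
      by rw [hz _ hd]; simp⟩
  have hdeg' : ∀ q : Polynomial Ω, (S * q).natDegree ≤ 3 → q.natDegree ≤ 3 - S.natDegree := by
    intro q hq
    by_cases hq0 : q = 0
    · simp [hq0]
    · have := hdeg q hq hq0
      omega
  -- the discriminant of the primitive part does not vanish
  have hD : cubicDisc a' b' c' d' ≠ 0 := by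
    intro hD
    obtain ⟨u, v, huv, h1, h2⟩ := exists_double_root_of_cubicDisc_eq_zero hD
    have hinfinite : {x | u.eval x ≠ 0 ∨ v.eval x ≠ 0}.Infinite := by
      have : ∀ w : Polynomial Ω, w ≠ 0 → {x | w.eval x ≠ 0}.Infinite := by
        intro w hw
        have hf : {x | w.eval x = 0}.Finite := by
          refine (w.roots.toFinset.finite_toSet).subset fun x hx => ?_
          rw [Finset.mem_coe, Multiset.mem_toFinset, Polynomial.mem_roots hw]
          exact hx
        have := hf.infinite_compl
        exact this
      rcases huv with hu | hv
      · exact (this u hu).mono fun x hx => Or.inl hx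
      · exact (this v hv).mono fun x hx => Or.inr hx
    exact hinfinite (hfin.subset fun x hx => ⟨_, _, hx, isCurveSing_of_double_root h1 h2 x⟩)
  -- the factor `S` is squarefree
  have hSsep : ∀ r, S.eval r = 0 → S.derivative.eval r ≠ 0 := by
    intro r hr hr'
    have : {u | IsCurveSing (S * a') (S * b') (S * c') (S * d') r u 1} = Set.univ := by
      ext u
      simp [IsCurveSing, Polynomial.derivative_mul, hr, hr']
    exact Set.infinite_univ (this ▸ hfib r)
  have onS : ∀ s u, IsCurveSing (S * a') (S * b') (S * c') (S * d') s u 1 → S.eval s = 0 →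
      a'.eval s * u ^ 3 + b'.eval s * u ^ 2 + c'.eval s * u + d'.eval s = 0 := by
    intro s u h hs
    have := h.2.2
    simp only [Polynomial.derivative_mul, Polynomial.eval_add, Polynomial.eval_mul, hs] at this
    refine (mul_eq_zero.mp ?_).resolve_left (hSsep s hs)
    linear_combination this
  have offS : ∀ s u, IsCurveSing (S * a') (S * b') (S * c') (S * d') s u 1 → S.eval s ≠ 0 →
      IsCurveSing a' b' c' d' s u 1 := by
    rintro s u ⟨h1, h2, h3⟩ hs
    simp only [Polynomial.derivative_mul, Polynomial.eval_add, Polynomial.eval_mul] at h1 h2 h3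
    have e1 : 3 * a'.eval s * u ^ 2 + 2 * b'.eval s * u * 1 + c'.eval s * 1 ^ 2 = 0 :=
      (mul_eq_zero.mp (by linear_combination h1)).resolve_left hs
    have e2 : b'.eval s * u ^ 2 + 2 * c'.eval s * u * 1 + 3 * d'.eval s * 1 ^ 2 = 0 :=
      (mul_eq_zero.mp (by linear_combination h2)).resolve_left hs
    refine ⟨e1, e2, (mul_eq_zero.mp ?_).resolve_left hs⟩
    linear_combination h3 - S.derivative.eval s * (u * e1 + e2) / 3
  set I₁ := Finset.univ.filter fun i => S.eval (p i).1 = 0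
  set I₂ := Finset.univ.filter fun i => ¬ S.eval (p i).1 = 0
  have hI : I₁.card + I₂.card = 9 := by
    have := Finset.card_filter_add_card_filter_not (s := (Finset.univ : Finset (Fin 9)))
      (fun i => S.eval (p i).1 = 0)
    simpa using this
  -- Over a root of `S` a singular point must be a zero of the primitive cubic, so there are at most
  -- three per root.
  have hI₁ : I₁.card ≤ 3 * S.roots.toFinset.card := by
    refine Finset.card_le_mul_card_image_of_maps_to (f := fun i => (p i).1) ?_ 3 ?_
    · intro i hi
      rw [Multiset.mem_toFinset, Polynomial.mem_roots hS0]
      exact (Finset.mem_filter.mp hi).2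
    · intro r hr
      rw [Multiset.mem_toFinset, Polynomial.mem_roots hS0] at hr
      have hinj : Set.InjOn (fun i => (p i).2) ({i ∈ I₁ | (p i).1 = r} : Finset (Fin 9)) := by
        intro i hi j hj hij
        have hi' := (Finset.mem_filter.mp hi).2
        have hj' := (Finset.mem_filter.mp hj).2
        exact hp (Prod.ext (hi'.trans hj'.symm) hij)
      rw [← Finset.card_image_of_injOn hinj]
      refine card_le_three_of_cubic_roots (hcop r) _ fun u hu => ?_
      obtain ⟨i, hi, rfl⟩ := Finset.mem_image.mp hu
      have hi' := (Finset.mem_filter.mp hi).2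
      rw [← hi']
      exact onS _ _ (hsing i) (by rw [hi']; exact hr)
  -- Away from `S` a singular point gives a double zero of the discriminant, of degree at most `4 (3
  -- - deg S)`. Different points give different zeros, because a nonzero binary cubic cannot have
  -- two double roots.
  have hI₂ : 2 * I₂.card ≤ 4 * (3 - S.natDegree) := by
    have hinj : Set.InjOn (fun i => (p i).1) I₂ := by
      intro i hi j hj hij
      have hi' := offS _ _ (hsing i) (Finset.mem_filter.mp hi).2
      have hj' := offS _ _ (hsing j) (Finset.mem_filter.mp hj).2
      replace hij : (p i).1 = (p j).1 := hij
      refine hp (Prod.ext hij ?_)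
      by_contra hne
      rw [hij] at hi'
      refine hcop (p j).1 (cubic_eq_zero_of_two_double_roots hne ?_ ?_ ?_ ?_)
      · simpa using hi'.1
      · simpa using hi'.2.1
      · simpa using hj'.1
      · simpa using hj'.2.1
    rw [← Finset.card_image_of_injOn hinj]
    refine (two_mul_card_le_natDegree hD _ fun x hx => ?_).trans
      (natDegree_cubicDisc_le (hdeg' _ ha) (hdeg' _ hb) (hdeg' _ hc) (hdeg' _ hd))
    obtain ⟨i, hi, rfl⟩ := Finset.mem_image.mp hx
    obtain ⟨h1, h2, h3⟩ := offS _ _ (hsing i) (Finset.mem_filter.mp hi).2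
    generalize (p i).1 = s at *
    generalize (p i).2 = u at *
    -- Solving the singularity equations for `c`, `d` and the derivative of `d` turns the vanishing
    -- of the discriminant and of its derivative into polynomial identities.
    have hc0 : c'.eval s = -3 * a'.eval s * u ^ 2 - 2 * b'.eval s * u := by linear_combination h1
    have hd0 : d'.eval s = 2 * a'.eval s * u ^ 3 + b'.eval s * u ^ 2 := by
      linear_combination (1 / 3) * h2 - (2 / 3) * u * h1
    have hd1 : d'.derivative.eval s = - (a'.derivative.eval s * u ^ 3 +
      b'.derivative.eval s * u ^ 2 + c'.derivative.eval s * u) := by linear_combination h3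
    constructor
    · simp only [cubicDisc, Polynomial.eval_add, Polynomial.eval_sub, Polynomial.eval_mul,
        Polynomial.eval_pow, Polynomial.eval_ofNat, hc0, hd0]
      ring
    · simp only [cubicDisc, Polynomial.derivative_add, Polynomial.derivative_sub,
        Polynomial.derivative_mul, Polynomial.derivative_pow, Polynomial.derivative_ofNat,
        Polynomial.eval_add, Polynomial.eval_sub, Polynomial.eval_mul, Polynomial.eval_zero,
        Polynomial.eval_pow, Polynomial.eval_ofNat, Polynomial.eval_C, hc0, hd0, hd1]
      push_cast
      ring
  have hR : S.roots.toFinset.card ≤ S.natDegree :=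
    (Multiset.toFinset_card_le _).trans (Polynomial.card_roots' S)
  -- With `k = deg S ≤ 3` the two counts give `9 ≤ 3 k + 2 (3 - k)`, hence `k = 3`. The primitive
  -- part is then constant in the first variable.
  have hk : S.natDegree = 3 := by omega
  have hconst : ∀ q : Polynomial Ω, (S * q).natDegree ≤ 3 → q = Polynomial.C (q.coeff 0) := by
    intro q hq
    refine Polynomial.eq_C_of_natDegree_le_zero ?_
    have := hdeg' q hq
    omega
  obtain ⟨α, rfl⟩ : ∃ α, a' = Polynomial.C α := ⟨_, hconst _ ha⟩
  obtain ⟨β, rfl⟩ : ∃ α, b' = Polynomial.C α := ⟨_, hconst _ hb⟩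
  obtain ⟨γ, rfl⟩ : ∃ α, c' = Polynomial.C α := ⟨_, hconst _ hc⟩
  obtain ⟨δ, rfl⟩ : ∃ α, d' = Polynomial.C α := ⟨_, hconst _ hd⟩
  have hSe : ∀ x, S.eval x = S.coeff 3 * x ^ 3 + S.coeff 2 * x ^ 2 + S.coeff 1 * x +
      S.coeff 0 := by
    intro x
    rw [Polynomial.eval_eq_sum_range, hk]
    simp [Finset.sum_range_succ]
    ring
  have hSd : ∀ x, S.derivative.eval x = 3 * S.coeff 3 * x ^ 2 + 2 * S.coeff 2 * x +
      S.coeff 1 := by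
    intro x
    rw [Polynomial.derivative_eval, Polynomial.sum_over_range' _ _ 4 (by omega)]
    · simp [Finset.sum_range_succ]
      ring
    · simp
  have hS3 : S.coeff 3 ≠ 0 := by
    rw [← hk]
    exact Polynomial.leadingCoeff_ne_zero.mpr hS0
  obtain ⟨s₁, s₂, s₃, h12, h13, h23, e2, e1, e0⟩ := exists_three_roots hS3 (fun u hu => by
    rw [← hSd]; exact hSsep u (by rw [hSe, hu]))
  -- Otherwise the constant cubic vanishes at `(1 : 0)`, and this point on the line over `s₁` is
  -- singular, against `hinf`.
  have hα : α ≠ 0 := by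
    rintro rfl
    refine one_ne_zero (hinf s₁ 1 ?_)
    have hs : S.eval s₁ = 0 := by rw [hSe, e2, e1, e0]; ring
    simp [IsCurveSing, hs]
  obtain ⟨r₁, r₂, r₃, g12, g13, g23, f2, f1, f0⟩ := exists_three_roots (b := β) (c := γ) (d := δ) hα
    (fun u hu hu' => by
      -- A double root `u` of the constant cubic would be a double line of the second ruling, with a
      -- singular point over every `s`.
      have : {s | ∃ u v, (u ≠ 0 ∨ v ≠ 0) ∧ IsCurveSing (S * Polynomial.C α) (S * Polynomial.C β)
          (S * Polynomial.C γ) (S * Polynomial.C δ) s u v} = Set.univ := by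
        ext s
        simp only [Set.mem_ofPred_eq, Set.mem_univ, iff_true]
        refine ⟨u, 1, Or.inr one_ne_zero, ?_, ?_, ?_⟩
        · simp; linear_combination S.eval s * hu'
        · simp; linear_combination S.eval s * (3 * hu - u * hu')
        · simp; linear_combination S.derivative.eval s * hu
      exact Set.infinite_univ (this ▸ hfin))
  refine ⟨S.coeff 3 * α, s₁, s₂, s₃, r₁, r₂, r₃, mul_ne_zero hS3 hα, h12, h13, h23, g12, g13, g23,
    fun x u v => ?_⟩
  simp only [Polynomial.eval_mul, Polynomial.eval_C, hSe, f2, f1, f0, e2, e1, e0]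
  ring

end BinaryCubics

end SegreCubic

/-! ### Polarization of cubic forms. -/

namespace SegreCubic

section Polarization

variable {K Ω : Type*} [Field K] [Field Ω] [Algebra K Ω]

/-- Symmetric trilinear forms. -/
structure IsSymmTri {V : Type*} [AddCommGroup V] [Module Ω V]
    (T : V →ₗ[Ω] V →ₗ[Ω] V →ₗ[Ω] Ω) : Prop where
  swap₁ : ∀ x y z, T x y z = T y x z
  swap₂ : ∀ x y z, T x y z = T x z y

theorem aeval_euler {n m : ℕ} {F : MvPolynomial (Fin n) K} (hF : F.IsHomogeneous m)
    (v : Fin n → Ω) : ∑ i, v i * aeval v (pderiv i F) = m * aeval v F := by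
  have := congrArg (aeval v) hF.sum_X_mul_pderiv
  simpa using this

theorem pderiv_comm' {n : ℕ} (i j : Fin n) (F : MvPolynomial (Fin n) K) :
    pderiv i (pderiv j F) = pderiv j (pderiv i F) := by
  have h : ⁅(pderiv i : Derivation K (MvPolynomial (Fin n) K) (MvPolynomial (Fin n) K)),
      (pderiv j : Derivation K (MvPolynomial (Fin n) K) (MvPolynomial (Fin n) K))⁆ = 0 := by
    apply MvPolynomial.derivation_ext
    intro k
    simp [Derivation.commutator_apply, pderiv_X, Pi.single_apply, apply_ite]
  have := congrArg (fun D : Derivation K (MvPolynomial (Fin n) K) (MvPolynomial (Fin n) K) => D F) h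
  simpa [Derivation.commutator_apply, sub_eq_zero] using this

theorem aeval_of_isHomogeneous_zero {n : ℕ} {F : MvPolynomial (Fin n) K}
    (hF : F.IsHomogeneous 0) (v : Fin n → Ω) : aeval v F = algebraMap K Ω (F.coeff 0) := by
  rw [(totalDegree_eq_zero_iff_eq_C (p := F)).mp (by simpa using hF.totalDegree_le)]
  simp

/-- The symmetric trilinear form of a cubic form. -/
theorem exists_polarization [CharZero Ω] {n : ℕ} {F : MvPolynomial (Fin n) K}
    (hF : F.IsHomogeneous 3) :
    ∃ T : (Fin n → Ω) →ₗ[Ω] (Fin n → Ω) →ₗ[Ω] (Fin n → Ω) →ₗ[Ω] Ω, IsSymmTri T ∧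
      (∀ v, aeval v F = T v v v) ∧ (∀ v i, aeval v (pderiv i F) = 3 * T v v (Pi.single i 1)) ∧
      ∀ v w i, (hessian F v).mulVec w i = 6 * T v w (Pi.single i 1) := by
  let c (i j k : Fin n) : Ω := algebraMap K Ω ((pderiv k (pderiv j (pderiv i F))).coeff 0)
  let T : (Fin n → Ω) →ₗ[Ω] (Fin n → Ω) →ₗ[Ω] (Fin n → Ω) →ₗ[Ω] Ω :=
    ∑ i, ∑ j, ∑ k, (c i j k / 6) • (LinearMap.proj i : (Fin n → Ω) →ₗ[Ω] Ω).smulRight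
      ((LinearMap.proj j : (Fin n → Ω) →ₗ[Ω] Ω).smulRight
        (LinearMap.proj k : (Fin n → Ω) →ₗ[Ω] Ω))
  have hT : ∀ x y z, T x y z = ∑ i, x i * ∑ j, y j * ∑ k, z k * (c i j k / 6) := by
    intro x y z
    simp only [T, LinearMap.sum_apply, LinearMap.smul_apply, LinearMap.smulRight_apply,
      LinearMap.proj_apply, smul_eq_mul, Finset.mul_sum]
    refine Finset.sum_congr rfl fun i _ => Finset.sum_congr rfl fun j _ =>
      Finset.sum_congr rfl fun k _ => by ring
  have hc1 : ∀ i j k, c i j k = c j i k := by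
    intro i j k; simp only [c]; rw [pderiv_comm' j i]
  have hc2 : ∀ i j k, c i j k = c i k j := by
    intro i j k; simp only [c]; rw [pderiv_comm' k j]
  -- The trilinear form is built from third partial derivatives; `e3`, `e2`, `e1` recover the lower
  -- derivatives and `F` by Euler's identity in degrees one, two and three.
  have e3 : ∀ v i j, ∑ k, v k * c i j k = aeval v (pderiv j (pderiv i F)) := by
    intro v i j
    have h := aeval_euler (hF.pderiv.pderiv : (pderiv j (pderiv i F)).IsHomogeneous 1) v
    rw [Nat.cast_one, one_mul] at h
    rw [← h]
    refine Finset.sum_congr rfl fun k _ => ?_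
    rw [aeval_of_isHomogeneous_zero
      (hF.pderiv.pderiv.pderiv : (pderiv k (pderiv j (pderiv i F))).IsHomogeneous 0)]
  have e2 : ∀ (v : Fin n → Ω) i,
      ∑ j, v j * aeval v (pderiv j (pderiv i F)) = 2 * aeval v (pderiv i F) := by
    intro v i
    rw [aeval_euler (hF.pderiv : (pderiv i F).IsHomogeneous 2) v]
    norm_num
  have e1 : ∀ v : Fin n → Ω, ∑ i, v i * aeval v (pderiv i F) = 3 * aeval v F := by
    intro v
    rw [aeval_euler hF v]
    norm_num
  have hs1 : ∀ x y z, T x y z = T y x z := by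
    intro x y z
    rw [hT, hT]
    simp only [Finset.mul_sum]
    rw [Finset.sum_comm]
    refine Finset.sum_congr rfl fun i _ => Finset.sum_congr rfl fun j _ =>
      Finset.sum_congr rfl fun k _ => by rw [hc1]; ring
  have hs2 : ∀ x y z, T x y z = T x z y := by
    intro x y z
    rw [hT, hT]
    simp only [Finset.mul_sum]
    refine Finset.sum_congr rfl fun i _ => ?_
    rw [Finset.sum_comm]
    refine Finset.sum_congr rfl fun j _ => Finset.sum_congr rfl fun k _ => by rw [hc2]; ring
  have hd : ∀ v w i, ∑ j, aeval v (pderiv i (pderiv j F)) * w j = 6 * T v w (Pi.single i 1) := by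
    intro v w i
    have hsw : T v w (Pi.single i 1) = T (Pi.single i 1) w v := by rw [hs2 v w, hs1 v, hs2 _ v]
    have hT' : T (Pi.single i 1) w v = ∑ j, w j * ∑ k, v k * (c i j k / 6) := by
      rw [hT, Finset.sum_eq_single i (fun b _ hb => by simp [hb]) (by simp), Pi.single_eq_same,
        one_mul]
    rw [hsw, hT', Finset.mul_sum]
    refine Finset.sum_congr rfl fun j _ => ?_
    rw [← e3, Finset.mul_sum, Finset.mul_sum, Finset.sum_mul]
    refine Finset.sum_congr rfl fun k _ => ?_
    rw [hc1]
    ring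
  refine ⟨T, ⟨hs1, hs2⟩, fun v => ?_, fun v i => ?_, fun v w i => ?_⟩
  · rw [hT]
    have : ∀ i j, ∑ k, v k * (c i j k / 6) = aeval v (pderiv j (pderiv i F)) / 6 := by
      intro i j
      rw [← e3, Finset.sum_div]
      exact Finset.sum_congr rfl fun k _ => by ring
    simp only [this]
    simp only [mul_div_assoc', ← Finset.sum_div, e2]
    have : ∀ i, v i * (2 * aeval v (pderiv i F)) = 2 * (v i * aeval v (pderiv i F)) := by
      intro i; ring
    simp only [this, ← Finset.mul_sum, e1]
    ring
  · have h := hd v v i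
    have h' := e2 v i
    have : ∑ j, aeval v (pderiv i (pderiv j F)) * v j = 2 * aeval v (pderiv i F) := by
      rw [← h']
      exact Finset.sum_congr rfl fun j _ => by rw [pderiv_comm', mul_comm]
    have h2 : (2 : Ω) ≠ 0 := two_ne_zero
    apply mul_left_cancel₀ h2
    rw [← this, h]; ring
  · rw [← hd]
    rfl

end Polarization

end SegreCubic

/-! ### Frames adapted to the tangent cone of a node. -/

namespace SegreCubic

section Frames

variable {Ω V : Type*} [Field Ω] [AddCommGroup V] [Module Ω V]
  {T : V →ₗ[Ω] V →ₗ[Ω] V →ₗ[Ω] Ω}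

/-- The vectors `e, w₁, …, w₄` span, `e` is a singular point of the cubic `T v v v = 0`, and the
quadratic form `T e` of its tangent cone is `2 δ (x₁ x₄ - x₂ x₃)`. -/
structure IsFrame (T : V →ₗ[Ω] V →ₗ[Ω] V →ₗ[Ω] Ω) (e w₁ w₂ w₃ w₄ : V) (δ : Ω) : Prop where
  symm : IsSymmTri T
  ne_zero : δ ≠ 0
  span : ∀ v, ∃ x₀ x₁ x₂ x₃ x₄ : Ω, v = x₀ • e + x₁ • w₁ + x₂ • w₂ + x₃ • w₃ + x₄ • w₄
  sing : ∀ y, T e e y = 0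
  h11 : T e w₁ w₁ = 0
  h12 : T e w₁ w₂ = 0
  h13 : T e w₁ w₃ = 0
  h14 : T e w₁ w₄ = δ
  h22 : T e w₂ w₂ = 0
  h23 : T e w₂ w₃ = -δ
  h24 : T e w₂ w₄ = 0
  h33 : T e w₃ w₃ = 0
  h34 : T e w₃ w₄ = 0
  h44 : T e w₄ w₄ = 0

namespace IsFrame

variable {e w₁ w₂ w₃ w₄ : V} {δ : Ω}

/-- In a frame the form `T e` is antidiagonal, so pairing with the `wᵢ` reads off all coordinates
except that of `e`, which spans its kernel. -/
theorem pair (h : IsFrame T e w₁ w₂ w₃ w₄ δ) (x₀ x₁ x₂ x₃ x₄ : Ω) (v : V)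
    (hv : v = x₀ • e + x₁ • w₁ + x₂ • w₂ + x₃ • w₃ + x₄ • w₄) :
    T e v w₁ = δ * x₄ ∧ T e v w₂ = -δ * x₃ ∧ T e v w₃ = -δ * x₂ ∧ T e v w₄ = δ * x₁ := by
  have h21 := (h.symm.swap₂ e w₂ w₁).trans h.h12
  have h31 := (h.symm.swap₂ e w₃ w₁).trans h.h13
  have h41 := (h.symm.swap₂ e w₄ w₁).trans h.h14
  have h32 := (h.symm.swap₂ e w₃ w₂).trans h.h23
  have h42 := (h.symm.swap₂ e w₄ w₂).trans h.h24
  have h43 := (h.symm.swap₂ e w₄ w₃).trans h.h34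
  subst hv
  simp only [map_add, map_smul, LinearMap.add_apply, LinearMap.smul_apply, smul_eq_mul, h.sing,
    h.h11, h.h12, h.h13, h.h14, h.h22, h.h23, h.h24, h.h33, h.h34, h.h44, h21, h31, h41, h32,
    h42, h43]
  refine ⟨?_, ?_, ?_, ?_⟩ <;> ring

/-- Change of basis in the first ruling. -/
theorem row (h : IsFrame T e w₁ w₂ w₃ w₄ δ) {p q r t : Ω} (hd : p * t - q * r ≠ 0) :
    IsFrame T e (p • w₁ + q • w₃) (p • w₂ + q • w₄) (r • w₁ + t • w₃) (r • w₂ + t • w₄)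
      ((p * t - q * r) * δ) := by
  have h21 := (h.symm.swap₂ e w₂ w₁).trans h.h12
  have h31 := (h.symm.swap₂ e w₃ w₁).trans h.h13
  have h41 := (h.symm.swap₂ e w₄ w₁).trans h.h14
  have h32 := (h.symm.swap₂ e w₃ w₂).trans h.h23
  have h42 := (h.symm.swap₂ e w₄ w₂).trans h.h24
  have h43 := (h.symm.swap₂ e w₄ w₃).trans h.h34
  refine ⟨h.symm, mul_ne_zero hd h.ne_zero, fun v => ?_, h.sing, ?_, ?_, ?_, ?_, ?_, ?_, ?_, ?_,
    ?_, ?_⟩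
  · obtain ⟨x₀, x₁, x₂, x₃, x₄, rfl⟩ := h.span v
    obtain ⟨i, hi⟩ : ∃ i, (p * t - q * r) * i = 1 := ⟨_, mul_inv_cancel₀ hd⟩
    refine ⟨x₀, (t * x₁ - r * x₃) * i, (t * x₂ - r * x₄) * i, (p * x₃ - q * x₁) * i,
      (p * x₄ - q * x₂) * i, ?_⟩
    match_scalars
    · ring
    · linear_combination (-x₁) * hi
    · linear_combination (-x₂) * hi
    · linear_combination (-x₃) * hi
    · linear_combination (-x₄) * hi
  all_goals
    simp only [map_add, map_smul, LinearMap.add_apply, LinearMap.smul_apply, smul_eq_mul,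
      h.h11, h.h12, h.h13, h.h14, h.h22, h.h23, h.h24, h.h33, h.h34, h.h44, h21, h31, h41, h32,
      h42, h43]
    ring

/-- Exchange of the two rulings. -/
theorem swap (h : IsFrame T e w₁ w₂ w₃ w₄ δ) : IsFrame T e w₁ w₃ w₂ w₄ δ where
  symm := h.symm
  ne_zero := h.ne_zero
  span v := by
    obtain ⟨x₀, x₁, x₂, x₃, x₄, rfl⟩ := h.span v
    exact ⟨x₀, x₁, x₃, x₂, x₄, by abel⟩
  sing := h.sing
  h11 := h.h11
  h12 := h.h13
  h13 := h.h12
  h14 := h.h14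
  h22 := h.h33
  h23 := (h.symm.swap₂ _ _ _).trans h.h23
  h24 := h.h34
  h33 := h.h22
  h34 := h.h24
  h44 := h.h44

/-- Change of basis in the second ruling. -/
theorem col (h : IsFrame T e w₁ w₂ w₃ w₄ δ) {p q r t : Ω} (hd : p * t - q * r ≠ 0) :
    IsFrame T e (p • w₁ + q • w₂) (r • w₁ + t • w₂) (p • w₃ + q • w₄) (r • w₃ + t • w₄)
      ((p * t - q * r) * δ) :=
  (h.swap.row hd).swap

end IsFrame

/-- The tangent cone of a node of a cubic threefold in suitable coordinates. -/
theorem exists_isFrame [IsAlgClosed Ω] [CharZero Ω] [FiniteDimensional Ω V]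
    (hV : Module.finrank Ω V = 5) (hT : IsSymmTri T) {e : V} (he : e ≠ 0) (hs : ∀ y, T e e y = 0)
    (hn : ∀ w, (∀ y, T e w y = 0) → w ∈ Submodule.span Ω {e}) :
    ∃ (w₁ w₂ w₃ w₄ : V) (δ : Ω), IsFrame T e w₁ w₂ w₃ w₄ δ := by
  obtain ⟨W, hW⟩ := Submodule.exists_isCompl (Submodule.span Ω {e})
  have hW4 : Module.finrank Ω W = 4 := by
    have := Submodule.finrank_add_eq_of_isCompl hW
    rw [finrank_span_singleton he, hV] at this
    omega
  have h2 : Invertible (2 : Ω) := invertibleOfNonzero two_ne_zero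
  let B : LinearMap.BilinForm Ω W := (T e).compl₁₂ W.subtype W.subtype
  have hB : LinearMap.IsSymm B := ⟨fun x y => hT.swap₂ _ _ _⟩
  obtain ⟨b', hb'⟩ := LinearMap.BilinForm.exists_orthogonal_basis hB
  let b := b'.reindex (finCongr hW4)
  have hb : ∀ i j, i ≠ j → T e (b i) (b j) = 0 := by
    intro i j hij
    have := hb' (i := (finCongr hW4).symm i) (j := (finCongr hW4).symm j)
      (fun h => hij ((finCongr hW4).symm.injective h))
    simpa [b, B, Function.onFun] using this
  have hspan : ∀ v, ∃ x₀ x₁ x₂ x₃ x₄ : Ω,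
      v = x₀ • e + x₁ • (b 0 : V) + x₂ • (b 1 : V) + x₃ • (b 2 : V) + x₄ • (b 3 : V) := by
    intro v
    have hv : v ∈ Submodule.span Ω {e} ⊔ W := by rw [hW.sup_eq_top]; trivial
    obtain ⟨y, hy, z, hz, rfl⟩ := Submodule.mem_sup.mp hv
    obtain ⟨x₀, rfl⟩ := Submodule.mem_span_singleton.mp hy
    obtain ⟨c, hc⟩ : ∃ c : Fin 4 → Ω, z = c 0 • (b 0 : V) + c 1 • (b 1 : V) + c 2 • (b 2 : V) +
        c 3 • (b 3 : V) := by
      have hz' := congrArg (Submodule.subtype W) (b.sum_repr ⟨z, hz⟩)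
      simp only [Fin.sum_univ_four, map_add, map_smul, Submodule.subtype_apply] at hz'
      exact ⟨_, hz'.symm⟩
    exact ⟨x₀, c 0, c 1, c 2, c 3, by rw [hc]; abel⟩
  have hd : ∀ i, T e (b i) (b i) ≠ 0 := by
    intro i h0
    have h1 : (b i : V) ∈ Submodule.span Ω {e} := by
      apply hn
      intro y
      obtain ⟨x₀, x₁, x₂, x₃, x₄, rfl⟩ := hspan y
      have h3 : ∀ j, T e (b i) (b j) = 0 := by
        intro j
        by_cases hij : i = j
        · subst hij; exact h0
        · exact hb i j hij
      simp only [map_add, map_smul, h3, hT.swap₂ e _ e, hs]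
      simp
    have h2 : (b i : V) ∈ (⊥ : Submodule Ω V) := by
      rw [← hW.inf_eq_bot]; exact ⟨h1, (b i).2⟩
    exact b.ne_zero i (Subtype.ext ((Submodule.mem_bot Ω).mp h2))
  choose d hd2 using fun i => IsAlgClosed.exists_eq_mul_self (T e (b i) (b i))
  have hd0 : ∀ i, d i ≠ 0 := by
    intro i h0
    exact hd i (by rw [hd2, h0, mul_zero])
  obtain ⟨I, hI⟩ := IsAlgClosed.exists_eq_mul_self (-1 : Ω)
  obtain ⟨u, hud⟩ : ∃ u : Fin 4 → V, ∀ i, u i = (d i)⁻¹ • (b i : V) := ⟨_, fun _ => rfl⟩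
  have hu : ∀ i j, T e (u i) (u j) = if i = j then 1 else 0 := by
    intro i j
    by_cases hij : i = j
    · subst hij
      simp only [hud, map_smul, LinearMap.smul_apply, smul_eq_mul, hd2, if_true]
      field_simp [hd0 i]
    · simp [hud, hij, hb i j hij]
  -- With `I² = -1`, the sum of four squares splits as `(u₀² + u₁²) + (u₂² + u₃²)` and each bracket
  -- factors over `Ω`. The sign of the third vector produces `x₁ x₄ - x₂ x₃`; each hyperbolic pair
  -- has value `±2`, whence `δ = 2`.
  refine ⟨u 0 + I • u 1, u 2 + I • u 3, -(u 2 - I • u 3), u 0 - I • u 1, 2, hT, two_ne_zero,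
    fun v => ?_, hs, ?_, ?_, ?_, ?_, ?_, ?_, ?_, ?_, ?_, ?_⟩
  · obtain ⟨x₀, x₁, x₂, x₃, x₄, rfl⟩ := hspan v
    have hbu : ∀ i, (b i : V) = d i • u i := by
      intro i; simp [hud, smul_smul, hd0 i]
    refine ⟨x₀, (x₁ * d 0 - I * x₂ * d 1) / 2, (x₃ * d 2 - I * x₄ * d 3) / 2,
      -(x₃ * d 2 + I * x₄ * d 3) / 2, (x₁ * d 0 + I * x₂ * d 1) / 2, ?_⟩
    rw [hbu 0, hbu 1, hbu 2, hbu 3]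
    match_scalars
    · ring
    · ring
    · linear_combination (-x₂) * d 1 * hI
    · ring
    · linear_combination (-x₄) * d 3 * hI
  all_goals
    simp only [map_add, map_sub, map_neg, map_smul, LinearMap.add_apply, LinearMap.sub_apply,
      LinearMap.neg_apply, LinearMap.smul_apply, smul_eq_mul, hu]
    simp
  all_goals
    first | linear_combination hI | linear_combination -hI

end Frames

end SegreCubic

/-! ### General frames and the curve on the tangent cone. -/

namespace SegreCubic

section TenNodes

variable {Ω V : Type*} [Field Ω] [AddCommGroup V] [Module Ω V]
  {T : V →ₗ[Ω] V →ₗ[Ω] V →ₗ[Ω] Ω}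

/-- The singular points of the cubic `T v v v = 0`. -/
def singSet (T : V →ₗ[Ω] V →ₗ[Ω] V →ₗ[Ω] Ω) : Set (ℙ Ω V) := {p | ∀ y, T p.rep p.rep y = 0}

theorem mk_mem_singSet {v : V} (hv : v ≠ 0) :
    Projectivization.mk Ω v hv ∈ singSet T ↔ ∀ y, T v v y = 0 := by
  obtain ⟨a, ha⟩ := Projectivization.exists_smul_eq_mk_rep Ω v hv
  have : ∀ y, T (Projectivization.mk Ω v hv).rep (Projectivization.mk Ω v hv).rep y =
      (a : Ω) ^ 2 * T v v y := by
    intro y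
    rw [← ha]
    simp [Units.smul_def]
    ring
  simp [singSet, this]

/-- Every obstruction lies in a finite set and spoils at most one parameter, so infinitely many
parameters cannot all be spoiled. -/
theorem exists_avoiding {α β : Type*} [Infinite α] {Z : Set β} (hZ : Z.Finite)
    (bad : α → β → Prop) (h : ∀ a b, bad a b → b ∈ Z)
    (inj : ∀ a a' b, bad a b → bad a' b → a = a') : ∃ a, ∀ b, ¬ bad a b := by
  by_contra hcon
  push Not at hcon
  choose f hf using hcon
  have : Function.Injective fun a => (⟨f a, h a _ (hf a)⟩ : Z) := by
    intro a a' haa'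
    have h1 : f a = f a' := congrArg Subtype.val haa'
    exact inj a a' _ (hf a) (h1 ▸ hf a')
  have := hZ.to_subtype
  have := Finite.of_injective _ ‹Function.Injective _›
  exact not_finite α

namespace IsFrame

variable {e w₁ w₂ w₃ w₄ : V} {δ : Ω}

theorem left_ne_zero (h : IsFrame T e w₁ w₂ w₃ w₄ δ) : e ≠ 0 := by
  rintro rfl
  have := h.h14
  rw [map_zero, LinearMap.zero_apply, LinearMap.zero_apply] at this
  exact h.ne_zero this.symm

theorem coord_eq (h : IsFrame T e w₁ w₂ w₃ w₄ δ) {x₀ x₁ x₂ x₃ x₄ y₀ y₁ y₂ y₃ y₄ : Ω}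
    (he : x₀ • e + x₁ • w₁ + x₂ • w₂ + x₃ • w₃ + x₄ • w₄ =
      y₀ • e + y₁ • w₁ + y₂ • w₂ + y₃ • w₃ + y₄ • w₄) :
    x₁ = y₁ ∧ x₂ = y₂ ∧ x₃ = y₃ ∧ x₄ = y₄ := by
  obtain ⟨h1, h2, h3, h4⟩ := h.pair x₀ x₁ x₂ x₃ x₄ _ rfl
  obtain ⟨k1, k2, k3, k4⟩ := h.pair y₀ y₁ y₂ y₃ y₄ _ rfl
  rw [he] at h1 h2 h3 h4
  have hd := h.ne_zero
  have hd' := neg_ne_zero.mpr hd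
  exact ⟨mul_left_cancel₀ hd (h4.symm.trans k4), mul_left_cancel₀ hd' (h3.symm.trans k3),
    mul_left_cancel₀ hd' (h2.symm.trans k2), mul_left_cancel₀ hd (h1.symm.trans k1)⟩

/-- No singular point but the node lies on the plane spanned by `e, w₁, w₂`. -/
def RowGood (T : V →ₗ[Ω] V →ₗ[Ω] V →ₗ[Ω] Ω) (e w₁ w₂ : V) : Prop :=
  ∀ x₀ x₁ x₂ : Ω, (∀ y, T (x₀ • e + x₁ • w₁ + x₂ • w₂) (x₀ • e + x₁ • w₁ + x₂ • w₂) y = 0) →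
    x₁ = 0 ∧ x₂ = 0

/-- The planes spanned by `e`, `w₁ + μ w₃`, `w₂ + μ w₄` belong to one ruling of the tangent cone and
meet pairwise only in the node. Each other singular point thus lies on at most one of them. -/
theorem exists_rowGood [Infinite Ω] (h : IsFrame T e w₁ w₂ w₃ w₄ δ) (hZ : (singSet T).Finite) :
    ∃ μ : Ω, RowGood T e (w₁ + μ • w₃) (w₂ + μ • w₄) := by
  obtain ⟨μ, hμ⟩ := exists_avoiding hZ (fun (μ : Ω) p => p ∈ singSet T ∧ ∃ x₀ x₁ x₂ : Ω,
      (x₁ ≠ 0 ∨ x₂ ≠ 0) ∧ p.rep = x₀ • e + x₁ • (w₁ + μ • w₃) + x₂ • (w₂ + μ • w₄))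
    (fun _ _ hp => hp.1) (by
      rintro μ μ' p ⟨-, x₀, x₁, x₂, hx, h1⟩ ⟨-, y₀, y₁, y₂, -, h2⟩
      have h3 : x₀ • e + x₁ • w₁ + x₂ • w₂ + (x₁ * μ) • w₃ + (x₂ * μ) • w₄ =
          y₀ • e + y₁ • w₁ + y₂ • w₂ + (y₁ * μ') • w₃ + (y₂ * μ') • w₄ := by
        have := h1.symm.trans h2
        simp only [smul_add, smul_smul] at this
        convert this using 1 <;> abel
      obtain ⟨e1, e2, e3, e4⟩ := h.coord_eq h3
      rcases hx with hx | hx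
      · exact mul_left_cancel₀ hx (by rw [e3, e1])
      · exact mul_left_cancel₀ hx (by rw [e4, e2]))
  refine ⟨μ, fun x₀ x₁ x₂ hs => ?_⟩
  by_contra hx
  have hx' : x₁ ≠ 0 ∨ x₂ ≠ 0 := by tauto
  have hv : x₀ • e + x₁ • (w₁ + μ • w₃) + x₂ • (w₂ + μ • w₄) ≠ 0 := by
    intro h0
    have h3 : x₀ • e + x₁ • w₁ + x₂ • w₂ + (x₁ * μ) • w₃ + (x₂ * μ) • w₄ =
        (0 : Ω) • e + (0 : Ω) • w₁ + (0 : Ω) • w₂ + (0 : Ω) • w₃ + (0 : Ω) • w₄ := by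
      simp only [smul_add, smul_smul] at h0
      rw [show (0 : Ω) • e + (0 : Ω) • w₁ + (0 : Ω) • w₂ + (0 : Ω) • w₃ + (0 : Ω) • w₄ = 0 by simp,
        ← h0]
      abel
    obtain ⟨e1, e2, -, -⟩ := h.coord_eq h3
    exact hx ⟨e1, e2⟩
  obtain ⟨a, ha⟩ := Projectivization.exists_smul_eq_mk_rep Ω _ hv
  refine hμ _ ⟨(mk_mem_singSet hv).mpr hs, a * x₀, a * x₁, a * x₂, ?_, ?_⟩
  · rcases hx' with hx' | hx'
    · exact Or.inl (mul_ne_zero a.ne_zero hx')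
    · exact Or.inr (mul_ne_zero a.ne_zero hx')
  · rw [← ha, Units.smul_def]
    simp only [smul_add, smul_smul, mul_assoc]

theorem exists_good [Infinite Ω] (h : IsFrame T e w₁ w₂ w₃ w₄ δ) (hZ : (singSet T).Finite) :
    ∃ (w₁ w₂ w₃ w₄ : V), IsFrame T e w₁ w₂ w₃ w₄ δ ∧ RowGood T e w₁ w₂ ∧ RowGood T e w₁ w₃ := by
  obtain ⟨μ, hμ⟩ := h.exists_rowGood hZ
  have h' : IsFrame T e (w₁ + μ • w₃) (w₂ + μ • w₄) w₃ w₄ δ := by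
    simpa using h.row (p := 1) (q := μ) (r := 0) (t := 1) (by simp)
  obtain ⟨ν, hν⟩ := h'.swap.exists_rowGood hZ
  refine ⟨_, _, _, _, by simpa using h'.col (p := 1) (q := ν) (r := 0) (t := 1) (by simp), ?_, hν⟩
  -- The change of basis in the second ruling replaces `w₁` by `w₁ + ν w₂`, so the plane chosen in
  -- the first ruling is unchanged and stays good.
  intro x₀ x₁ x₂ hs
  have := hμ x₀ x₁ (ν * x₁ + x₂) (by
    intro y
    rw [← hs y]
    congr 2
    all_goals first | module | (congr 1; module))
  refine ⟨this.1, ?_⟩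
  simpa [this.1] using this.2

end IsFrame

/-- The polynomial `T (s x₁ + y₁) (s x₂ + y₂) (s x₃ + y₃)` in `s`. -/
noncomputable def linePoly (T : V →ₗ[Ω] V →ₗ[Ω] V →ₗ[Ω] Ω) (x₁ y₁ x₂ y₂ x₃ y₃ : V) :
    Polynomial Ω :=
  Polynomial.C (T x₁ x₂ x₃) * Polynomial.X ^ 3 +
  Polynomial.C (T x₁ x₂ y₃ + T x₁ y₂ x₃ + T y₁ x₂ x₃) * Polynomial.X ^ 2 +
  Polynomial.C (T x₁ y₂ y₃ + T y₁ x₂ y₃ + T y₁ y₂ x₃) * Polynomial.X + Polynomial.C (T y₁ y₂ y₃)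

theorem natDegree_linePoly (x₁ y₁ x₂ y₂ x₃ y₃ : V) :
    (linePoly T x₁ y₁ x₂ y₂ x₃ y₃).natDegree ≤ 3 :=
  Polynomial.natDegree_cubic_le

theorem eval_linePoly (x₁ y₁ x₂ y₂ x₃ y₃ : V) (s : Ω) :
    (linePoly T x₁ y₁ x₂ y₂ x₃ y₃).eval s = T (s • x₁ + y₁) (s • x₂ + y₂) (s • x₃ + y₃) := by
  simp [linePoly]
  ring

theorem eval_derivative_linePoly (x₁ y₁ x₂ y₂ x₃ y₃ : V) (s : Ω) :
    (linePoly T x₁ y₁ x₂ y₂ x₃ y₃).derivative.eval s = T x₁ (s • x₂ + y₂) (s • x₃ + y₃) +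
      T (s • x₁ + y₁) x₂ (s • x₃ + y₃) + T (s • x₁ + y₁) (s • x₂ + y₂) x₃ := by
  simp [linePoly]
  ring

/-- Chain rule: `w` is the point of the tangent cone with parameters `(s; u : v)`, its partial
derivatives in `u`, `v`, `s` are the three test vectors, and the derivative of `T w w w` along a
vector `y` is `3 T w w y`. -/
theorem isCurveSing_iff [CharZero Ω] (hT : IsSymmTri T) (w₁ w₂ w₃ w₄ : V) (s u v : Ω) (w : V)
    (hw : w = u • (s • w₁ + w₃) + v • (s • w₂ + w₄)) :
    IsCurveSing (linePoly T w₁ w₃ w₁ w₃ w₁ w₃) (3 * linePoly T w₁ w₃ w₁ w₃ w₂ w₄)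
      (3 * linePoly T w₁ w₃ w₂ w₄ w₂ w₄) (linePoly T w₂ w₄ w₂ w₄ w₂ w₄) s u v ↔
    T w w (s • w₁ + w₃) = 0 ∧ T w w (s • w₂ + w₄) = 0 ∧ T w w (u • w₁ + v • w₂) = 0 := by
  have h3 : (3 : Ω) ≠ 0 := by norm_num
  have d3 : (Polynomial.derivative (3 : Polynomial Ω)) = 0 := Polynomial.derivative_ofNat 3
  unfold IsCurveSing
  simp only [Polynomial.derivative_mul, d3, zero_mul, zero_add, Polynomial.eval_mul,
    Polynomial.eval_ofNat, eval_linePoly, eval_derivative_linePoly]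
  generalize hm1 : s • w₁ + w₃ = m₁ at *
  generalize hm2 : s • w₂ + w₄ = m₂ at *
  subst hw
  have hs := hT.swap₁
  have hs' := hT.swap₂
  have c1 : 3 * T m₁ m₁ m₁ * u ^ 2 + 2 * (3 * T m₁ m₁ m₂) * u * v + 3 * T m₁ m₂ m₂ * v ^ 2 =
      3 * T (u • m₁ + v • m₂) (u • m₁ + v • m₂) m₁ := by
    simp only [map_add, map_smul, LinearMap.add_apply, LinearMap.smul_apply, smul_eq_mul]
    rw [hs' m₁ m₂ m₁, hs m₂ m₁ m₁, hs' m₁ m₂ m₁, hs' m₂ m₂ m₁, hs m₂ m₁ m₂]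
    ring
  have c2 : 3 * T m₁ m₁ m₂ * u ^ 2 + 2 * (3 * T m₁ m₂ m₂) * u * v + 3 * T m₂ m₂ m₂ * v ^ 2 =
      3 * T (u • m₁ + v • m₂) (u • m₁ + v • m₂) m₂ := by
    simp only [map_add, map_smul, LinearMap.add_apply, LinearMap.smul_apply, smul_eq_mul]
    rw [hs m₂ m₁ m₂]
    ring
  have c3 : (T w₁ m₁ m₁ + T m₁ w₁ m₁ + T m₁ m₁ w₁) * u ^ 3 +
      3 * (T w₁ m₁ m₂ + T m₁ w₁ m₂ + T m₁ m₁ w₂) * u ^ 2 * v +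
      3 * (T w₁ m₂ m₂ + T m₁ w₂ m₂ + T m₁ m₂ w₂) * u * v ^ 2 +
      (T w₂ m₂ m₂ + T m₂ w₂ m₂ + T m₂ m₂ w₂) * v ^ 3 =
      3 * T (u • m₁ + v • m₂) (u • m₁ + v • m₂) (u • w₁ + v • w₂) := by
    simp only [map_add, map_smul, LinearMap.add_apply, LinearMap.smul_apply, smul_eq_mul]
    rw [hs w₁ m₁ m₁, hs' m₁ w₁ m₁, hs w₁ m₁ m₂, hs' m₁ w₁ m₂, hs w₁ m₂ m₂, hs' m₂ w₁ m₂,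
      hs' m₁ w₂ m₂, hs w₂ m₂ m₂, hs' m₂ w₂ m₂, hs m₂ m₁ w₁, hs m₂ m₁ w₂]
    ring
  rw [c1, c2, c3]
  simp [h3]

end TenNodes

end SegreCubic

/-! ### Projection from a node: the nine other nodes. -/

namespace SegreCubic

section NormalForm

variable {Ω V : Type*} [Field Ω] [AddCommGroup V] [Module Ω V]
  {T : V →ₗ[Ω] V →ₗ[Ω] V →ₗ[Ω] Ω}

theorem finite_of_rel {α β : Type*} {Z : Set β} (hZ : Z.Finite) {A : Set α} (R : α → β → Prop)
    (h : ∀ a ∈ A, ∃ b ∈ Z, R a b) (inj : ∀ a ∈ A, ∀ a' ∈ A, ∀ b, R a b → R a' b → a = a') :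
    A.Finite := by
  choose f hf using h
  have := hZ.to_subtype
  have hinj : Function.Injective fun a : A => (⟨f a a.2, (hf a a.2).1⟩ : Z) := by
    intro a a' haa'
    have h1 : f a a.2 = f a' a'.2 := congrArg Subtype.val haa'
    exact Subtype.ext (inj a a.2 a' a'.2 _ (hf a a.2).2 (h1 ▸ (hf a' a'.2).2))
  exact Finite.of_injective _ hinj

theorem cubic_coeff_eq_zero [CharZero Ω] {c₀ c₁ c₂ c₃ : Ω}
    (h : ∀ x, c₃ * x ^ 3 + c₂ * x ^ 2 + c₁ * x + c₀ = 0) :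
    c₃ = 0 ∧ c₂ = 0 ∧ c₁ = 0 ∧ c₀ = 0 := by
  have h0 := h 0
  have h1 := h 1
  have h2 := h (-1)
  have h3 := h 2
  have e0 : c₀ = 0 := by linear_combination h0
  have e2 : c₂ = 0 := by linear_combination (h1 + h2) / 2 - e0
  have e3 : c₃ = 0 := by linear_combination (h3 - 2 * h1 - 2 * e2 + e0) / 6
  exact ⟨e3, e2, by linear_combination h1 - e3 - e2 - e0, e0⟩

namespace IsFrame

variable {e w₁ w₂ w₃ w₄ : V} {δ : Ω}

/-- The hypotheses say that the linear form `T w w` vanishes on the tangent space of the quadric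
cone at `w`, so modulo `e` it is a multiple of `T e w`. It can then be cancelled by the cross term
`2 x₀ T e w` on moving `w` along the line towards `e`. -/
theorem exists_sing [CharZero Ω] (h : IsFrame T e w₁ w₂ w₃ w₄ δ) {s u v : Ω} (huv : u ≠ 0 ∨ v ≠ 0)
    {w : V} (hw : w = (s * u) • w₁ + (s * v) • w₂ + u • w₃ + v • w₄)
    (hA : T w w (s • w₁ + w₃) = 0) (hB : T w w (s • w₂ + w₄) = 0)
    (hC : T w w (u • w₁ + v • w₂) = 0) :
    ∃ x₀ : Ω, ∀ y, T (x₀ • e + w) (x₀ • e + w) y = 0 := by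
  obtain ⟨k1, k2, k3, k4⟩ := h.pair 0 (s * u) (s * v) u v w (by rw [hw]; module)
  have hd := h.ne_zero
  simp only [map_add, map_smul, smul_eq_mul] at hA hB hC
  -- The third condition makes the values of `T w w` at `w₁` and `w₂` proportional to `(v, -u)`,
  -- which are the values of `T e w` there up to `δ`.
  obtain ⟨k, hk1, hk2⟩ : ∃ k, T w w w₁ = k * v ∧ T w w w₂ = - k * u := by
    rcases huv with hu | hv
    · refine ⟨- T w w w₂ / u, ?_, ?_⟩
      · field_simp
        linear_combination hC
      · field_simp
    · refine ⟨T w w w₁ / v, ?_, ?_⟩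
      · field_simp
      · field_simp
        linear_combination hC
  refine ⟨- k / (2 * δ), fun y => ?_⟩
  have hx : - k / (2 * δ) * (2 * δ) = -k := by field_simp
  generalize - k / (2 * δ) = x₀ at hx
  have ew : T e w w = 0 := by
    nth_rewrite 2 [hw]
    simp only [map_add, map_smul, smul_eq_mul, k1, k2, k3, k4]
    ring
  have hwe : ∀ y, T w e y = T e w y := fun y => h.symm.swap₁ _ _ _
  have hee : T w w e = 0 := by rw [h.symm.swap₂, h.symm.swap₁]; exact ew
  have hwe2 : T e w e = 0 := by rw [h.symm.swap₂]; exact h.sing w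
  obtain ⟨y₀, y₁, y₂, y₃, y₄, rfl⟩ := h.span y
  have e3 : T w w w₃ = - (s * (k * v)) := by linear_combination hA - s * hk1
  have e4 : T w w w₄ = s * k * u := by linear_combination hB - s * hk2
  simp only [map_add, map_smul, LinearMap.add_apply, LinearMap.smul_apply, smul_eq_mul, h.sing, hwe,
    hee, hwe2, k1, k2, k3, k4, hk1, hk2, e3, e4]
  linear_combination (y₁ * v - y₂ * u - s * v * y₃ + s * u * y₄) * hx

/-- Evaluating `T v v` at `e` puts a singular point on the tangent cone. If `x₄ = 0`, the equation
`x₂ x₃ = 0` places it on one of the two good planes, which contain no singular point but `e`. -/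
theorem sing_coord [CharZero Ω] (h : IsFrame T e w₁ w₂ w₃ w₄ δ) (h12 : RowGood T e w₁ w₂)
    (h13 : RowGood T e w₁ w₃) {x₀ x₁ x₂ x₃ x₄ : Ω} {v : V}
    (hv : v = x₀ • e + x₁ • w₁ + x₂ • w₂ + x₃ • w₃ + x₄ • w₄) (hs : ∀ y, T v v y = 0) :
    (x₁ = 0 ∧ x₂ = 0 ∧ x₃ = 0 ∧ x₄ = 0) ∨ (x₄ ≠ 0 ∧ x₁ * x₄ = x₂ * x₃) := by
  obtain ⟨k1, k2, k3, k4⟩ := h.pair x₀ x₁ x₂ x₃ x₄ v hv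
  have hd := h.ne_zero
  have hq : x₁ * x₄ = x₂ * x₃ := by
    have h1 := hs e
    rw [h.symm.swap₂, h.symm.swap₁] at h1
    nth_rewrite 2 [hv] at h1
    simp only [map_add, map_smul, smul_eq_mul, k1, k2, k3, k4, h.symm.swap₂ e v e, h.sing] at h1
    have : (2 * δ) * (x₁ * x₄ - x₂ * x₃) = 0 := by linear_combination h1
    have := (mul_eq_zero.mp this).resolve_left (mul_ne_zero two_ne_zero hd)
    linear_combination this
  by_cases h4 : x₄ = 0
  · left
    subst h4
    by_cases h3 : x₃ = 0
    · subst h3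
      have := h12 x₀ x₁ x₂ (by simpa [hv] using hs)
      exact ⟨this.1, this.2, rfl, rfl⟩
    · have h2 : x₂ = 0 := by simpa [h3] using hq.symm
      subst h2
      exact absurd (h13 x₀ x₁ x₃ (by simpa [hv] using hs)).2 h3
  · exact Or.inr ⟨h4, hq⟩

/-- At a singular point `T w w = -2 x₀ T e w`, and `T e w` vanishes on the tangent directions of the
quadric cone at `w`. -/
theorem sing_curve (h : IsFrame T e w₁ w₂ w₃ w₄ δ) {x₀ s u v : Ω} {w : V}
    (hw : w = (s * u) • w₁ + (s * v) • w₂ + u • w₃ + v • w₄)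
    (hs : ∀ y, T (x₀ • e + w) (x₀ • e + w) y = 0) :
    T w w (s • w₁ + w₃) = 0 ∧ T w w (s • w₂ + w₄) = 0 ∧ T w w (u • w₁ + v • w₂) = 0 := by
  obtain ⟨k1, k2, k3, k4⟩ := h.pair 0 (s * u) (s * v) u v w (by rw [hw]; module)
  have key : ∀ y, T w w y = - (2 * x₀ * T e w y) := by
    intro y
    have := hs y
    simp only [map_add, map_smul, LinearMap.add_apply, LinearMap.smul_apply, smul_eq_mul, h.sing,
      h.symm.swap₁ w e] at this
    linear_combination this
  refine ⟨?_, ?_, ?_⟩ <;> rw [key] <;>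
    simp only [map_add, map_smul, smul_eq_mul, k1, k2, k3, k4] <;> ring

/-- The condition at `w₁` is linear in the coefficient of `e`, with slope `2δ`. Hence the other
nodes are separated by their projections. -/
theorem sing_left_unique [CharZero Ω] (h : IsFrame T e w₁ w₂ w₃ w₄ δ) {x₀ y₀ s u : Ω} {w : V}
    (hw : w = (s * u) • w₁ + s • w₂ + u • w₃ + w₄)
    (hs : ∀ y, T (x₀ • e + w) (x₀ • e + w) y = 0) (ht : ∀ y, T (y₀ • e + w) (y₀ • e + w) y = 0) :
    x₀ = y₀ := by
  obtain ⟨k1, -, -, -⟩ := h.pair 0 (s * u) s u 1 w (by rw [hw]; module)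
  have h1 := hs w₁
  have h2 := ht w₁
  simp only [map_add, map_smul, LinearMap.add_apply, LinearMap.smul_apply, smul_eq_mul, h.sing,
      h.symm.swap₁ w e, k1] at h1 h2
  refine mul_left_cancel₀ (mul_ne_zero two_ne_zero h.ne_zero) ?_
  linear_combination h1 - h2

/-- Nodes other than `e` correspond to singular points of the curve cut out on `ℙ¹ × ℙ¹`. The
finiteness conditions of `exists_factorization_of_nine_sing` follow from the finiteness of the
singular locus. -/
theorem exists_factorization [CharZero Ω] [IsAlgClosed Ω] (h : IsFrame T e w₁ w₂ w₃ w₄ δ)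
    (h12 : RowGood T e w₁ w₂) (h13 : RowGood T e w₁ w₃) (hZ : (singSet T).ncard = 10) :
    ∃ κ s₁ s₂ s₃ r₁ r₂ r₃ : Ω, κ ≠ 0 ∧ (s₁ ≠ s₂ ∧ s₁ ≠ s₃ ∧ s₂ ≠ s₃) ∧
      (r₁ ≠ r₂ ∧ r₁ ≠ r₃ ∧ r₂ ≠ r₃) ∧
      ∀ x u v w, w = (x * u) • w₁ + (x * v) • w₂ + u • w₃ + v • w₄ →
        T w w w = κ * ((x - s₁) * (x - s₂) * (x - s₃)) *
          ((u - r₁ * v) * (u - r₂ * v) * (u - r₃ * v)) := by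
  have hfinZ : (singSet T).Finite := Set.finite_of_ncard_ne_zero (by omega)
  -- `R q p` expresses that the node `p` projects from `e` to the curve point with parameters `q`,
  -- up to scaling.
  set R : Ω × Ω × Ω → ℙ Ω V → Prop := fun q p => ∃ a x₀ : Ω, a ≠ 0 ∧
    p.rep = x₀ • e + (q.1 * (a * q.2.1)) • w₁ + (q.1 * (a * q.2.2)) • w₂ + (a * q.2.1) • w₃ +
      (a * q.2.2) • w₄ with hR
  have hcs := fun s u v => isCurveSing_iff h.symm w₁ w₂ w₃ w₄ s u v
    ((s * u) • w₁ + (s * v) • w₂ + u • w₃ + v • w₄) (by module)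
  set A := linePoly T w₁ w₃ w₁ w₃ w₁ w₃
  set B := 3 * linePoly T w₁ w₃ w₁ w₃ w₂ w₄
  set C := 3 * linePoly T w₁ w₃ w₂ w₄ w₂ w₄
  set D := linePoly T w₂ w₄ w₂ w₄ w₂ w₄
  have hpt : ∀ s u v, (u ≠ 0 ∨ v ≠ 0) → IsCurveSing A B C D s u v →
      ∃ p ∈ singSet T, R (s, u, v) p := by
    intro s u v huv hs
    obtain ⟨h1, h2, h3⟩ := (hcs s u v).mp hs
    obtain ⟨x₀, hx⟩ := h.exists_sing huv rfl h1 h2 h3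
    have hne : x₀ • e + ((s * u) • w₁ + (s * v) • w₂ + u • w₃ + v • w₄) ≠ 0 := by
      intro h0
      have h0' : x₀ • e + (s * u) • w₁ + (s * v) • w₂ + u • w₃ + v • w₄ =
          (0 : Ω) • e + (0 : Ω) • w₁ + (0 : Ω) • w₂ + (0 : Ω) • w₃ + (0 : Ω) • w₄ := by
        rw [show (0 : Ω) • e + (0 : Ω) • w₁ + (0 : Ω) • w₂ + (0 : Ω) • w₃ + (0 : Ω) • w₄ = 0 by
          simp, ← h0]
        abel
      obtain ⟨-, -, e3, e4⟩ := h.coord_eq h0'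
      tauto
    obtain ⟨a, ha⟩ := Projectivization.exists_smul_eq_mk_rep Ω _ hne
    refine ⟨_, (mk_mem_singSet hne).mpr hx, a, a * x₀, a.ne_zero, ?_⟩
    rw [← ha, Units.smul_def]
    module
  have hinjs : ∀ s u v s' u' v' p, (u ≠ 0 ∨ v ≠ 0) → R (s, u, v) p → R (s', u', v') p → s = s' := by
    rintro s u v s' u' v' p huv ⟨a, x₀, ha, h1⟩ ⟨a', y₀, ha', h2⟩
    obtain ⟨e1, e2, e3, e4⟩ := h.coord_eq (h1.symm.trans h2)
    simp only at e1 e2 e3 e4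
    rcases huv with hu | hv
    · exact mul_right_cancel₀ (mul_ne_zero ha hu) (by rw [e1, e3])
    · exact mul_right_cancel₀ (mul_ne_zero ha hv) (by rw [e2, e4])
  have hpts : ∃ q : Fin 9 → Ω × Ω, Function.Injective q ∧
      ∀ i, IsCurveSing A B C D (q i).1 (q i).2 1 := by
    have he := h.left_ne_zero
    have hemem : Projectivization.mk Ω e he ∈ singSet T := (mk_mem_singSet he).mpr h.sing
    have hc9 : (singSet T \ {Projectivization.mk Ω e he}).ncard = 9 := by
      rw [Set.ncard_sdiff_singleton_of_mem hemem, hZ]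
    have : Finite ↥(singSet T \ {Projectivization.mk Ω e he}) := (hfinZ.subset Set.sdiff_subset)
    let f : Fin 9 ≃ ↥(singSet T \ {Projectivization.mk Ω e he}) :=
      (Finite.equivFinOfCardEq (by rw [← hc9]; exact Nat.card_coe_set_eq _)).symm
    have hq : ∀ p : ↥(singSet T \ {Projectivization.mk Ω e he}), ∃ (q : Ω × Ω) (x₀ : Ω)
        (hv : x₀ • e + ((q.1 * q.2) • w₁ + q.1 • w₂ + q.2 • w₃ + w₄) ≠ 0),
        p.1 = Projectivization.mk Ω _ hv ∧ ∀ y,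
          T (x₀ • e + ((q.1 * q.2) • w₁ + q.1 • w₂ + q.2 • w₃ + w₄))
            (x₀ • e + ((q.1 * q.2) • w₁ + q.1 • w₂ + q.2 • w₃ + w₄)) y = 0 := by
      rintro ⟨p, hp, hpe⟩
      obtain ⟨x₀, x₁, x₂, x₃, x₄, hx⟩ := h.span p.rep
      rcases h.sing_coord h12 h13 hx hp with ⟨rfl, rfl, rfl, rfl⟩ | ⟨h4, hq⟩
      · exfalso
        apply hpe
        rw [Set.mem_singleton_iff, ← p.mk_rep, Projectivization.mk_eq_mk_iff']
        exact ⟨x₀, by rw [hx]; simp⟩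
      · have hvec : (x₀ / x₄) • e + ((x₂ / x₄ * (x₃ / x₄)) • w₁ + (x₂ / x₄) • w₂ + (x₃ / x₄) • w₃ +
            w₄) = x₄⁻¹ • p.rep := by
          rw [hx]
          match_scalars <;> field_simp
          exact hq.symm.trans (mul_comm _ _)
        refine ⟨(x₂ / x₄, x₃ / x₄), x₀ / x₄, ?_, ?_, ?_⟩
        · rw [hvec]
          exact smul_ne_zero (inv_ne_zero h4) p.rep_nonzero
        · refine p.mk_rep.symm.trans ?_
          rw [Projectivization.mk_eq_mk_iff']
          exact ⟨x₄, by rw [hvec, smul_smul, mul_inv_cancel₀ h4, one_smul]⟩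
        · intro y
          simp only [hvec, map_smul, LinearMap.smul_apply, hp y, smul_zero]
    choose q x₀ hv hpv hsing using hq
    refine ⟨fun i => q (f i), fun i j hij => f.injective (Subtype.ext ?_), fun i => ?_⟩
    · simp only at hij
      have h2 := hsing (f j)
      have h1 := hsing (f i)
      rw [hij] at h1
      have := h.sing_left_unique rfl h1 h2
      rw [hpv (f i), hpv (f j)]
      congr 1
      rw [hij, this]
    · refine (hcs _ _ 1).mpr (h.sing_curve rfl (x₀ := x₀ (f i)) ?_)
      simpa using hsing (f i)
  obtain ⟨q, hqinj, hqs⟩ := hpts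
  have hA : A.natDegree ≤ 3 := natDegree_linePoly ..
  have h3 : (3 : Polynomial Ω) = Polynomial.C 3 := rfl
  have hB : B.natDegree ≤ 3 := by
    refine (Polynomial.natDegree_C_mul_le (3 : Ω) _).trans (natDegree_linePoly ..)
  have hC : C.natDegree ≤ 3 := by
    refine (Polynomial.natDegree_C_mul_le (3 : Ω) _).trans (natDegree_linePoly ..)
  have hD : D.natDegree ≤ 3 := natDegree_linePoly ..
  obtain ⟨κ, s₁, s₂, s₃, r₁, r₂, r₃, hκ, hs1, hs2, hs3, hr1, hr2, hr3, hfac⟩ := exists_factorization_of_nine_sing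
    hA hB hC hD (finite_of_rel hfinZ
      (fun s p => ∃ u v, (u ≠ 0 ∨ v ≠ 0) ∧ R (s, u, v) p)
      (by
        rintro s ⟨u, v, huv, hs⟩
        obtain ⟨p, hp, hpR⟩ := hpt s u v huv hs
        exact ⟨p, hp, u, v, huv, hpR⟩)
      (by
        rintro s - s' - p ⟨u, v, huv, h1⟩ ⟨u', v', -, h2⟩
        exact hinjs _ _ _ _ _ _ _ huv h1 h2))
    (fun s => finite_of_rel hfinZ (fun u p => R (s, u, 1) p)
      (fun u hu => hpt s u 1 (Or.inr one_ne_zero) hu)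
      (by
        rintro u - u' - p ⟨a, x₀, ha, h1⟩ ⟨a', y₀, ha', h2⟩
        obtain ⟨e1, e2, e3, e4⟩ := h.coord_eq (h1.symm.trans h2)
        simp only [mul_one] at e3 e4
        subst e4
        exact mul_left_cancel₀ ha e3))
    (fun s u hu => by
      by_contra hu0
      obtain ⟨h1, h2, h3⟩ := (hcs s u 0).mp hu
      obtain ⟨x₀, hx⟩ := h.exists_sing (Or.inl hu0) rfl h1 h2 h3
      -- A singular point of the curve at `v = 0` lifts to a node in the plane of `e, w₁, w₃`,
      -- excluded by goodness.
      refine hu0 (h13 x₀ (s * u) u fun y => ?_).2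
      rw [← hx y]
      have : x₀ • e + (s * u) • w₁ + u • w₃ =
        x₀ • e + ((s * u) • w₁ + (s * 0) • w₂ + u • w₃ + (0 : Ω) • w₄) := by module
      rw [this]) q hqinj hqs
  refine ⟨κ, s₁, s₂, s₃, r₁, r₂, r₃, hκ, ⟨hs1, hs2, hs3⟩, ⟨hr1, hr2, hr3⟩, fun x u v w hw => ?_⟩
  rw [← hfac]
  simp only [A, B, C, D, Polynomial.eval_mul, Polynomial.eval_ofNat, eval_linePoly]
  have hw' : w = u • (x • w₁ + w₃) + v • (x • w₂ + w₄) := by rw [hw]; module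
  rw [hw']
  generalize x • w₁ + w₃ = m
  generalize x • w₂ + w₄ = n
  simp only [map_add, map_smul, LinearMap.add_apply, LinearMap.smul_apply, smul_eq_mul]
  rw [h.symm.swap₁ n m m, h.symm.swap₂ m n m, h.symm.swap₁ n m n, h.symm.swap₂ n n m,
    h.symm.swap₁ n m n]
  ring

end IsFrame

end NormalForm

end SegreCubic

/-! ### From the six lines to the sum of six cubes. -/

namespace SegreCubic

section NormalForm

variable {Ω V : Type*} [Field Ω] [AddCommGroup V] [Module Ω V]
  {T : V →ₗ[Ω] V →ₗ[Ω] V →ₗ[Ω] Ω}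

theorem cubic_smul_add (hT : IsSymmTri T) (x y : Ω) (m n : V) :
    T (x • m + y • n) (x • m + y • n) (x • m + y • n) =
      T m m m * x ^ 3 + 3 * T m m n * x ^ 2 * y + 3 * T m n n * x * y ^ 2 + T n n n * y ^ 3 := by
  simp only [map_add, map_smul, LinearMap.add_apply, LinearMap.smul_apply, smul_eq_mul]
  rw [hT.swap₁ n m m, hT.swap₂ m n m, hT.swap₁ n m n, hT.swap₂ n n m, hT.swap₁ n m n]
  ring

/-- A cubic form on a line is determined by its dehomogenisation. -/
theorem cubic_homogenize [CharZero Ω] (hT : IsSymmTri T) (m n : V) {K s₁ s₂ s₃ : Ω}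
    (h : ∀ x : Ω, T (x • m + n) (x • m + n) (x • m + n) =
      K * ((x - s₁) * (x - s₂) * (x - s₃))) (x y : Ω) :
    T (x • m + y • n) (x • m + y • n) (x • m + y • n) =
      K * ((x - s₁ * y) * (x - s₂ * y) * (x - s₃ * y)) := by
  have h' : ∀ x, (T m m m - K) * x ^ 3 + (3 * T m m n + K * (s₁ + s₂ + s₃)) * x ^ 2 +
      (3 * T m n n - K * (s₁ * s₂ + s₁ * s₃ + s₂ * s₃)) * x + (T n n n + K * (s₁ * s₂ * s₃)) = 0 := by
    intro x
    have h1 := h x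
    have h2 := cubic_smul_add hT x 1 m n
    rw [one_smul] at h2
    linear_combination h1 - h2
  obtain ⟨e3, e2, e1, e0⟩ := cubic_coeff_eq_zero h'
  rw [cubic_smul_add hT]
  linear_combination x ^ 3 * e3 + x ^ 2 * y * e2 + x * y ^ 2 * e1 + y ^ 3 * e0

namespace IsFrame

variable {e w₁ w₂ w₃ w₄ : V} {δ : Ω}

theorem exists_normal_frame [CharZero Ω] [IsAlgClosed Ω] (h : IsFrame T e w₁ w₂ w₃ w₄ δ)
    (hZ : (singSet T).ncard = 10) :
    ∃ (w₁ w₂ w₃ w₄ : V) (δ κ : Ω), IsFrame T e w₁ w₂ w₃ w₄ δ ∧ κ ≠ 0 ∧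
      ∀ x y w, w = x • (y • w₁ + w₂) + (y • w₃ + w₄) →
        T w w w = κ * ((x ^ 2 - x) * (y ^ 2 - y)) := by
  have hfinZ : (singSet T).Finite := Set.finite_of_ncard_ne_zero (by omega)
  obtain ⟨w₁, w₂, w₃, w₄, h, h12, h13⟩ := h.exists_good hfinZ
  obtain ⟨κ, s₁, s₂, s₃, r₁, r₂, r₃, hκ, ⟨hs1, hs2, hs3⟩, ⟨hr1, hr2, hr3⟩, hfac⟩ :=
    h.exists_factorization h12 h13 hZ
  rw [← sub_ne_zero] at hs1 hs2 hs3 hr1 hr2 hr3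
  have hfac' : ∀ a b u v w, w = a • (u • w₁ + v • w₂) + b • (u • w₃ + v • w₄) →
      T w w w = κ * ((a - s₁ * b) * (a - s₂ * b) * (a - s₃ * b)) *
          ((u - r₁ * v) * (u - r₂ * v) * (u - r₃ * v)) := by
    rintro a b u v w rfl
    rw [cubic_homogenize h.symm (K := κ * ((u - r₁ * v) * (u - r₂ * v) * (u - r₃ * v)))
      (s₁ := s₁) (s₂ := s₂) (s₃ := s₃)]
    · ring
    · intro x
      rw [hfac x u v _ (by module)]
      ring
  -- The matrix is that of the Möbius map taking `0, ∞, 1` to `a, b, c`; it is applied to the three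
  -- lines of each ruling.
  have hdet : ∀ a b c : Ω, a - b ≠ 0 → a - c ≠ 0 → b - c ≠ 0 →
      ((a - c) * b) * (c - b) - (a - c) * ((c - b) * a) ≠ 0 := by
    intro a b c h1 h2 h3
    have : ((a - c) * b) * (c - b) - (a - c) * ((c - b) * a) = (a - c) * (b - c) * (a - b) := by ring
    rw [this]
    exact mul_ne_zero (mul_ne_zero h2 h3) h1
  have h' := (h.row (hdet s₁ s₂ s₃ hs1 hs2 hs3)).col (hdet r₁ r₂ r₃ hr1 hr2 hr3)
  refine ⟨_, _, _, _, _, κ * ((s₁ - s₂) * (s₁ - s₃) * (s₂ - s₃)) ^ 2 *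
    ((r₁ - r₂) * (r₁ - r₃) * (r₂ - r₃)) ^ 2, h', mul_ne_zero (mul_ne_zero hκ (pow_ne_zero 2
      (mul_ne_zero (mul_ne_zero hs1 hs2) hs3))) (pow_ne_zero 2 (mul_ne_zero (mul_ne_zero hr1 hr2) hr3)), ?_⟩
  intro x y w hw
  rw [hfac' (x * ((s₁ - s₃) * s₂) + (s₃ - s₂) * s₁) (x * (s₁ - s₃) + (s₃ - s₂))
    (y * ((r₁ - r₃) * r₂) + (r₃ - r₂) * r₁) (y * (r₁ - r₃) + (r₃ - r₂)) w (by rw [hw]; module)]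
  have e : ∀ s₁ s₂ s₃ x : Ω, (x * ((s₁ - s₃) * s₂) + (s₃ - s₂) * s₁ - s₁ * (x * (s₁ - s₃) + (s₃ - s₂))) *
    (x * ((s₁ - s₃) * s₂) + (s₃ - s₂) * s₁ - s₂ * (x * (s₁ - s₃) + (s₃ - s₂))) *
    (x * ((s₁ - s₃) * s₂) + (s₃ - s₂) * s₁ - s₃ * (x * (s₁ - s₃) + (s₃ - s₂))) =
    ((s₁ - s₂) * (s₁ - s₃) * (s₂ - s₃)) ^ 2 * (x ^ 2 - x) := by intros; ring
  rw [e, e]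
  ring

/-- The equation of the cubic in a normalised frame. -/
theorem cubic_eq [CharZero Ω] (h : IsFrame T e w₁ w₂ w₃ w₄ δ) {κ : Ω}
    (hκ : ∀ x y w, w = x • (y • w₁ + w₂) + (y • w₃ + w₄) →
        T w w w = κ * ((x ^ 2 - x) * (y ^ 2 - y))) :
    ∃ A B C D : Ω, ∀ x₀ x₁ x₂ x₃ x₄ v, v = x₀ • e + x₁ • w₁ + x₂ • w₂ + x₃ • w₃ + x₄ • w₄ →
      T v v v = (6 * δ * x₀ - (A * x₁ + B * x₂ + C * x₃ + D * x₄)) * (x₁ * x₄ - x₂ * x₃) +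
        κ * (x₁ * x₄ * (x₁ - x₂ - x₃ + x₄)) := by
  have hs := h.symm.swap₁
  have hs' := h.symm.swap₂
  -- Restriction to the quadric determines the cubic in `x₁, …, x₄` up to a multiple of `x₁ x₄ - x₂
  -- x₃`. Comparing coefficients first in `x`, then in `y`, yields sixteen relations.
  have hx : ∀ x y : Ω, T (y • w₁ + w₂) (y • w₁ + w₂) (y • w₁ + w₂) * x ^ 3 +
      (3 * T (y • w₁ + w₂) (y • w₁ + w₂) (y • w₃ + w₄) - κ * (y ^ 2 - y)) * x ^ 2 +
      (3 * T (y • w₁ + w₂) (y • w₃ + w₄) (y • w₃ + w₄) + κ * (y ^ 2 - y)) * x +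
      T (y • w₃ + w₄) (y • w₃ + w₄) (y • w₃ + w₄) = 0 := by
    intro x y
    have h1 := hκ x y _ rfl
    have h2 := cubic_smul_add h.symm x 1 (y • w₁ + w₂) (y • w₃ + w₄)
    rw [one_smul] at h2
    linear_combination h1 - h2
  have hy := fun y => cubic_coeff_eq_zero fun x => hx x y
  obtain ⟨t111, t112, t122, t222⟩ := cubic_coeff_eq_zero
    (c₃ := T w₁ w₁ w₁) (c₂ := 3 * T w₁ w₁ w₂) (c₁ := 3 * T w₁ w₂ w₂) (c₀ := T w₂ w₂ w₂) fun y => by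
      have h1 := (hy y).1
      have h2 := cubic_smul_add h.symm y 1 w₁ w₂
      rw [one_smul] at h2
      linear_combination h1 - h2
  obtain ⟨t333, t334, t344, t444⟩ := cubic_coeff_eq_zero
    (c₃ := T w₃ w₃ w₃) (c₂ := 3 * T w₃ w₃ w₄) (c₁ := 3 * T w₃ w₄ w₄) (c₀ := T w₄ w₄ w₄) fun y => by
      have h1 := (hy y).2.2.2
      have h2 := cubic_smul_add h.symm y 1 w₃ w₄
      rw [one_smul] at h2
      linear_combination h1 - h2
  obtain ⟨t113, t123, t223, t224⟩ := cubic_coeff_eq_zero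
    (c₃ := 3 * T w₁ w₁ w₃) (c₂ := 3 * T w₁ w₁ w₄ + 6 * T w₁ w₂ w₃ - κ)
    (c₁ := 6 * T w₁ w₂ w₄ + 3 * T w₂ w₂ w₃ + κ) (c₀ := 3 * T w₂ w₂ w₄) fun y => by
      have h1 := (hy y).2.1
      simp only [map_add, map_smul, LinearMap.add_apply, LinearMap.smul_apply, smul_eq_mul,
        hs w₂ w₁] at h1
      linear_combination h1
  obtain ⟨t133, t134, t234, t244⟩ := cubic_coeff_eq_zero
    (c₃ := 3 * T w₁ w₃ w₃) (c₂ := 6 * T w₁ w₃ w₄ + 3 * T w₂ w₃ w₃ + κ)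
    (c₁ := 3 * T w₁ w₄ w₄ + 6 * T w₂ w₃ w₄ - κ) (c₀ := 3 * T w₂ w₄ w₄) fun y => by
      have h1 := (hy y).2.2.1
      simp only [map_add, map_smul, LinearMap.add_apply, LinearMap.smul_apply, smul_eq_mul,
        hs' _ w₄ w₃] at h1
      linear_combination h1
  -- These are the coefficients that the restriction leaves free: they form the linear factor
  -- multiplying the quadric, with a sign.
  refine ⟨6 * T w₁ w₂ w₃, 3 * T w₂ w₂ w₃, 3 * T w₂ w₃ w₃, 6 * T w₂ w₃ w₄, ?_⟩
  intro x₀ x₁ x₂ x₃ x₄ v hv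
  obtain ⟨k1, k2, k3, k4⟩ := h.pair x₀ x₁ x₂ x₃ x₄ v hv
  obtain ⟨m1, m2, m3, m4⟩ := h.pair 0 x₁ x₂ x₃ x₄ (x₁ • w₁ + x₂ • w₂ + x₃ • w₃ + x₄ • w₄) (by simp)
  have hv' : v = x₀ • e + (1 : Ω) • (x₁ • w₁ + x₂ • w₂ + x₃ • w₃ + x₄ • w₄) := by
    rw [hv]; module
  rw [hv', cubic_smul_add h.symm, h.sing, h.sing]
  have hq : T e (x₁ • w₁ + x₂ • w₂ + x₃ • w₃ + x₄ • w₄) (x₁ • w₁ + x₂ • w₂ + x₃ • w₃ + x₄ • w₄) =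
      2 * δ * (x₁ * x₄ - x₂ * x₃) := by
    rw [map_add, map_add, map_add, map_smul, map_smul, map_smul, map_smul, m1, m2, m3, m4]
    simp only [smul_eq_mul]
    ring
  have hc : T (x₁ • w₁ + x₂ • w₂ + x₃ • w₃ + x₄ • w₄) (x₁ • w₁ + x₂ • w₂ + x₃ • w₃ + x₄ • w₄)
      (x₁ • w₁ + x₂ • w₂ + x₃ • w₃ + x₄ • w₄) = 
      T w₁ w₁ w₁ * x₁ ^ 3 + T w₂ w₂ w₂ * x₂ ^ 3 + T w₃ w₃ w₃ * x₃ ^ 3 + T w₄ w₄ w₄ * x₄ ^ 3 +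
      3 * (T w₁ w₁ w₂ * x₁ ^ 2 * x₂ + T w₁ w₁ w₃ * x₁ ^ 2 * x₃ + T w₁ w₁ w₄ * x₁ ^ 2 * x₄ +
        T w₁ w₂ w₂ * x₁ * x₂ ^ 2 + T w₂ w₂ w₃ * x₂ ^ 2 * x₃ + T w₂ w₂ w₄ * x₂ ^ 2 * x₄ +
        T w₁ w₃ w₃ * x₁ * x₃ ^ 2 + T w₂ w₃ w₃ * x₂ * x₃ ^ 2 + T w₃ w₃ w₄ * x₃ ^ 2 * x₄ +
        T w₁ w₄ w₄ * x₁ * x₄ ^ 2 + T w₂ w₄ w₄ * x₂ * x₄ ^ 2 + T w₃ w₄ w₄ * x₃ * x₄ ^ 2) +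
      6 * (T w₁ w₂ w₃ * x₁ * x₂ * x₃ + T w₁ w₂ w₄ * x₁ * x₂ * x₄ + T w₁ w₃ w₄ * x₁ * x₃ * x₄ +
        T w₂ w₃ w₄ * x₂ * x₃ * x₄) := by
    simp only [map_add, map_smul, LinearMap.add_apply, LinearMap.smul_apply, smul_eq_mul,
      hs w₂ w₁, hs w₃ w₁, hs w₄ w₁, hs w₃ w₂, hs w₄ w₂, hs w₄ w₃, hs' _ w₂ w₁, hs' _ w₃ w₁,
      hs' _ w₄ w₁, hs' _ w₃ w₂, hs' _ w₄ w₂, hs' _ w₄ w₃]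
    ring
  rw [hq, hc]
  linear_combination x₁ ^ 3 * t111 + x₁ ^ 2 * x₂ * t112 + x₁ * x₂ ^ 2 * t122 + x₂ ^ 3 * t222 +
    x₃ ^ 3 * t333 + x₃ ^ 2 * x₄ * t334 + x₃ * x₄ ^ 2 * t344 + x₄ ^ 3 * t444 +
    x₁ ^ 2 * x₃ * t113 + x₁ ^ 2 * x₄ * t123 + x₁ * x₂ * x₄ * t223 + x₂ ^ 2 * x₄ * t224 +
    x₁ * x₃ ^ 2 * t133 + x₁ * x₃ * x₄ * t134 + x₁ * x₄ ^ 2 * t234 + x₂ * x₄ ^ 2 * t244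

end IsFrame

/-- After division by `-κ`, with `Z` the linear factor of the quadric divided by `κ`, the equation
is `Y₁Y₂Y₃ + Z₁Z₂Z₃` for `Y = (x₁, x₄, -(Z + x₁ - x₂ - x₃ + x₄))` and `(Z₁, Z₂, Z₃) = (Z, -x₂,
-x₃)`. These six forms sum to zero, so `sum_cube_eq` applies. -/
theorem exists_sum_cube_of_frame [CharZero Ω] [IsAlgClosed Ω] [FiniteDimensional Ω V]
    (hV : Module.finrank Ω V = 5) {e w₁ w₂ w₃ w₄ : V} {δ : Ω} (h : IsFrame T e w₁ w₂ w₃ w₄ δ)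
    (hZ : (singSet T).ncard = 10) :
    ∃ Λ : V →ₗ[Ω] (Fin 6 → Ω), IsSumZeroIso Λ ∧ ∃ a : Ω, a ≠ 0 ∧
      ∀ v, T v v v = a * ∑ i, Λ v i ^ 3 := by
  obtain ⟨w₁, w₂, w₃, w₄, δ, κ, h, hκ, hfac⟩ := h.exists_normal_frame hZ
  obtain ⟨A, B, C, D, hT⟩ := h.cubic_eq hfac
  have hδ := h.ne_zero
  have hspan : ⊤ ≤ Submodule.span Ω (Set.range ![e, w₁, w₂, w₃, w₄]) := by
    rintro v -
    obtain ⟨x₀, x₁, x₂, x₃, x₄, rfl⟩ := h.span v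
    have hmem : ∀ i, ![e, w₁, w₂, w₃, w₄] i ∈
        Submodule.span Ω (Set.range ![e, w₁, w₂, w₃, w₄]) :=
      fun i => Submodule.subset_span ⟨i, rfl⟩
    exact add_mem (add_mem (add_mem (add_mem (Submodule.smul_mem _ _ (hmem 0))
      (Submodule.smul_mem _ _ (hmem 1))) (Submodule.smul_mem _ _ (hmem 2)))
      (Submodule.smul_mem _ _ (hmem 3))) (Submodule.smul_mem _ _ (hmem 4))
  let b := basisOfTopLeSpanOfCardEqFinrank ![e, w₁, w₂, w₃, w₄] hspan (by simp [hV])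
  have hb : ⇑b = ![e, w₁, w₂, w₃, w₄] := coe_basisOfTopLeSpanOfCardEqFinrank ..
  -- The coordinates are solved from prescribed pair sums `-2 Yᵢ` and `-2 Zᵢ`; `S` is the sum of the
  -- `Zᵢ`. The factor `-κ / 24` below comes from `(-3) · (-8) = 24`.
  obtain ⟨M, hM⟩ : ∃ M : (Fin 5 → Ω) →ₗ[Ω] (Fin 6 → Ω), ∀ x, M x =
      let Z := (6 * δ * x 0 - (A * x 1 + B * x 2 + C * x 3 + D * x 4)) / κ
      let S := Z - x 2 - x 3
      ![S + 2 * x 1, S + 2 * x 4, S - 2 * (Z + x 1 - x 2 - x 3 + x 4), -S + 2 * Z, -S - 2 * x 2,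
        -S - 2 * x 3] := by
    let p : Fin 5 → (Fin 5 → Ω) →ₗ[Ω] Ω := LinearMap.proj
    obtain ⟨z, hz⟩ : ∃ z : (Fin 5 → Ω) →ₗ[Ω] Ω, ∀ x,
        z x = (6 * δ * x 0 - (A * x 1 + B * x 2 + C * x 3 + D * x 4)) / κ :=
      ⟨κ⁻¹ • ((6 * δ) • p 0 - (A • p 1 + B • p 2 + C • p 3 + D • p 4)), fun x => by
        simp [p, div_eq_inv_mul]⟩
    simp only [← hz]
    obtain ⟨S, hS⟩ : ∃ S, S = z - p 2 - p 3 := ⟨_, rfl⟩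
    have hS' : ∀ x, z x - x 2 - x 3 = S x := fun x => by rw [hS]; rfl
    simp only [hS']
    refine ⟨LinearMap.pi ![S + (2 : Ω) • p 1, S + (2 : Ω) • p 4,
      S - (2 : Ω) • (z + p 1 - p 2 - p 3 + p 4), -S + (2 : Ω) • z, -S - (2 : Ω) • p 2,
      -S - (2 : Ω) • p 3], fun x => ?_⟩
    funext i
    fin_cases i <;> rfl
  have hv : ∀ v, v = b.equivFun v 0 • e + b.equivFun v 1 • w₁ + b.equivFun v 2 • w₂ +
      b.equivFun v 3 • w₃ + b.equivFun v 4 • w₄ := by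
    intro v
    have := b.sum_equivFun v
    rw [hb] at this
    simpa [Fin.sum_univ_five] using this.symm
  refine ⟨M ∘ₗ b.equivFun.toLinearMap, ⟨?_, ?_, ?_⟩, -κ / 24, by simpa using hκ, ?_⟩
  · intro v h0
    have h0' : M (b.equivFun v) = 0 := h0
    suffices b.equivFun v = 0 by simpa using this
    generalize b.equivFun v = x at h0'
    rw [hM] at h0'
    obtain ⟨Z, hZ⟩ : ∃ Z, Z = (6 * δ * x 0 - (A * x 1 + B * x 2 + C * x 3 + D * x 4)) / κ := ⟨_, rfl⟩
    rw [← hZ] at h0'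
    have e0 := congrFun h0' 0
    have e1 := congrFun h0' 1
    have e2 := congrFun h0' 2
    have e3 := congrFun h0' 3
    have e4 := congrFun h0' 4
    have e5 := congrFun h0' 5
    simp at e0 e1 e2 e3 e4 e5
    have S0 : Z - x 2 - x 3 = 0 := by linear_combination e0 + e1 + e2
    have hx1 : x 1 = 0 := by linear_combination (e0 - S0) / 2
    have hx4 : x 4 = 0 := by linear_combination (e1 - S0) / 2
    have hx2 : x 2 = 0 := by linear_combination -(e4 + S0) / 2
    have hx3 : x 3 = 0 := by linear_combination -(e5 + S0) / 2
    have hZ0 : Z = 0 := by linear_combination (e3 + S0) / 2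
    have hx0 : x 0 = 0 := by
      rw [hZ0, hx1, hx2, hx3, hx4, eq_comm] at hZ
      simpa [hκ, hδ] using hZ
    funext i
    fin_cases i <;> assumption
  · intro v
    simp only [LinearMap.comp_apply, hM, LinearEquiv.coe_coe, Fin.sum_univ_six]
    simp
    ring
  · intro y hy
    rw [Fin.sum_univ_six] at hy
    refine ⟨b.equivFun.symm ![(κ * (y 3 + (y 0 + y 1 + y 2)) / 2 +
      (A * (y 0 - (y 0 + y 1 + y 2)) / 2 + B * (-y 4 - (y 0 + y 1 + y 2)) / 2 +
      C * (-y 5 - (y 0 + y 1 + y 2)) / 2 + D * (y 1 - (y 0 + y 1 + y 2)) / 2)) / (6 * δ),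
      (y 0 - (y 0 + y 1 + y 2)) / 2, (-y 4 - (y 0 + y 1 + y 2)) / 2, (-y 5 - (y 0 + y 1 + y 2)) / 2,
      (y 1 - (y 0 + y 1 + y 2)) / 2], ?_⟩
    simp only [LinearMap.comp_apply, LinearEquiv.coe_coe, LinearEquiv.apply_symm_apply]
    rw [hM]
    have hZ : (6 * δ * ((κ * (y 3 + (y 0 + y 1 + y 2)) / 2 +
      (A * (y 0 - (y 0 + y 1 + y 2)) / 2 + B * (-y 4 - (y 0 + y 1 + y 2)) / 2 +
      C * (-y 5 - (y 0 + y 1 + y 2)) / 2 + D * (y 1 - (y 0 + y 1 + y 2)) / 2)) / (6 * δ)) -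
      (A * ((y 0 - (y 0 + y 1 + y 2)) / 2) + B * ((-y 4 - (y 0 + y 1 + y 2)) / 2) +
      C * ((-y 5 - (y 0 + y 1 + y 2)) / 2) + D * ((y 1 - (y 0 + y 1 + y 2)) / 2))) / κ =
      (y 3 + (y 0 + y 1 + y 2)) / 2 := by
      field_simp
      ring
    simp only [Matrix.cons_val]
    rw [hZ]
    have e5 : y 5 = -(y 0 + y 1 + y 2 + y 3 + y 4) := by linear_combination hy
    funext i
    fin_cases i <;> simp [e5] <;> ring
  · intro v
    rw [hT _ _ _ _ _ v (hv v)]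
    simp only [LinearMap.comp_apply, hM, LinearEquiv.coe_coe]
    generalize b.equivFun v = x
    obtain ⟨Z, hZ⟩ : ∃ Z, Z = (6 * δ * x 0 - (A * x 1 + B * x 2 + C * x 3 + D * x 4)) / κ := ⟨_, rfl⟩
    have hZ' : 6 * δ * x 0 - (A * x 1 + B * x 2 + C * x 3 + D * x 4) = κ * Z := by
      rw [hZ]; field_simp
    rw [← hZ, hZ', Fin.sum_univ_six]
    simp only [Matrix.cons_val]
    ring

/-- A ten-nodal cubic threefold over an algebraically closed field is the Segre cubic. -/
theorem exists_sum_cube [CharZero Ω] [IsAlgClosed Ω] [FiniteDimensional Ω V]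
    (hV : Module.finrank Ω V = 5) (hT : IsSymmTri T) (hZ : (singSet T).ncard = 10)
    (hn : ∀ p ∈ singSet T, ∀ w, (∀ y, T p.rep w y = 0) → w ∈ Submodule.span Ω {p.rep}) :
    ∃ Λ : V →ₗ[Ω] (Fin 6 → Ω), IsSumZeroIso Λ ∧ ∃ a : Ω, a ≠ 0 ∧
      ∀ v, T v v v = a * ∑ i, Λ v i ^ 3 := by
  obtain ⟨p, hp⟩ := Set.nonempty_of_ncard_ne_zero (s := singSet T) (by omega)
  obtain ⟨w₁, w₂, w₃, w₄, δ, h⟩ := exists_isFrame hV hT p.rep_nonzero hp (hn p hp)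
  exact exists_sum_cube_of_frame hV h hZ

/-- A ten-nodal cubic threefold is geometrically the Segre cubic. -/
theorem IsTenNodalCubic.exists_sum_cube {K : Type*} [Field K] [CharZero K]
    {F : MvPolynomial (Fin 5) K} (hF : IsTenNodalCubic F) :
    ∃ Λ : (Fin 5 → AlgebraicClosure K) →ₗ[AlgebraicClosure K] (Fin 6 → AlgebraicClosure K),
      IsSumZeroIso Λ ∧ ∃ a : AlgebraicClosure K, a ≠ 0 ∧
        ∀ v, aeval v F = a * ∑ i, Λ v i ^ 3 := by
  obtain ⟨hF3, hcard, hnode⟩ := hF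
  obtain ⟨T, hT, hTF, hT1, hT2⟩ := exists_polarization (Ω := AlgebraicClosure K) hF3
  have hbas : ∀ v w, (∀ i, T v w (Pi.single i 1) = 0) → ∀ y, T v w y = 0 := by
    intro v w hi y
    have : T v w = 0 := by
      apply LinearMap.pi_ext'
      intro i
      ext
      simpa using hi i
    rw [this, LinearMap.zero_apply]
  have hsing : ∀ p : ℙ (AlgebraicClosure K) (Fin 5 → AlgebraicClosure K),
      IsSingularAt F p.rep ↔ p ∈ singSet T := by
    intro p
    constructor
    · rintro ⟨-, h⟩
      refine hbas _ _ fun i => ?_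
      have := h i
      rw [hT1] at this
      simpa using this
    · intro h
      refine ⟨by rw [hTF]; exact h _, fun i => by rw [hT1, h, mul_zero]⟩
  obtain ⟨Λ, hΛ, a, ha, h⟩ := SegreCubic.exists_sum_cube (T := T) (by simp) hT
    (by rw [← hcard]; congr 1; ext p; exact (hsing p).symm) (by
      intro p hp w hw
      refine (hnode p ((hsing p).mpr hp)).2 w ?_
      funext i
      rw [hT2, hw, mul_zero, Pi.zero_apply])
  exact ⟨Λ, hΛ, a, ha, fun v => by rw [hTF, h]⟩

end NormalForm

end SegreCubic

/-! ### The étale algebra of a Galois-stable set of values. -/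

namespace SegreCubic

section EtaleAlgebra


variable {K : Type u} [Field K]

/-- `K[X]/p` is a standard étale algebra with localization at `1`; the Bézout relation of
separability supplies the inverse of the derivative. -/
theorem etale_adjoinRoot {p : Polynomial K} (hp : p.Monic) (hs : p.Separable) :
    Algebra.Etale K (AdjoinRoot p) := by
  obtain ⟨a, b, hab⟩ := hs
  let P : StandardEtalePair K := ⟨p, hp, 1, b, a, 0, by rw [pow_zero, ← hab]; ring⟩
  have hmap : P.HasMap (AdjoinRoot.root p) := ⟨by
    change Polynomial.aeval _ p = 0
    rw [AdjoinRoot.aeval_eq, AdjoinRoot.mk_self], by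
    change IsUnit (Polynomial.aeval _ (1 : Polynomial K))
    simp⟩
  have hX : Polynomial.aeval P.X p = 0 := P.hasMap_X.1
  have hr : AdjoinRoot.liftAlgHom p (Algebra.ofId K P.Ring) P.X hX (AdjoinRoot.root p) = P.X :=
    AdjoinRoot.liftAlgHom_root ..
  let e : P.Ring ≃ₐ[K] AdjoinRoot p := AlgEquiv.ofAlgHom (P.lift (AdjoinRoot.root p) hmap)
    (AdjoinRoot.liftAlgHom p (Algebra.ofId K _) P.X hX)
    (AdjoinRoot.algHom_ext (by
      change P.lift _ hmap (AdjoinRoot.liftAlgHom p (Algebra.ofId K _) P.X hX _) = _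
      rw [hr]; exact P.lift_X _ _))
    (P.hom_ext (by
      change AdjoinRoot.liftAlgHom p (Algebra.ofId K _) P.X hX (P.lift _ hmap P.X) = _
      rw [P.lift_X]; exact hr))
  exact Algebra.Etale.of_equiv e

/-- Galois permutes the linear factors, so the coefficients of the product are fixed and lie in `K`.
-/
theorem exists_map_eq_prod {Ω : Type*} [Field Ω] [Algebra K Ω] [IsGalois K Ω] {n : ℕ}
    {y : Fin n → Ω} {ρ : (Ω ≃ₐ[K] Ω) → Equiv.Perm (Fin n)} (hρ : ∀ σ i, σ (y i) = y (ρ σ i)) :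
    ∃ p : Polynomial K, p.Monic ∧ p.natDegree = n ∧
      p.map (algebraMap K Ω) = ∏ i, (Polynomial.X - Polynomial.C (y i)) := by
  have hlift : ∏ i, (Polynomial.X - Polynomial.C (y i)) ∈ Polynomial.lifts (algebraMap K Ω) := by
    rw [Polynomial.lifts_iff_coeff_lifts]
    intro k
    rw [InfiniteGalois.mem_range_algebraMap_iff_fixed]
    intro σ
    have h1 : (∏ i, (Polynomial.X - Polynomial.C (y i))).map ((σ : Ω →ₐ[K] Ω) : Ω →+* Ω) =
        ∏ i, (Polynomial.X - Polynomial.C (y i)) := by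
      rw [Polynomial.map_prod, ← Equiv.prod_comp (ρ σ) fun i => Polynomial.X - Polynomial.C (y i)]
      refine Finset.prod_congr rfl fun i _ => ?_
      simp [hρ]
    conv_rhs => rw [← h1]
    rw [Polynomial.coeff_map]
    rfl
  have hm : (∏ i, (Polynomial.X - Polynomial.C (y i))).Monic :=
    Polynomial.monic_prod_of_monic _ _ fun i _ => Polynomial.monic_X_sub_C _
  obtain ⟨p, hp, hdeg, hpm⟩ := Polynomial.lifts_and_natDegree_eq_and_monic hlift hm
  refine ⟨p, hpm, ?_, hp⟩
  rw [hdeg, Polynomial.natDegree_prod_of_monic _ _ fun i _ => Polynomial.monic_X_sub_C _]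
  simp

/-- The étale algebra attached to a finite Galois orbit space in `Ω`. -/
theorem exists_etale_algebra {Ω : Type*} [Field Ω] [Algebra K Ω] [IsGalois K Ω] {n : ℕ}
    {y : Fin n → Ω} (hy : Function.Injective y) {ρ : (Ω ≃ₐ[K] Ω) → Equiv.Perm (Fin n)}
    (hρ : ∀ σ i, σ (y i) = y (ρ σ i)) :
    ∃ (L : Type u) (_ : CommRing L) (_ : Algebra K L), Algebra.Etale K L ∧
      Module.finrank K L = n ∧ ∃ b : Fin n ≃ (L →ₐ[K] Ω),
        (∀ σ i, b (ρ σ i) = (σ : Ω →ₐ[K] Ω).comp (b i)) ∧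
        (∀ l, algebraMap K Ω (Algebra.trace K L l) = ∑ i, b i l) ∧
        (∀ f : Fin n → Ω, (∀ σ i, σ (f i) = f (ρ σ i)) → ∃ l, ∀ i, b i l = f i) ∧
        ∀ l, (∀ i, b i l = 0) → l = 0 := by
  obtain ⟨p, hpm, hdeg, hmap⟩ := exists_map_eq_prod hρ
  have hsep : p.Separable := by
    rw [← Polynomial.separable_map (algebraMap K Ω), hmap, Polynomial.separable_prod_X_sub_C_iff]
    exact hy
  have hroot : ∀ x : Ω, Polynomial.aeval x p = 0 ↔ ∃ i, x = y i := by
    intro x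
    rw [Polynomial.aeval_def, ← Polynomial.eval_map, hmap, Polynomial.eval_prod,
      Finset.prod_eq_zero_iff]
    simp [sub_eq_zero]
  let b₀ : Fin n → (AdjoinRoot p →ₐ[K] Ω) := fun i =>
    AdjoinRoot.liftAlgHom p (Algebra.ofId K Ω) (y i) ((hroot (y i)).mpr ⟨i, rfl⟩)
  have hb₀ : ∀ i, b₀ i (AdjoinRoot.root p) = y i :=
    fun i => AdjoinRoot.liftAlgHom_root ..
  have hbij : Function.Bijective b₀ := by
    refine ⟨fun i j hij => hy ?_, fun φ => ?_⟩
    · rw [← hb₀, ← hb₀, hij]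
    · obtain ⟨i, hi⟩ := (hroot (φ (AdjoinRoot.root p))).mp (by
        rw [Polynomial.aeval_algHom_apply, AdjoinRoot.aeval_eq, AdjoinRoot.mk_self, map_zero])
      exact ⟨i, AdjoinRoot.algHom_ext (by rw [hb₀, hi])⟩
  let bas : Module.Basis (Fin n) K (AdjoinRoot p) :=
    (AdjoinRoot.powerBasis' hpm).basis.reindex (finCongr hdeg)
  have hbas : ∀ i j, b₀ i (bas j) = Matrix.vandermonde y i j := by
    intro i j
    simp [bas, hb₀, Matrix.vandermonde_apply]
    rfl
  have hdet : IsUnit (Matrix.vandermonde y).det :=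
    (Matrix.det_vandermonde_ne_zero_iff.mpr hy).isUnit
  have hexp : ∀ (c : Fin n → K) i, b₀ i (∑ j, c j • bas j) =
      (Matrix.vandermonde y).mulVec (fun j => algebraMap K Ω (c j)) i := by
    intro c i
    rw [map_sum]
    refine Finset.sum_congr rfl fun j _ => ?_
    rw [map_smul, hbas, Algebra.smul_def, mul_comm]
  refine ⟨AdjoinRoot p, inferInstance, inferInstance, etale_adjoinRoot hpm hsep, ?_,
    Equiv.ofBijective b₀ hbij, ?_, ?_, ?_, ?_⟩
  · rw [(AdjoinRoot.powerBasis' hpm).finrank, AdjoinRoot.powerBasis'_dim, hdeg]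
  · intro σ i
    apply AdjoinRoot.algHom_ext
    simp [hb₀, hρ]
  · intro l
    -- The Vandermonde matrix of the roots diagonalizes multiplication by `l`, with the values of
    -- the embeddings on the diagonal; hence the trace is their sum.
    have hM : Matrix.vandermonde y * (Algebra.leftMulMatrix bas l).map (algebraMap K Ω) =
        Matrix.diagonal (fun i => b₀ i l) * Matrix.vandermonde y := by
      ext i j
      rw [Matrix.diagonal_mul, ← hbas, ← map_mul, ← bas.sum_repr (l * bas j), hexp]
      simp [Matrix.mul_apply, Matrix.mulVec, dotProduct, Algebra.leftMulMatrix_eq_repr_mul]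
    have hM' : (Algebra.leftMulMatrix bas l).map (algebraMap K Ω) =
        (Matrix.vandermonde y)⁻¹ * (Matrix.diagonal (fun i => b₀ i l) * Matrix.vandermonde y) := by
      rw [← hM, Matrix.nonsing_inv_mul_cancel_left _ _ hdet]
    have htr : algebraMap K Ω (Algebra.trace K _ l) =
        ((Algebra.leftMulMatrix bas l).map (algebraMap K Ω)).trace := by
      rw [Algebra.trace_eq_matrix_trace bas l]
      simp [Matrix.trace]
    rw [htr, hM', Matrix.trace_mul_comm, Matrix.mul_assoc, Matrix.mul_nonsing_inv _ hdet,
      Matrix.mul_one, Matrix.trace_diagonal]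
    rfl
  · intro f hf
    set c := (Matrix.vandermonde y)⁻¹.mulVec f with hc
    have hVc : (Matrix.vandermonde y).mulVec c = f := by
      rw [hc, Matrix.mulVec_mulVec, Matrix.mul_nonsing_inv _ hdet, Matrix.one_mulVec]
    -- The interpolation problem has a unique solution. An equivariant right-hand side is solved
    -- equally by the Galois conjugate of the solution, so the coefficients are fixed.
    have hfix : ∀ j, c j ∈ Set.range (algebraMap K Ω) := by
      intro j
      rw [InfiniteGalois.mem_range_algebraMap_iff_fixed]
      intro σ
      have h1 : (Matrix.vandermonde y).mulVec (fun j => σ (c j)) = f := by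
        funext i
        obtain ⟨i, rfl⟩ := (ρ σ).surjective i
        rw [← hf, ← hVc]
        simp [Matrix.mulVec, dotProduct, Matrix.vandermonde_apply, hρ]
      have h2 : (fun j => σ (c j)) = c := by
        calc (fun j => σ (c j)) = (Matrix.vandermonde y)⁻¹.mulVec
              ((Matrix.vandermonde y).mulVec (fun j => σ (c j))) := by
              rw [Matrix.mulVec_mulVec, Matrix.nonsing_inv_mul _ hdet, Matrix.one_mulVec]
          _ = c := by rw [h1]
      exact congrFun h2 j
    choose d hd using hfix
    refine ⟨∑ j, d j • bas j, fun i => ?_⟩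
    rw [Equiv.ofBijective_apply, hexp]
    simp only [hd]
    exact congrFun hVc i
  · intro l hl
    rw [← bas.sum_repr l]
    have h0 : (Matrix.vandermonde y).mulVec (fun j => algebraMap K Ω (bas.repr l j)) = 0 := by
      funext i
      rw [← hexp, bas.sum_repr]
      exact hl i
    have h1 : (fun j => algebraMap K Ω (bas.repr l j)) = 0 := by
      rw [← Matrix.one_mulVec (fun j => algebraMap K Ω (bas.repr l j)),
        ← Matrix.nonsing_inv_mul _ hdet, ← Matrix.mulVec_mulVec, h0, Matrix.mulVec_zero]
    refine Finset.sum_eq_zero fun j _ => ?_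
    have h2 := congrFun h1 j
    simp only [Pi.zero_apply, map_eq_zero] at h2
    rw [h2, zero_smul]

end EtaleAlgebra

/-! ### Making the six linear forms Galois-equivariant. -/

section Descent

variable {K Ω : Type*} [Field K] [Field Ω] [Algebra K Ω]

theorem linear_apply_eq_sum {ι κ : Type*} [Fintype ι] [DecidableEq ι]
    (f : (ι → Ω) →ₗ[Ω] (κ → Ω)) (v : ι → Ω) (j : κ) : f v j = ∑ i, f (Pi.single i 1) j * v i := by
  conv_lhs => rw [← Finset.univ_sum_single v]
  rw [map_sum, Finset.sum_apply]
  refine Finset.sum_congr rfl fun i _ => ?_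
  rw [mul_comm, ← smul_eq_mul, ← Pi.smul_apply, ← map_smul, ← Pi.single_smul, smul_eq_mul, mul_one]

/-- Conjugation of a linear map by a Galois automorphism. -/
def conjLin {ι κ : Type*} (σ : Ω ≃ₐ[K] Ω) (f : (ι → Ω) →ₗ[Ω] (κ → Ω)) :
    (ι → Ω) →ₗ[Ω] (κ → Ω) where
  toFun w j := σ (f (fun i => σ.symm (w i)) j)
  map_add' v w := by
    funext j
    have : (fun i => σ.symm ((v + w) i)) = (fun i => σ.symm (v i)) + fun i => σ.symm (w i) := by
      funext i; simp
    rw [this]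
    simp
  map_smul' a v := by
    funext j
    have : (fun i => σ.symm ((a • v) i)) = σ.symm a • fun i => σ.symm (v i) := by
      funext i; simp
    rw [this]
    simp

theorem conjLin_apply {ι κ : Type*} (σ : Ω ≃ₐ[K] Ω) (f : (ι → Ω) →ₗ[Ω] (κ → Ω)) (w : ι → Ω) (j : κ) :
    conjLin σ f (fun i => σ (w i)) j = σ (f w j) := by
  change σ (f (fun i => σ.symm (σ (w i))) j) = _
  simp

theorem IsSumZeroIso.conjLin {ι : Type*} {f : (ι → Ω) →ₗ[Ω] (Fin 6 → Ω)} (hf : IsSumZeroIso f)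
    (σ : Ω ≃ₐ[K] Ω) : IsSumZeroIso (conjLin σ f) := by
  have hw : ∀ w : ι → Ω, ∃ v : ι → Ω, w = fun i => σ (v i) :=
    fun w => ⟨fun i => σ.symm (w i), by simp⟩
  refine ⟨fun w h => ?_, fun w => ?_, fun x hx => ?_⟩
  · obtain ⟨v, rfl⟩ := hw w
    have : f v = 0 := by
      funext j
      have := congrFun h j
      rw [conjLin_apply] at this
      simpa using this
    rw [hf.inj v this]
    funext i
    simp
  · obtain ⟨v, rfl⟩ := hw w
    simp only [conjLin_apply, ← map_sum, hf.sum_eq, map_zero]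
  · obtain ⟨v, hv⟩ := hf.surj (fun i => σ.symm (x i)) (by rw [← map_sum, hx, map_zero])
    refine ⟨fun i => σ (v i), funext fun j => ?_⟩
    rw [conjLin_apply, hv]
    simp

/-- A polynomial vanishing on a grid with infinite sides is zero, and the image of `K` is infinite.
-/
theorem exists_algebraMap_eval_ne_zero [Infinite K] {n : ℕ} {P : MvPolynomial (Fin n) Ω}
    (hP : P ≠ 0) : ∃ v : Fin n → K, eval (fun i => algebraMap K Ω (v i)) P ≠ 0 := by
  by_contra! h
  refine hP (funext_set (fun _ => Set.range (algebraMap K Ω))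
    (fun _ => Set.infinite_range_of_injective (algebraMap K Ω).injective) fun x hx => ?_)
  choose v hv using fun i => hx i (Set.mem_univ i)
  rw [map_zero, ← funext hv, h]

theorem galois_aeval {n : ℕ} (F : MvPolynomial (Fin n) K) (σ : Ω ≃ₐ[K] Ω) (v : Fin n → Ω) :
    aeval (fun i => σ (v i)) F = σ (aeval v F) :=
  (comp_aeval_apply v (σ : Ω →ₐ[K] Ω) F).symm

variable [CharZero K]

/-- The product of all the forms required not to vanish is a nonzero polynomial, each factor being
nonzero at some vector, so it is nonzero at a rational one. -/
theorem IsSumZeroIso.exists_generic [CharZero Ω] {n : ℕ} {f : (Fin n → Ω) →ₗ[Ω] (Fin 6 → Ω)}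
    (hf : IsSumZeroIso f) : ∃ v : Fin n → K,
      let w : Fin n → Ω := fun i => algebraMap K Ω (v i)
      ∑ i, f w i ^ 2 ≠ 0 ∧ ∑ i, f w i ^ 3 ≠ 0 ∧ Function.Injective (f w) := by
  let Q : Fin 6 → MvPolynomial (Fin n) Ω := fun j => ∑ i, C (f (Pi.single i 1) j) * X i
  have hQ : ∀ w j, eval w (Q j) = f w j := by
    intro w j
    rw [linear_apply_eq_sum]
    simp [Q]
  have h2 : ∑ i, Q i ^ 2 ≠ 0 := by
    intro h0
    obtain ⟨w, hw⟩ := hf.surj ![1, -1, 0, 0, 0, 0] (by simp [Fin.sum_univ_six])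
    have := congrArg (eval w) h0
    simp only [map_sum, map_pow, hQ, hw] at this
    simp [Fin.sum_univ_six] at this
  have h3 : ∑ i, Q i ^ 3 ≠ 0 := by
    intro h0
    obtain ⟨w, hw⟩ := hf.surj ![2, -1, -1, 0, 0, 0] (by simp [Fin.sum_univ_six]; norm_num)
    have := congrArg (eval w) h0
    simp only [map_sum, map_pow, hQ, hw] at this
    simp [Fin.sum_univ_six] at this
    norm_num at this
  have hd : ∏ p ∈ (Finset.univ : Finset (Fin 6)).offDiag, (Q p.1 - Q p.2) ≠ 0 := by
    rw [Finset.prod_ne_zero_iff]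
    rintro ⟨i, j⟩ hij h0
    have hij' : i ≠ j := by simpa using hij
    obtain ⟨w, hw⟩ := hf.surj (rootVec Ω i j) (sum_rootVec i j)
    have := congrArg (eval w) h0
    simp only [map_sub, hQ, hw, rootVec_apply, map_zero] at this
    simp [hij', hij'.symm] at this
  obtain ⟨v, hv⟩ := exists_algebraMap_eval_ne_zero (K := K) (mul_ne_zero (mul_ne_zero h2 h3) hd)
  simp only [map_mul, map_sum, map_pow, map_prod, map_sub, hQ] at hv
  have hv1 := left_ne_zero_of_mul hv
  refine ⟨v, left_ne_zero_of_mul hv1, right_ne_zero_of_mul hv1, fun i j hij => ?_⟩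
  by_contra hne
  exact Finset.prod_ne_zero_iff.mp (right_ne_zero_of_mul hv) (i, j) (by simpa using hne)
    (sub_eq_zero.mpr hij)

/-- A system of linear forms as in a ten-nodal cubic can be rescaled so that the Galois group
permutes it. -/
theorem IsSumZeroIso.exists_equivariant [CharZero Ω] {n : ℕ} {f : (Fin n → Ω) →ₗ[Ω] (Fin 6 → Ω)}
    (hf : IsSumZeroIso f) {F : MvPolynomial (Fin n) K} {a : Ω} (ha : a ≠ 0)
    (hF : ∀ v, aeval v F = a * ∑ i, f v i ^ 3) :
    ∃ (g : (Fin n → Ω) →ₗ[Ω] (Fin 6 → Ω)) (b : Ω), IsSumZeroIso g ∧ b ≠ 0 ∧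
      (∀ v, aeval v F = b * ∑ i, g v i ^ 3) ∧
      (∃ v : Fin n → K, ∑ i, g (fun i => algebraMap K Ω (v i)) i ^ 3 ≠ 0 ∧
        Function.Injective (g fun i => algebraMap K Ω (v i))) ∧
      ∃ ρ : (Ω ≃ₐ[K] Ω) →* Equiv.Perm (Fin 6),
        ∀ σ w i, σ (g w i) = g (fun j => σ (w j)) (ρ σ i) := by
  obtain ⟨v, h2, h3, hinj⟩ := hf.exists_generic (K := K)
  set w₀ : Fin n → Ω := fun i => algebraMap K Ω (v i) with hw₀
  have hperm : ∀ σ : Ω ≃ₐ[K] Ω, ∃ (κ : Ω) (π : Equiv.Perm (Fin 6)), κ ≠ 0 ∧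
      ∀ w i, σ (f w i) = κ * f (fun j => σ (w j)) (π i) := by
    intro σ
    have hcube : ∀ w, ∑ i, SegreCubic.conjLin σ f w i ^ 3 = (a / σ a) * ∑ i, f w i ^ 3 := by
      intro w
      obtain ⟨u, rfl⟩ : ∃ u : Fin n → Ω, w = fun i => σ (u i) :=
        ⟨fun i => σ.symm (w i), by simp⟩
      simp only [conjLin_apply]
      have h1 := galois_aeval F σ u
      rw [hF, hF, map_mul, map_sum] at h1
      simp only [map_pow] at h1
      have hσa : σ a ≠ 0 := by simpa using ha
      field_simp
      rw [h1, mul_comm]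
    obtain ⟨κ, π, hκ, h⟩ := exists_perm_of_tri_eq hf (hf.conjLin σ) (tri_eq_of_cube_eq hcube)
    refine ⟨κ, π⁻¹, hκ, fun w i => ?_⟩
    rw [← h, ← conjLin_apply]
    simp
  choose κ π hκ hπ using hperm
  have hw₀' : ∀ σ : Ω ≃ₐ[K] Ω, (fun j => σ (w₀ j)) = w₀ := fun σ => funext fun j => by simp [hw₀]
  -- Under `σ` the sums of squares and of cubes at the rational vector `w₀` are divided out of their
  -- permutation and scale by `κ²` and `κ³`. Their quotient scales by `κ⁻¹`: an explicit Hilbert 90.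
  set t : Ω := (∑ i, f w₀ i ^ 2) / ∑ i, f w₀ i ^ 3 with ht
  have ht0 : t ≠ 0 := div_ne_zero h2 h3
  have htσ : ∀ σ, σ t * κ σ = t := by
    intro σ
    have e2 : σ (∑ i, f w₀ i ^ 2) = κ σ ^ 2 * ∑ i, f w₀ i ^ 2 := by
      rw [map_sum, Finset.mul_sum, ← Equiv.sum_comp (π σ) fun i => κ σ ^ 2 * f w₀ i ^ 2]
      refine Finset.sum_congr rfl fun i _ => ?_
      rw [map_pow, hπ, hw₀']; ring
    have e3 : σ (∑ i, f w₀ i ^ 3) = κ σ ^ 3 * ∑ i, f w₀ i ^ 3 := by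
      rw [map_sum, Finset.mul_sum, ← Equiv.sum_comp (π σ) fun i => κ σ ^ 3 * f w₀ i ^ 3]
      refine Finset.sum_congr rfl fun i _ => ?_
      rw [map_pow, hπ, hw₀']; ring
    have := hκ σ
    rw [ht, map_div₀, e2, e3]
    field_simp
  have hg : ∀ σ w i, σ ((t • f) w i) = (t • f) (fun j => σ (w j)) (π σ i) := by
    intro σ w i
    simp only [LinearMap.smul_apply, Pi.smul_apply, smul_eq_mul, map_mul, hπ]
    conv_rhs => rw [← htσ σ]
    ring
  have hginj : Function.Injective ((t • f) w₀) := by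
    intro i j hij
    refine hinj (mul_left_cancel₀ ht0 ?_)
    simpa using hij
  have hgw : ∀ σ i, σ ((t • f) w₀ i) = (t • f) w₀ (π σ i) := fun σ i => by rw [hg, hw₀']
  refine ⟨t • f, a / t ^ 3, ⟨fun w h => hf.inj w ?_, fun w => ?_, fun x hx => ?_⟩,
    div_ne_zero ha (pow_ne_zero 3 ht0), fun w => ?_, ⟨v, ?_, hginj⟩,
    { toFun := π, map_one' := ?_, map_mul' := fun σ τ => ?_ }, hg⟩
  · exact (smul_eq_zero.mp h).resolve_left ht0
  · simp [← Finset.mul_sum, hf.sum_eq]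
  · obtain ⟨w, hw⟩ := hf.surj (t⁻¹ • x) (by simp [← Finset.mul_sum, hx])
    exact ⟨w, by rw [LinearMap.smul_apply, hw, smul_inv_smul₀ ht0]⟩
  · rw [hF]
    simp only [LinearMap.smul_apply, Pi.smul_apply, smul_eq_mul, mul_pow, ← Finset.mul_sum]
    field_simp
  · simp only [LinearMap.smul_apply, Pi.smul_apply, smul_eq_mul, mul_pow, ← Finset.mul_sum]
    exact mul_ne_zero (pow_ne_zero 3 ht0) h3
  -- The values at `w₀` are distinct and `σ` permutes them through `π σ`, so multiplicativity can be
  -- read off from them.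
  · ext i : 1
    exact hginj (hgw 1 i).symm
  · ext i : 1
    refine hginj ?_
    rw [← hgw, AlgEquiv.mul_apply, hgw, hgw]
    rfl

end Descent

end SegreCubic

/-! ### Points of the Segre cubic and linear morphisms. -/

namespace SegreCubic

section Points

variable {K Ω : Type*} [Field K] [Field Ω] [Algebra K Ω]

theorem mk_mem_zeros {ι : Type*} {S : Set (MvPolynomial ι K)} {v : ι → Ω} (hv : v ≠ 0) :
    Projectivization.mk Ω v hv ∈ zeros Ω S ↔ ∀ f ∈ S, ∀ a : Ω, aeval (a • v) f = 0 := by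
  simp [zeros, Projectivization.submodule_mk, Submodule.mem_span_singleton]

theorem mk_mem_segre {v : Fin 6 → Ω} (hv : v ≠ 0) :
    Projectivization.mk Ω v hv ∈ segre K Ω ↔ ∑ i, v i = 0 ∧ ∑ i, v i ^ 3 = 0 := by
  rw [mk_mem_zeros]
  simp only [segreEqs, Set.mem_insert_iff, Set.mem_singleton_iff, forall_eq_or_imp, forall_eq,
    map_sum, map_pow, aeval_X, Pi.smul_apply, smul_eq_mul, mul_pow, ← Finset.mul_sum]
  constructor
  · rintro ⟨h1, h3⟩
    exact ⟨by simpa using h1 1, by simpa using h3 1⟩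
  · rintro ⟨h1, h3⟩
    simp [h1, h3]

theorem isMorphism_of_matrix {ι κ : Type*} [Fintype ι] {k : Type*} [Field k] [Algebra k Ω]
    {X : Set (ℙ Ω (ι → Ω))} {Y : Set (ℙ Ω (κ → Ω))} (A : Matrix κ ι k) {φ : X → Y}
    (h : ∀ q : X, ∃ h : (fun j => ∑ i, algebraMap k Ω (A j i) * q.1.rep i) ≠ 0,
      (φ q).1 = Projectivization.mk Ω _ h) : IsMorphism k φ := by
  intro p
  have he : ∀ q : X, (fun j => aeval q.1.rep (∑ i, C (A j i) * MvPolynomial.X i)) =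
      fun j => ∑ i, algebraMap k Ω (A j i) * q.1.rep i := by
    intro q
    simp
  refine ⟨1, fun j => ∑ i, C (A j i) * MvPolynomial.X i, fun j => ?_, ?_, fun q hq => ?_⟩
  · refine IsHomogeneous.sum _ _ _ fun i _ => ?_
    simpa using (isHomogeneous_C ι (A j i)).mul (isHomogeneous_X k i)
  · rw [he]
    exact (h p).1
  · obtain ⟨h1, h2⟩ := h q
    rw [h2]
    congr 1
    exact (he q).symm

theorem isMorphism_of_linear {ι κ : Type*} [Fintype ι] [DecidableEq ι]
    {X : Set (ℙ Ω (ι → Ω))} {Y : Set (ℙ Ω (κ → Ω))} (A : (ι → Ω) →ₗ[Ω] (κ → Ω)) {φ : X → Y}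
    (h : ∀ q : X, ∃ h : A q.1.rep ≠ 0, (φ q).1 = Projectivization.mk Ω _ h) :
    IsMorphism Ω φ := by
  refine isMorphism_of_matrix (fun j i => A (Pi.single i 1) j) fun q => ?_
  have he : (fun j => ∑ i, algebraMap Ω Ω (A (Pi.single i 1) j) * q.1.rep i) = A q.1.rep := by
    funext j
    rw [linear_apply_eq_sum]
    rfl
  obtain ⟨h1, h2⟩ := h q
  refine ⟨by rwa [he], ?_⟩
  rw [h2]
  congr 1
  exact he.symm

end Points

/-! ### Twists and trace forms. -/

section Twist


variable {K : Type u} {Ω : Type*} [Field K] [Field Ω] [Algebra K Ω]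

/-- `g` identifies the hypersurface with the Segre cubic, and the twisting isomorphism `ψ` is the
inverse of this identification. Equivariance of `g` up to `ρ` is then the twisting identity. -/
theorem isTwist_of_linear {n : ℕ} {F : MvPolynomial (Fin n) K} {g : (Fin n → Ω) →ₗ[Ω] (Fin 6 → Ω)}
    (hg : IsSumZeroIso g) {b : Ω} (hb : b ≠ 0) (hF : ∀ v, aeval v F = b * ∑ i, g v i ^ 3)
    {ρ : (Ω ≃ₐ[K] Ω) → Equiv.Perm (Fin 6)}
    (hρ : ∀ σ w i, σ (g w i) = g (fun j => σ (w j)) (ρ σ i))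
    {c : (Ω ≃ₐ[K] Ω) → autGroup Ω (segre K Ω)}
    (hc : ∀ σ, (c σ : Equiv.Perm (segre K Ω)) = segrePerm K Ω (ρ σ)) :
    IsTwist (segreEqs K) {F} c := by
  have hinj : Function.Injective g :=
    (injective_iff_map_eq_zero g).mpr hg.inj
  have hmem : ∀ (v : Fin n → Ω) (hv : v ≠ 0), Projectivization.mk Ω v hv ∈ zeros Ω {F} ↔
      Projectivization.mk Ω (g v) (fun h => hv (hg.inj v h)) ∈ segre K Ω := by
    intro v hv
    rw [mk_mem_zeros, mk_mem_segre]
    simp only [Set.mem_singleton_iff, forall_eq, hF, map_smul, Pi.smul_apply, smul_eq_mul, mul_pow,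
      ← Finset.mul_sum, hg.sum_eq, true_and]
    constructor
    · intro h
      simpa [hb] using h 1
    · intro h a
      rw [h, mul_zero, mul_zero]
  let χ₀ : zeros Ω {F} → segre K Ω := fun q => ⟨Projectivization.map g hinj q.1, by
    have := q.2
    rw [← q.1.mk_rep] at this ⊢
    exact (hmem _ _).mp this⟩
  have hχ₀ : Function.Bijective χ₀ := by
    constructor
    · intro p q hpq
      exact Subtype.ext (Projectivization.map_injective g hinj (congrArg Subtype.val hpq))
    · rintro ⟨p, hp⟩
      induction p using Projectivization.ind with
      | h v hv =>
        obtain ⟨w, rfl⟩ := hg.surj v ((mk_mem_segre hv).mp hp).1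
        have hw : w ≠ 0 := by rintro rfl; exact hv (map_zero g)
        exact ⟨⟨Projectivization.mk Ω w hw, (hmem w hw).mpr hp⟩, rfl⟩
  let χ := Equiv.ofBijective χ₀ hχ₀
  obtain ⟨f, hf⟩ := g.exists_leftInverse_of_injective (LinearMap.ker_eq_bot.mpr hinj)
  have hf' : ∀ w, f (g w) = w := fun w => congrArg (fun l => l w) hf
  refine ⟨χ.symm, ?_, ?_, ?_⟩
  · refine isMorphism_of_linear f fun p => ?_
    obtain ⟨q, rfl⟩ := χ.surjective p
    obtain ⟨q, hq⟩ := q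
    induction q using Projectivization.ind with
    | h v hv =>
      rw [Equiv.symm_apply_apply]
      have hgv : g v ≠ 0 := fun h => hv (hg.inj v h)
      obtain ⟨a, ha⟩ := Projectivization.exists_smul_eq_mk_rep Ω (g v) hgv
      have hrep : (χ ⟨Projectivization.mk Ω v hv, hq⟩).1.rep = a • g v := ha.symm
      have hfr : f (χ ⟨Projectivization.mk Ω v hv, hq⟩).1.rep = a • v := by
        rw [hrep, Units.smul_def, map_smul, hf', Units.smul_def]
      have hne : f (χ ⟨Projectivization.mk Ω v hv, hq⟩).1.rep ≠ 0 := by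
        rw [hfr]
        exact (smul_ne_zero_iff_ne a).mpr hv
      refine ⟨hne, ?_⟩
      rw [Projectivization.mk_eq_mk_iff]
      exact ⟨a⁻¹, by rw [hfr, inv_smul_smul]⟩
  · rw [Equiv.symm_symm]
    refine isMorphism_of_linear g fun p => ⟨fun h => p.1.rep_nonzero (hg.inj _ h), ?_⟩
    change Projectivization.map g hinj p.1 = _
    conv_lhs => rw [← p.1.mk_rep]
    rfl
  · intro σ p
    obtain ⟨p, rfl⟩ := (galPerm (segreEqs K) σ).surjective p
    obtain ⟨q, rfl⟩ := χ.surjective p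
    have hinv : (galPerm (segreEqs K) σ)⁻¹ (galPerm (segreEqs K) σ (χ q)) = χ q :=
      Equiv.symm_apply_apply _ _
    rw [hinv, Equiv.symm_apply_apply, Equiv.eq_symm_apply, hc]
    apply Subtype.ext
    obtain ⟨q, hq⟩ := q
    induction q using Projectivization.ind with
    | h v hv =>
      change Projectivization.mk Ω (g (galVec _ σ v)) _ = Projectivization.mk Ω
        (LinearMap.funLeft Ω Ω (ρ σ).symm (galVec _ σ (g v))) _
      congr 1
      funext i
      obtain ⟨i, rfl⟩ := (ρ σ).surjective i
      change g (fun j => σ (v j)) (ρ σ i) = σ (g v ((ρ σ).symm (ρ σ i)))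
      rw [Equiv.symm_apply_apply, hρ]

/-- An automorphism fixing the finite extension generated by the distinct values `y i` induces the
identity permutation, so the kernel contains an open subgroup. -/
theorem isOpen_ker_of_injective {n : ℕ} {y : Fin n → Ω} (hy : Function.Injective y)
    [Algebra.IsAlgebraic K Ω] {ρ : (Ω ≃ₐ[K] Ω) →* Equiv.Perm (Fin n)}
    (hρ : ∀ σ i, σ (y i) = y (ρ σ i)) : IsOpen (ρ.ker : Set (Ω ≃ₐ[K] Ω)) := by
  have hfin : FiniteDimensional K (IntermediateField.adjoin K (Set.range y)) :=
    IntermediateField.finiteDimensional_adjoin fun x _ => Algebra.IsIntegral.isIntegral x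
  refine Subgroup.isOpen_mono (H₁ := (IntermediateField.adjoin K (Set.range y)).fixingSubgroup) ?_
    (IntermediateField.fixingSubgroup_isOpen _)
  intro σ hσ
  rw [MonoidHom.mem_ker]
  ext i : 1
  refine hy ?_
  rw [← hρ]
  rw [IntermediateField.mem_fixingSubgroup_iff] at hσ
  exact hσ _ (IntermediateField.subset_adjoin K _ ⟨i, rfl⟩)

/-- Equivariance lets the values of `g` at a rational vector be interpolated by an element of `L`.
In the coordinates `B i` the trace is a sum, so `Tr (z ^ 3)` becomes the sum of cubes. -/
theorem isTraceCubic_of_equivariant [IsGalois K Ω] {F : MvPolynomial (Fin 5) K}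
    {g : (Fin 5 → Ω) →ₗ[Ω] (Fin 6 → Ω)} (hg : IsSumZeroIso g) {b : Ω} (hb : b ≠ 0)
    (hF : ∀ v, aeval v F = b * ∑ i, g v i ^ 3)
    {ρ : (Ω ≃ₐ[K] Ω) → Equiv.Perm (Fin 6)}
    (hρ : ∀ σ w i, σ (g w i) = g (fun j => σ (w j)) (ρ σ i)) {v₀ : Fin 5 → K}
    (hv₀ : ∑ i, g (fun i => algebraMap K Ω (v₀ i)) i ^ 3 ≠ 0)
    {L : Type*} [CommRing L] [Algebra K L] {B : Fin 6 → (L →ₐ[K] Ω)}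
    (htr : ∀ l, algebraMap K Ω (Algebra.trace K L l) = ∑ i, B i l)
    (hex : ∀ f : Fin 6 → Ω, (∀ σ i, σ (f i) = f (ρ σ i)) → ∃ l, ∀ i, B i l = f i)
    (hBσ : ∀ σ i, B (ρ σ i) = (σ : Ω →ₐ[K] Ω).comp (B i))
    (huniq : ∀ l, (∀ i, B i l = 0) → l = 0) : IsTraceCubic F L := by
  have hex' : ∀ x : Fin 5 → K, ∃ l, ∀ i, B i l = g (fun j => algebraMap K Ω (x j)) i := by
    intro x
    refine hex _ fun σ i => ?_
    rw [hρ]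
    simp
  choose ℓ hℓ using hex'
  have huniq' : ∀ l l', (∀ i, B i l = B i l') → l = l' := fun l l' h =>
    sub_eq_zero.mp (huniq _ fun i => by rw [map_sub, h, sub_self])
  let ℓ' : (Fin 5 → K) →ₗ[K] L :=
    { toFun := ℓ
      map_add' := fun x y => huniq' _ _ fun i => by
        have : (fun j => algebraMap K Ω ((x + y) j)) =
            (fun j => algebraMap K Ω (x j)) + fun j => algebraMap K Ω (y j) := by
          funext j
          simp
        rw [map_add, hℓ, hℓ, hℓ, this, map_add, Pi.add_apply]
      map_smul' := fun a x => huniq' _ _ fun i => by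
        have : (fun j => algebraMap K Ω ((a • x) j)) =
            algebraMap K Ω a • fun j => algebraMap K Ω (x j) := by
          funext j
          simp
        rw [RingHom.id_apply, map_smul, hℓ, hℓ, this, map_smul, Pi.smul_apply, smul_eq_mul,
          Algebra.smul_def] }
  have hsum3 : ∀ x : Fin 5 → K, algebraMap K Ω (Algebra.trace K L (ℓ x ^ 3)) * b =
      algebraMap K Ω (eval x F) := by
    intro x
    have h1 : algebraMap K Ω (eval x F) = aeval (fun j => algebraMap K Ω (x j)) F :=
      (aeval_algebraMap_apply Ω x F).symm
    rw [htr, h1, hF, mul_comm]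
    simp only [map_pow, hℓ]
  -- At `v₀` both the trace and the value of `F` are nonzero elements of `K`, which forces `b` to be
  -- rational.
  obtain ⟨a, ha⟩ : ∃ a : K, algebraMap K Ω a * b = 1 := by
    have h1 := hsum3 v₀
    have h2 : algebraMap K Ω (Algebra.trace K L (ℓ v₀ ^ 3)) ≠ 0 := by
      rw [htr]
      simpa only [map_pow, hℓ] using hv₀
    have h3 : algebraMap K Ω (eval v₀ F) ≠ 0 := by
      rw [← h1]; exact mul_ne_zero h2 hb
    refine ⟨Algebra.trace K L (ℓ v₀ ^ 3) / eval v₀ F, ?_⟩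
    rw [map_div₀, div_mul_eq_mul_div, h1, div_self h3]
  refine ⟨ℓ', ?_, ?_, a, ?_, fun x => ?_⟩
  · refine (injective_iff_map_eq_zero ℓ').mpr fun x hx => ?_
    have : g (fun j => algebraMap K Ω (x j)) = 0 := by
      funext i
      rw [← hℓ]
      change B i (ℓ' x) = 0
      rw [hx, map_zero]
    have h0 := hg.inj _ this
    funext j
    simpa using congrFun h0 j
  · ext l
    rw [LinearMap.mem_range, LinearMap.mem_ker]
    constructor
    · rintro ⟨x, rfl⟩
      apply (algebraMap K Ω).injective
      rw [htr, map_zero]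
      change ∑ i, B i (ℓ x) = 0
      simp only [hℓ, hg.sum_eq]
    · intro hl
      obtain ⟨w, hw⟩ := hg.surj (fun i => B i l) (by rw [← htr, hl, map_zero])
      -- The preimage of an equivariant vector under the injective equivariant `g` is Galois-fixed.
      have hfix : ∀ j, w j ∈ Set.range (algebraMap K Ω) := by
        intro j
        rw [InfiniteGalois.mem_range_algebraMap_iff_fixed]
        intro σ
        have : (fun j => σ (w j)) = w := by
          rw [← sub_eq_zero]
          apply hg.inj
          rw [map_sub, sub_eq_zero]
          funext i
          obtain ⟨i, rfl⟩ := (ρ σ).surjective i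
          rw [← hρ, hw]
          exact (congrArg (fun φ => φ l) (hBσ σ i)).symm
        exact congrFun this j
      choose x hx using hfix
      refine ⟨x, huniq' _ _ fun i => ?_⟩
      change B i (ℓ x) = _
      rw [hℓ, funext hx, hw]
  · rintro rfl
    simp at ha
  · apply (algebraMap K Ω).injective
    rw [map_mul, ← hsum3]
    change algebraMap K Ω (Algebra.trace K L (ℓ x ^ 3)) = _
    linear_combination (-algebraMap K Ω (Algebra.trace K L (ℓ x ^ 3))) * ha

/-- Every ten-nodal cubic threefold is a twist of the Segre cubic, and is given by the trace form of
the corresponding étale algebra. -/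
theorem IsTenNodalCubic.exists_twist [CharZero K] {F : MvPolynomial (Fin 5) K}
    (hF : IsTenNodalCubic F)
    {e : Equiv.Perm (Fin 6) → autGroup (AlgebraicClosure K) (segre K (AlgebraicClosure K))}
    (he : ∀ π, (e π : Equiv.Perm (segre K (AlgebraicClosure K))) = segrePerm K _ π) :
    ∃ ρ : (AlgebraicClosure K ≃ₐ[K] AlgebraicClosure K) →* Equiv.Perm (Fin 6),
      IsOpen (ρ.ker : Set (AlgebraicClosure K ≃ₐ[K] AlgebraicClosure K)) ∧
      IsTwist (segreEqs K) {F} (fun σ => e (ρ σ)) ∧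
      ∃ (L : Type u) (_ : CommRing L) (_ : Algebra K L),
        Algebra.Etale K L ∧ Module.finrank K L = 6 ∧
        (∃ b : Fin 6 ≃ (L →ₐ[K] AlgebraicClosure K), ∀ σ i,
          b (ρ σ i) = (σ : AlgebraicClosure K →ₐ[K] AlgebraicClosure K).comp (b i)) ∧
        IsTraceCubic F L := by
  obtain ⟨f, hf, a, ha, hFf⟩ := hF.exists_sum_cube
  have : CharZero (AlgebraicClosure K) := charZero_of_injective_algebraMap
    (algebraMap K (AlgebraicClosure K)).injective
  obtain ⟨g, b, hg, hb, hFg, ⟨v₀, hv₀, hinj⟩, ρ, hρ⟩ := hf.exists_equivariant ha hFf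
  have hy : ∀ (σ : AlgebraicClosure K ≃ₐ[K] AlgebraicClosure K) i,
      σ (g (fun i => algebraMap K (AlgebraicClosure K) (v₀ i)) i) =
        g (fun i => algebraMap K (AlgebraicClosure K) (v₀ i)) (ρ σ i) := by
    intro σ i
    rw [hρ]
    simp
  obtain ⟨L, hL1, hL2, het, hrank, B, hB, htr, hex, huniq⟩ := exists_etale_algebra hinj hy
  exact ⟨ρ, isOpen_ker_of_injective hinj hy, isTwist_of_linear hg hb hFg hρ fun σ => he _,
    L, hL1, hL2, het, hrank, ⟨B, hB⟩,
    isTraceCubic_of_equivariant hg hb hFg hρ hv₀ htr hex hB huniq⟩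

end Twist

end SegreCubic

/-! ### The parametrization of the Segre cubic by quadrics. -/

namespace SegreCubic

section Parametrization

/-- Quadrics through five points of `ℙ³`, parametrizing the Segre cubic. -/
def quad {R : Type*} [CommRing R] (t : Fin 4 → R) : Fin 6 → R :=
  ![-(t 1 * (t 2 - t 3)) + t 2 * (t 0 - t 3) + t 0 * (t 1 - t 3),
    t 1 * (t 2 - t 3) - t 2 * (t 0 - t 3) + t 0 * (t 1 - t 3),
    t 1 * (t 2 - t 3) + t 2 * (t 0 - t 3) - t 0 * (t 1 - t 3),
    t 2 * (t 1 - t 3) - t 0 * (t 2 - t 3) - t 1 * (t 0 - t 3),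
    -(t 2 * (t 1 - t 3)) + t 0 * (t 2 - t 3) - t 1 * (t 0 - t 3),
    -(t 2 * (t 1 - t 3)) - t 0 * (t 2 - t 3) + t 1 * (t 0 - t 3)]

/-- The symmetric bilinear map associated with `quad`. -/
def quadPolar {R : Type*} [CommRing R] (t v : Fin 4 → R) : Fin 6 → R :=
  ![-(t 1 * (v 2 - v 3) + v 1 * (t 2 - t 3)) + (t 2 * (v 0 - v 3) + v 2 * (t 0 - t 3)) +
      (t 0 * (v 1 - v 3) + v 0 * (t 1 - t 3)),
    t 1 * (v 2 - v 3) + v 1 * (t 2 - t 3) - (t 2 * (v 0 - v 3) + v 2 * (t 0 - t 3)) +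
      (t 0 * (v 1 - v 3) + v 0 * (t 1 - t 3)),
    t 1 * (v 2 - v 3) + v 1 * (t 2 - t 3) + (t 2 * (v 0 - v 3) + v 2 * (t 0 - t 3)) -
      (t 0 * (v 1 - v 3) + v 0 * (t 1 - t 3)),
    t 2 * (v 1 - v 3) + v 2 * (t 1 - t 3) - (t 0 * (v 2 - v 3) + v 0 * (t 2 - t 3)) -
      (t 1 * (v 0 - v 3) + v 1 * (t 0 - t 3)),
    -(t 2 * (v 1 - v 3) + v 2 * (t 1 - t 3)) + (t 0 * (v 2 - v 3) + v 0 * (t 2 - t 3)) -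
      (t 1 * (v 0 - v 3) + v 1 * (t 0 - t 3)),
    -(t 2 * (v 1 - v 3) + v 2 * (t 1 - t 3)) - (t 0 * (v 2 - v 3) + v 0 * (t 2 - t 3)) +
      (t 1 * (v 0 - v 3) + v 1 * (t 0 - t 3))]

section Ring

variable {R : Type*} [CommRing R]

theorem map_quad {S F : Type*} [CommRing S] [FunLike F R S] [RingHomClass F R S] (f : F)
    (t : Fin 4 → R) (i : Fin 6) : f (quad t i) = quad (fun j => f (t j)) i := by
  fin_cases i <;> simp [quad]

theorem quad_add_smul (t v : Fin 4 → R) (s : R) :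
    quad (t + s • v) = quad t + s • quadPolar t v + s ^ 2 • quad v := by
  funext i
  fin_cases i <;> simp [quad, quadPolar] <;> ring

theorem quad_smul (t : Fin 4 → R) (s : R) : quad (s • t) = s ^ 2 • quad t := by
  funext i
  fin_cases i <;> simp [quad] <;> ring

theorem quadPolar_self (t : Fin 4 → R) : quadPolar t t = (2 : R) • quad t := by
  funext i
  fin_cases i <;> simp [quad, quadPolar] <;> ring

theorem quadPolar_smul (t v : Fin 4 → R) (s : R) : quadPolar t (s • v) = s • quadPolar t v := by
  funext i
  fin_cases i <;> simp [quadPolar] <;> ring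

theorem quadPolar_add (t v w : Fin 4 → R) : quadPolar t (v + w) = quadPolar t v + quadPolar t w := by
  funext i
  fin_cases i <;> simp [quadPolar] <;> ring

theorem sum_quad (t : Fin 4 → R) : ∑ i, quad t i = 0 := by
  simp [Fin.sum_univ_six, quad]
  ring

theorem sum_quad_cube (t : Fin 4 → R) : ∑ i, quad t i ^ 3 = 0 := by
  simp only [Fin.sum_univ_six, quad, Matrix.cons_val]
  ring

theorem sum_quadPolar (t v : Fin 4 → R) : ∑ i, quadPolar t v i = 0 := by
  simp [Fin.sum_univ_six, quadPolar]
  ring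

/-- The derivative of `sum_quad_cube` along `v`: the image of the differential lies in the tangent
hyperplane. -/
theorem sum_quad_sq_mul_quadPolar (t v : Fin 4 → R) :
    ∑ i, quad t i ^ 2 * quadPolar t v i = 0 := by
  simp only [Fin.sum_univ_six, quad, quadPolar, Matrix.cons_val]
  ring

end Ring

variable {Ω : Type*} [Field Ω]

/-- The five base points of `quad`. -/
def basePt (Ω : Type*) [Field Ω] : Fin 5 → Fin 4 → Ω :=
  ![![1, 0, 0, 0], ![0, 1, 0, 0], ![0, 0, 1, 0], ![0, 0, 0, 1], ![1, 1, 1, 1]]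

theorem quad_basePt (i : Fin 5) : quad (basePt Ω i) = 0 := by
  funext k
  fin_cases i <;> fin_cases k <;> simp [quad, basePt]

/-- The point `t` does not lie on a line through two of the five base points. -/
def OffLines (t : Fin 4 → Ω) : Prop := ∀ i j, t ∉ Submodule.span Ω {basePt Ω i, basePt Ω j}

theorem OffLines.not_zero_zero {t : Fin 4 → Ω} (h : OffLines t) :
    ¬ (t 0 = 0 ∧ t 1 = 0) ∧ ¬ (t 0 = 0 ∧ t 2 = 0) ∧ ¬ (t 0 = 0 ∧ t 3 = 0) ∧
    ¬ (t 1 = 0 ∧ t 2 = 0) ∧ ¬ (t 1 = 0 ∧ t 3 = 0) ∧ ¬ (t 2 = 0 ∧ t 3 = 0) := by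
  have key : ∀ i j : Fin 5, ∀ x y : Ω, t = x • basePt Ω i + y • basePt Ω j → False :=
    fun i j x y hxy => h i j (Submodule.mem_span_pair.mpr ⟨x, y, hxy.symm⟩)
  refine ⟨?_, ?_, ?_, ?_, ?_, ?_⟩ <;> rintro ⟨h1, h2⟩
  · exact key 2 3 (t 2) (t 3) (by funext k; fin_cases k <;> simp [basePt, h1, h2])
  · exact key 1 3 (t 1) (t 3) (by funext k; fin_cases k <;> simp [basePt, h1, h2])
  · exact key 1 2 (t 1) (t 2) (by funext k; fin_cases k <;> simp [basePt, h1, h2])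
  · exact key 0 3 (t 0) (t 3) (by funext k; fin_cases k <;> simp [basePt, h1, h2])
  · exact key 0 2 (t 0) (t 2) (by funext k; fin_cases k <;> simp [basePt, h1, h2])
  · exact key 0 1 (t 0) (t 1) (by funext k; fin_cases k <;> simp [basePt, h1, h2])

theorem OffLines.not_eq_eq {t : Fin 4 → Ω} (h : OffLines t) :
    ¬ (t 1 = t 3 ∧ t 2 = t 3) ∧ ¬ (t 0 = t 3 ∧ t 2 = t 3) ∧ ¬ (t 0 = t 3 ∧ t 1 = t 3) ∧
    ¬ (t 0 = t 1 ∧ t 1 = t 2) := by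
  have key : ∀ i j : Fin 5, ∀ x y : Ω, t = x • basePt Ω i + y • basePt Ω j → False :=
    fun i j x y hxy => h i j (Submodule.mem_span_pair.mpr ⟨x, y, hxy.symm⟩)
  refine ⟨?_, ?_, ?_, ?_⟩ <;> rintro ⟨h1, h2⟩
  · exact key 0 4 (t 0 - t 3) (t 3) (by funext k; fin_cases k <;> simp [basePt, h1, h2])
  · exact key 1 4 (t 1 - t 3) (t 3) (by funext k; fin_cases k <;> simp [basePt, h1, h2])
  · exact key 2 4 (t 2 - t 3) (t 3) (by funext k; fin_cases k <;> simp [basePt, h1, h2])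
  · exact key 3 4 (t 3 - t 2) (t 2) (by funext k; fin_cases k <;> simp [basePt, h1, h2])

theorem OffLines.ne_zero {t : Fin 4 → Ω} (h : OffLines t) : t ≠ 0 := by
  rintro rfl
  exact h 0 0 (Submodule.zero_mem _)

theorem coords_of_quadPolar_eq_zero [CharZero Ω] (t v : Fin 4 → Ω) (h : quadPolar t v = 0) :
    t 1 * (v 2 - v 3) + v 1 * (t 2 - t 3) = 0 ∧ t 2 * (v 0 - v 3) + v 2 * (t 0 - t 3) = 0 ∧
    t 0 * (v 1 - v 3) + v 0 * (t 1 - t 3) = 0 ∧ t 2 * (v 1 - v 3) + v 2 * (t 1 - t 3) = 0 ∧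
    t 0 * (v 2 - v 3) + v 0 * (t 2 - t 3) = 0 ∧ t 1 * (v 0 - v 3) + v 1 * (t 0 - t 3) = 0 := by
  have h0 := congrFun h 0
  have h1 := congrFun h 1
  have h2 := congrFun h 2
  have h3 := congrFun h 3
  have h4 := congrFun h 4
  have h5 := congrFun h 5
  simp only [quadPolar, Matrix.cons_val, Pi.zero_apply] at h0 h1 h2 h3 h4 h5
  refine ⟨?_, ?_, ?_, ?_, ?_, ?_⟩
  · linear_combination (h1 + h2) / 2
  · linear_combination (h0 + h2) / 2
  · linear_combination (h0 + h1) / 2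
  · linear_combination -(h4 + h5) / 2
  · linear_combination -(h3 + h5) / 2
  · linear_combination -(h3 + h4) / 2

/-- The brackets are the `2 × 2` minors of `(α, β, γ)` against `(t₀, t₁, t₂)`. They satisfy a linear
syzygy, and off the lines the factors in front cannot vanish together badly enough to leave one of
them nonzero. -/
theorem OffLines.exists_smul {t : Fin 4 → Ω} (ht : OffLines t) {α β γ : Ω}
    (g₁ : (t 2 - t 3) * (β * t 0 - α * t 1) = 0) (g₂ : (t 0 - t 3) * (γ * t 1 - β * t 2) = 0)
    (g₃ : (t 1 - t 3) * (α * t 2 - γ * t 0) = 0) :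
    ∃ μ, α = μ * t 0 ∧ β = μ * t 1 ∧ γ = μ * t 2 := by
  obtain ⟨z01, z02, z03, z12, z13, z23⟩ := ht.not_zero_zero
  obtain ⟨d12, d02, d01, -⟩ := ht.not_eq_eq
  have aux : ∀ a b c d X Y Z : Ω, ¬ (c = 0 ∧ d = 0) → ¬ (a = d ∧ c = d) → ¬ (b = d ∧ c = d) →
      (c - d) * X = 0 → (a - d) * Y = 0 → (b - d) * Z = 0 → c * X + a * Y + b * Z = 0 → X = 0 := by
    intro a b c d X Y Z hcd hac hbc hX hY hZ hrel
    by_contra h0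
    have hc := sub_eq_zero.mp ((mul_eq_zero.mp hX).resolve_right h0)
    have hY' := (mul_eq_zero.mp hY).resolve_left fun h => hac ⟨sub_eq_zero.mp h, hc⟩
    have hZ' := (mul_eq_zero.mp hZ).resolve_left fun h => hbc ⟨sub_eq_zero.mp h, hc⟩
    rw [hY', hZ', mul_zero, mul_zero, add_zero, add_zero] at hrel
    have hc0 := (mul_eq_zero.mp hrel).resolve_right h0
    exact hcd ⟨hc0, hc.symm.trans hc0⟩
  have h1 := aux _ _ _ _ _ _ _ z23 d02 d12 g₁ g₂ g₃ (by ring)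
  have h2 := aux _ _ _ _ _ _ _ z03 (fun h => d01 h.symm) (fun h => d02 h.symm) g₂ g₃ g₁ (by ring)
  have h3 := aux _ _ _ _ _ _ _ z13 (fun h => d12 h.symm) d01 g₃ g₁ g₂ (by ring)
  by_cases ha : t 0 = 0
  · have hb : t 1 ≠ 0 := fun h => z01 ⟨ha, h⟩
    refine ⟨β / t 1, mul_left_cancel₀ hb ?_, by field_simp, mul_left_cancel₀ hb ?_⟩
    · field_simp
      linear_combination -h1
    · field_simp
      linear_combination h2
  · refine ⟨α / t 0, by field_simp, mul_left_cancel₀ ha ?_, mul_left_cancel₀ ha ?_⟩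
    · field_simp
      linear_combination h1
    · field_simp
      linear_combination -h3

/-- The parametrization is an immersion off the ten lines joining base points, even on the affine
cones. The vanishing brackets first give `(v₀, v₁, v₂) = μ (t₀, t₁, t₂)`, and the rest forces `μ =
0`. -/
theorem OffLines.quadPolar_injective [CharZero Ω] {t v : Fin 4 → Ω} (ht : OffLines t)
    (h : quadPolar t v = 0) : v = 0 := by
  obtain ⟨e1, e2, e3, e4, e5, e6⟩ := coords_of_quadPolar_eq_zero t v h
  obtain ⟨μ, h0, h1, h2⟩ := ht.exists_smul (α := v 0) (β := v 1) (γ := v 2)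
    (by linear_combination t 0 * e1 - t 1 * e5) (by linear_combination t 1 * e2 - t 2 * e6)
    (by linear_combination t 2 * e3 - t 0 * e4)
  obtain ⟨z01, z02, -, z12, -, -⟩ := ht.not_zero_zero
  rw [h0] at e2 e3 e5 e6
  rw [h1] at e1 e3 e4 e6
  rw [h2] at e1 e2 e4 e5
  have aux : ∀ x y k : Ω, ¬ (x = 0 ∧ y = 0) → x * k = 0 → y * k = 0 → k = 0 := by
    intro x y k hxy hx hy
    by_contra hk
    exact hxy ⟨(mul_eq_zero.mp hx).resolve_right hk, (mul_eq_zero.mp hy).resolve_right hk⟩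
  have k0 := aux _ _ (2 * μ * t 0 - μ * t 3 - v 3) z12 (by linear_combination e6)
    (by linear_combination e2)
  have k1 := aux _ _ (2 * μ * t 1 - μ * t 3 - v 3) z02 (by linear_combination e3)
    (by linear_combination e4)
  have k2 := aux _ _ (2 * μ * t 2 - μ * t 3 - v 3) z01 (by linear_combination e5)
    (by linear_combination e1)
  have hμ : μ = 0 := by
    by_contra hμ0
    have h2μ : 2 * μ ≠ 0 := mul_ne_zero two_ne_zero hμ0
    exact ht.not_eq_eq.2.2.2 ⟨mul_left_cancel₀ h2μ (by linear_combination k0 - k1),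
      mul_left_cancel₀ h2μ (by linear_combination k1 - k2)⟩
  have h3 : v 3 = 0 := by rw [hμ] at k0; linear_combination -k0
  rw [hμ, zero_mul] at h0 h1 h2
  funext k
  fin_cases k
  exacts [h0, h1, h2, h3]

theorem OffLines.quad_ne_zero [CharZero Ω] {t : Fin 4 → Ω} (ht : OffLines t) : quad t ≠ 0 := by
  intro h
  refine ht.ne_zero (ht.quadPolar_injective (v := t) ?_)
  rw [quadPolar_self, h, smul_zero]

/-- Two points with the same image under the parametrization lie on a line through the fourth base
point. -/
theorem OffLines.mem_span_of_quad_eq [CharZero Ω] {t s : Fin 4 → Ω} (ht : OffLines t) {l : Ω}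
    (h : quad t = l • quad s) : s ∈ Submodule.span Ω {t, basePt Ω 3} := by
  have h0 := congrFun h 0
  have h1 := congrFun h 1
  have h2 := congrFun h 2
  have h3 := congrFun h 3
  have h4 := congrFun h 4
  have h5 := congrFun h 5
  simp only [quad, Matrix.cons_val, Pi.smul_apply, smul_eq_mul] at h0 h1 h2 h3 h4 h5
  have e1 : t 1 * (t 2 - t 3) = l * (s 1 * (s 2 - s 3)) := by linear_combination (h1 + h2) / 2
  have e2 : t 2 * (t 0 - t 3) = l * (s 2 * (s 0 - s 3)) := by linear_combination (h0 + h2) / 2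
  have e3 : t 0 * (t 1 - t 3) = l * (s 0 * (s 1 - s 3)) := by linear_combination (h0 + h1) / 2
  have e4 : t 2 * (t 1 - t 3) = l * (s 2 * (s 1 - s 3)) := by linear_combination -(h4 + h5) / 2
  have e5 : t 0 * (t 2 - t 3) = l * (s 0 * (s 2 - s 3)) := by linear_combination -(h3 + h5) / 2
  have e6 : t 1 * (t 0 - t 3) = l * (s 1 * (s 0 - s 3)) := by linear_combination -(h3 + h4) / 2
  obtain ⟨μ, m0, m1, m2⟩ := ht.exists_smul (α := s 0) (β := s 1) (γ := s 2)
    (by linear_combination s 1 * e5 - s 0 * e1) (by linear_combination s 2 * e6 - s 1 * e2)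
    (by linear_combination s 0 * e4 - s 2 * e3)
  refine Submodule.mem_span_pair.mpr ⟨μ, s 3 - μ * t 3, ?_⟩
  funext k
  fin_cases k <;> simp [basePt, m0, m1, m2]

theorem quad_of_coords [CharZero Ω] (x : Fin 6 → Ω) (t : Fin 4 → Ω) (l : Ω)
    (e1 : x 1 + x 2 = 2 * l * (t 1 * (t 2 - t 3))) (e2 : x 0 + x 2 = 2 * l * (t 2 * (t 0 - t 3)))
    (e3 : x 0 + x 1 = 2 * l * (t 0 * (t 1 - t 3)))
    (e4 : x 4 + x 5 = - (2 * l * (t 2 * (t 1 - t 3))))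
    (e5 : x 3 + x 5 = - (2 * l * (t 0 * (t 2 - t 3))))
    (e6 : x 3 + x 4 = - (2 * l * (t 1 * (t 0 - t 3)))) : x = l • quad t := by
  funext k
  fin_cases k <;> simp only [quad, Pi.smul_apply, smul_eq_mul, Fin.isValue, Fin.mk_one,
    Fin.reduceFinMk, Fin.zero_eta, Matrix.cons_val]
  · linear_combination (e2 + e3 - e1) / 2
  · linear_combination (e1 + e3 - e2) / 2
  · linear_combination (e1 + e2 - e3) / 2
  · linear_combination (e5 + e6 - e4) / 2
  · linear_combination (e4 + e6 - e5) / 2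
  · linear_combination (e4 + e5 - e6) / 2

theorem quadPolar_of_coords [CharZero Ω] (x : Fin 6 → Ω) (t v : Fin 4 → Ω)
    (e1 : x 1 + x 2 = 2 * (t 1 * (v 2 - v 3) + v 1 * (t 2 - t 3)))
    (e2 : x 0 + x 2 = 2 * (t 2 * (v 0 - v 3) + v 2 * (t 0 - t 3)))
    (e3 : x 0 + x 1 = 2 * (t 0 * (v 1 - v 3) + v 0 * (t 1 - t 3)))
    (e4 : x 4 + x 5 = - (2 * (t 2 * (v 1 - v 3) + v 2 * (t 1 - t 3))))
    (e5 : x 3 + x 5 = - (2 * (t 0 * (v 2 - v 3) + v 0 * (t 2 - t 3))))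
    (e6 : x 3 + x 4 = - (2 * (t 1 * (v 0 - v 3) + v 1 * (t 0 - t 3)))) : x = quadPolar t v := by
  funext k
  fin_cases k <;> simp only [quadPolar, Fin.isValue, Fin.mk_one,
    Fin.reduceFinMk, Fin.zero_eta, Matrix.cons_val]
  · linear_combination (e2 + e3 - e1) / 2
  · linear_combination (e1 + e3 - e2) / 2
  · linear_combination (e1 + e2 - e3) / 2
  · linear_combination (e5 + e6 - e4) / 2
  · linear_combination (e4 + e6 - e5) / 2
  · linear_combination (e4 + e5 - e6) / 2

/-- A point of the Segre cubic is in the image of the parametrization or in the image of the tangent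
space at one of the base points. -/
theorem exists_quad_or_quadPolar [CharZero Ω] (x : Fin 6 → Ω) (hx : ∑ i, x i = 0)
    (hx3 : ∑ i, x i ^ 3 = 0) :
    (∃ (t : Fin 4 → Ω) (l : Ω), l ≠ 0 ∧ x = l • quad t) ∨ ∃ i v, x = quadPolar (basePt Ω i) v := by
  rw [sum_cube_eq x hx] at hx3
  rw [Fin.sum_univ_six] at hx
  obtain ⟨Y1, hY1⟩ : ∃ y, x 1 + x 2 = 2 * y := ⟨(x 1 + x 2) / 2, by ring⟩
  obtain ⟨Y2, hY2⟩ : ∃ y, x 0 + x 2 = 2 * y := ⟨(x 0 + x 2) / 2, by ring⟩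
  obtain ⟨Y3, hY3⟩ : ∃ y, x 0 + x 1 = 2 * y := ⟨(x 0 + x 1) / 2, by ring⟩
  obtain ⟨Z1, hZ1⟩ : ∃ y, x 4 + x 5 = 2 * y := ⟨(x 4 + x 5) / 2, by ring⟩
  obtain ⟨Z2, hZ2⟩ : ∃ y, x 3 + x 5 = 2 * y := ⟨(x 3 + x 5) / 2, by ring⟩
  obtain ⟨Z3, hZ3⟩ : ∃ y, x 3 + x 4 = 2 * y := ⟨(x 3 + x 4) / 2, by ring⟩
  have hsum : Y1 + Y2 + Y3 + Z1 + Z2 + Z3 = 0 := by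
    linear_combination hx - (hY1 + hY2 + hY3 + hZ1 + hZ2 + hZ3) / 2
  have hprod : Y1 * Y2 * Y3 + Z1 * Z2 * Z3 = 0 := by
    rw [hY1, hY2, hY3, hZ1, hZ2, hZ3] at hx3
    linear_combination -hx3 / 24
  -- The matrix has determinant `Y₁Y₂Y₃ + Z₁Z₂Z₃`. A kernel vector supplies the first three
  -- parameters, inverting the parametrization; kernel vectors at the first three base points or
  -- along `(1, 1, 1)` lead to exceptional planes.
  obtain ⟨k, hk0, hk⟩ : ∃ k ≠ 0, (!![Y1, Z2, 0; 0, Y2, Z3; Z1, 0, Y3] : Matrix _ _ Ω).mulVec k = 0 := by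
    rw [Matrix.exists_mulVec_eq_zero_iff, Matrix.det_fin_three]
    simp
    linear_combination hprod
  have k1 := congrFun hk 0
  have k2 := congrFun hk 1
  have k3 := congrFun hk 2
  simp [Matrix.mulVec, dotProduct, Fin.sum_univ_three] at k1 k2 k3
  have hk0' : ¬ (k 0 = 0 ∧ k 1 = 0 ∧ k 2 = 0) := by
    rintro ⟨h0, h1, h2⟩
    apply hk0
    funext i
    fin_cases i <;> assumption
  generalize k 0 = a at *
  generalize k 1 = b at *
  generalize k 2 = c at *
  have pair : ∀ a b U V : Ω, ¬ (a = 0 ∧ b = 0) → U * a + V * b = 0 → ∃ α, U = α * b ∧ V = -(α * a) := by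
    intro a b U V hab h
    by_cases ha : a = 0
    · have hb : b ≠ 0 := fun h => hab ⟨ha, h⟩
      subst ha
      refine ⟨U / b, by field_simp, ?_⟩
      simpa [hb] using h
    · refine ⟨-V / a, ?_, by field_simp⟩
      field_simp
      linear_combination h
  by_cases hab : a = 0 ∧ b = 0
  · obtain ⟨rfl, rfl⟩ := hab
    have hc : c ≠ 0 := fun h => hk0' ⟨rfl, rfl, h⟩
    have hZ3' : Z3 = 0 := by simpa [hc] using k2
    have hY3' : Y3 = 0 := by simpa [hc] using k3
    subst hZ3' hY3'
    refine Or.inr ⟨2, ![-Z2, Y1, 0, -Y2 - Z2], ?_⟩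
    refine quadPolar_of_coords _ _ _ ?_ ?_ ?_ ?_ ?_ ?_ <;> simp [basePt]
    · linear_combination hY1
    · linear_combination hY2
    · linear_combination hY3
    · linear_combination hZ1 + 2 * hsum
    · linear_combination hZ2
    · linear_combination hZ3
  by_cases hbc : b = 0 ∧ c = 0
  · obtain ⟨rfl, rfl⟩ := hbc
    have ha : a ≠ 0 := fun h => hk0' ⟨h, rfl, rfl⟩
    have hY1' : Y1 = 0 := by simpa [ha] using k1
    have hZ1' : Z1 = 0 := by simpa [ha] using k3
    subst hY1' hZ1'
    refine Or.inr ⟨0, ![0, -Z3, Y2, -Y3 - Z3], ?_⟩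
    refine quadPolar_of_coords _ _ _ ?_ ?_ ?_ ?_ ?_ ?_ <;> simp [basePt]
    · linear_combination hY1
    · linear_combination hY2
    · linear_combination hY3
    · linear_combination hZ1
    · linear_combination hZ2 + 2 * hsum
    · linear_combination hZ3
  by_cases hca : c = 0 ∧ a = 0
  · obtain ⟨rfl, rfl⟩ := hca
    have hb : b ≠ 0 := fun h => hk0' ⟨rfl, h, rfl⟩
    have hY2' : Y2 = 0 := by simpa [hb] using k2
    have hZ2' : Z2 = 0 := by simpa [hb] using k1
    subst hY2' hZ2'
    refine Or.inr ⟨1, ![Y3, 0, -Z1, -Y1 - Z1], ?_⟩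
    refine quadPolar_of_coords _ _ _ ?_ ?_ ?_ ?_ ?_ ?_ <;> simp [basePt]
    · linear_combination hY1
    · linear_combination hY2
    · linear_combination hY3
    · linear_combination hZ1
    · linear_combination hZ2
    · linear_combination hZ3 + 2 * hsum
  obtain ⟨α, rfl, rfl⟩ := pair a b Y1 Z2 hab (by linear_combination k1)
  obtain ⟨β, rfl, rfl⟩ := pair b c Y2 Z3 hbc (by linear_combination k2)
  obtain ⟨γ, rfl, rfl⟩ := pair c a Y3 Z1 hca (by linear_combination k3)
  by_cases habc : a = b ∧ b = c
  · obtain ⟨rfl, rfl⟩ := habc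
    refine Or.inr ⟨4, ![β * a, γ * a, α * a, 0], ?_⟩
    refine quadPolar_of_coords _ _ _ ?_ ?_ ?_ ?_ ?_ ?_ <;> simp [basePt]
    · linear_combination hY1
    · linear_combination hY2
    · linear_combination hY3
    · linear_combination hZ1
    · linear_combination hZ2
    · linear_combination hZ3
  -- The condition that the six forms sum to zero says that `(α, β, γ)` is orthogonal to `(b - a, c
  -- - b, a - c)`, so it is spanned by `(c, a, b)` and `(1, 1, 1)`. The value `l = 0` is the
  -- exceptional plane of the base point with index `3`.
  obtain ⟨l, δ, rfl, rfl, rfl⟩ : ∃ l δ, α = l * c - δ ∧ β = l * a - δ ∧ γ = l * b - δ := by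
    by_cases h : a = b
    · subst h
      have hac : c - a ≠ 0 := fun h' => habc ⟨rfl, (sub_eq_zero.mp h').symm⟩
      have hβγ : β = γ := mul_left_cancel₀ hac (by linear_combination hsum)
      subst hβγ
      refine ⟨(α - β) / (c - a), (α - β) / (c - a) * a - β, ?_, by ring, by ring⟩
      field_simp
      ring
    · have hab' : a - b ≠ 0 := sub_ne_zero.mpr h
      refine ⟨(β - γ) / (a - b), (β - γ) / (a - b) * a - β, ?_, by ring, ?_⟩
      · field_simp
        linear_combination -hsum
      · field_simp
        ring
  by_cases hl : l = 0
  · subst hl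
    refine Or.inr ⟨3, ![δ * a, δ * b, δ * c, 0], ?_⟩
    refine quadPolar_of_coords _ _ _ ?_ ?_ ?_ ?_ ?_ ?_ <;> simp [basePt]
    · linear_combination hY1
    · linear_combination hY2
    · linear_combination hY3
    · linear_combination hZ1
    · linear_combination hZ2
    · linear_combination hZ3
  · have hd : l * (δ / l) = δ := by field_simp
    refine Or.inl ⟨![a, b, c, δ / l], l, hl, ?_⟩
    refine quad_of_coords _ _ _ ?_ ?_ ?_ ?_ ?_ ?_ <;> simp only [Matrix.cons_val]
    · linear_combination hY1 + 2 * b * hd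
    · linear_combination hY2 + 2 * c * hd
    · linear_combination hY3 + 2 * a * hd
    · linear_combination hZ1 - 2 * c * hd
    · linear_combination hZ2 - 2 * a * hd
    · linear_combination hZ3 - 2 * b * hd

/-- The image of the parametrization is dense in the Segre cubic. -/
theorem exists_add_smul_eq_quad [CharZero Ω] (x : Fin 6 → Ω) (hx : ∑ i, x i = 0)
    (hx3 : ∑ i, x i ^ 3 = 0) :
    ∃ y : Fin 6 → Ω, ∀ ε : Ω, ε ≠ 0 → ∃ (t : Fin 4 → Ω) (l : Ω), l ≠ 0 ∧ x + ε • y = l • quad t := by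
  rcases exists_quad_or_quadPolar x hx hx3 with ⟨t, l, hl, rfl⟩ | ⟨i, v, rfl⟩
  · exact ⟨0, fun ε _ => ⟨t, l, hl, by simp⟩⟩
  -- Approaching the base point along `v`, the image divided by `ε` is the tangent image plus `ε`
  -- times `quad v`.
  · refine ⟨quad v, fun ε hε => ⟨basePt Ω i + ε • v, ε⁻¹, inv_ne_zero hε, ?_⟩⟩
    rw [quad_add_smul, quad_basePt, zero_add, smul_add, smul_smul, smul_smul,
      inv_mul_cancel₀ hε, one_smul]
    congr 2
    field_simp

end Parametrization

end SegreCubic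

/-! ### Lifting an automorphism to forms on `ℙ³`. -/

namespace SegreCubic

section CoprimeTuples

variable {R : Type*} [CommRing R] [IsDomain R] [NormalizedGCDMonoid R] {ι : Type*} [Fintype ι]

/-- By proportionality `g i` divides `h i * g j` for every `j`, hence the gcd of these, which is
associated to `h i`. -/
theorem exists_mul_of_gcd_eq_one {g h : ι → R} (hg : Finset.univ.gcd g = 1)
    (H : ∀ i j, h i * g j = h j * g i) : ∃ c, ∀ i, h i = c * g i := by
  have hdvd : ∀ i, g i ∣ h i := by
    intro i
    have h1 : g i ∣ Finset.univ.gcd fun j => h i * g j :=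
      Finset.dvd_gcd fun j _ => by rw [H]; exact dvd_mul_left _ _
    have h2 := Finset.gcd_mul_left' Finset.univ g (h i)
    rw [hg, mul_one] at h2
    exact h1.trans h2.dvd
  obtain ⟨i₀, hi₀⟩ : ∃ i, g i ≠ 0 := by
    by_contra! h0
    have : Finset.univ.gcd g = 0 := Finset.gcd_eq_zero_iff.mpr fun i _ => h0 i
    rw [hg] at this
    exact one_ne_zero this
  obtain ⟨c, hc⟩ := hdvd i₀
  refine ⟨c, fun i => mul_right_cancel₀ hi₀ ?_⟩
  rw [H, hc]
  ring

end CoprimeTuples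

variable {Ω : Type*} [Field Ω]

theorem aeval_smul_of_isHomogeneous {A : Type*} [CommRing A] [Algebra Ω A] {σ : Type*}
    {p : MvPolynomial σ Ω} {d : ℕ} (hp : p.IsHomogeneous d) (a : A) (v : σ → A) :
    aeval (a • v) p = a ^ d * aeval v p := by
  rw [aeval_def, aeval_def, eval₂_eq, eval₂_eq, Finset.mul_sum]
  refine Finset.sum_congr rfl fun m hm => ?_
  rw [← hp (mem_support_iff.mp hm), Finsupp.weight_apply, Finsupp.sum]
  simp only [Pi.one_apply, smul_eq_mul, mul_one, Pi.smul_apply, mul_pow, Finset.prod_mul_distrib,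
    Finset.prod_pow_eq_pow_sum]
  ring

/-- The abstract properties of the relation `φ [w] = [z]` for an automorphism `φ` of the Segre
cubic. -/
structure IsAutRel (R : (Fin 6 → Ω) → (Fin 6 → Ω) → Prop) : Prop where
  right_ne : ∀ {w z}, R w z → z ≠ 0
  right_mem : ∀ {w z}, R w z → ∑ i, z i = 0 ∧ ∑ i, z i ^ 3 = 0
  left_unique : ∀ {w w' z}, R w z → R w' z → ∃ a : Ω, w' = a • w
  right_unique : ∀ {w z z'}, R w z → R w z' → ∃ a : Ω, z' = a • z
  smul_left : ∀ {w z} {a : Ω}, a ≠ 0 → R w z → R (a • w) z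
  smul_right : ∀ {w z} {a : Ω}, a ≠ 0 → R w z → R w (a • z)
  poly : ∀ w : Fin 6 → Ω, w ≠ 0 → ∑ i, w i = 0 → ∑ i, w i ^ 3 = 0 →
    ∃ f : Fin 6 → MvPolynomial (Fin 6) Ω, (fun i => aeval w (f i)) ≠ 0 ∧
      ∀ v, v ≠ 0 → ∑ i, v i = 0 → ∑ i, v i ^ 3 = 0 → (fun i => aeval v (f i)) ≠ 0 →
        R v fun i => aeval v (f i)
  poly_symm : ∀ z : Fin 6 → Ω, z ≠ 0 → ∑ i, z i = 0 → ∑ i, z i ^ 3 = 0 →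
    ∃ f : Fin 6 → MvPolynomial (Fin 6) Ω, (fun i => aeval z (f i)) ≠ 0 ∧
      ∀ v, v ≠ 0 → ∑ i, v i = 0 → ∑ i, v i ^ 3 = 0 → (fun i => aeval v (f i)) ≠ 0 →
        R (fun i => aeval v (f i)) v

section AutRel

variable {K : Type*} [Field K] [Algebra K Ω]

theorem exists_poly_of_isMorphism {φ : segre K Ω → segre K Ω} (hφ : IsMorphism Ω φ)
    (w : Fin 6 → Ω) (hw : w ≠ 0) (hm : Projectivization.mk Ω w hw ∈ segre K Ω) :
    ∃ f : Fin 6 → MvPolynomial (Fin 6) Ω, (fun i => aeval w (f i)) ≠ 0 ∧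
      ∀ (v : Fin 6 → Ω) (hv : v ≠ 0) (hm : Projectivization.mk Ω v hv ∈ segre K Ω)
        (h : (fun i => aeval v (f i)) ≠ 0),
        (φ ⟨_, hm⟩).1 = Projectivization.mk Ω (fun i => aeval v (f i)) h := by
  obtain ⟨d, f, hf, hfw, hfφ⟩ := hφ ⟨_, hm⟩
  have key : ∀ (v : Fin 6 → Ω) (hv : v ≠ 0), ∃ a : Ωˣ,
      (fun i => aeval (Projectivization.mk Ω v hv).rep (f i)) = a • fun i => aeval v (f i) := by
    intro v hv
    obtain ⟨a, ha⟩ := Projectivization.exists_smul_eq_mk_rep Ω v hv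
    refine ⟨a ^ d, ?_⟩
    funext i
    rw [← ha]
    exact aeval_smul_of_isHomogeneous (hf i) (a : Ω) v
  refine ⟨f, ?_, fun v hv hm h => ?_⟩
  · obtain ⟨a, ha⟩ := key w hw
    intro h0
    apply hfw
    change (fun i => aeval (Projectivization.mk Ω w hw).rep (f i)) = 0
    rw [ha, h0, smul_zero]
  · obtain ⟨a, ha⟩ := key v hv
    have hne : (fun i => aeval (Projectivization.mk Ω v hv).rep (f i)) ≠ 0 := by
      rw [ha]; exact (smul_ne_zero_iff_ne a).mpr h
    rw [hfφ ⟨_, hm⟩ hne, Projectivization.mk_eq_mk_iff]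
    exact ⟨a, ha.symm⟩

theorem isAutRel_of_mem_autGroup {φ : Equiv.Perm (segre K Ω)} (hφ : φ ∈ autGroup Ω (segre K Ω)) :
    IsAutRel fun w z => ∃ (hw : w ≠ 0) (hz : z ≠ 0) (hm : Projectivization.mk Ω w hw ∈ segre K Ω),
      (φ ⟨_, hm⟩).1 = Projectivization.mk Ω z hz where
  right_ne h := h.2.1
  right_mem := by
    rintro w z ⟨hw, hz, hm, h⟩
    rw [← mk_mem_segre (K := K) hz, ← h]
    exact (φ _).2
  left_unique := by
    rintro w w' z ⟨hw, hz, hm, h⟩ ⟨hw', hz', hm', h'⟩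
    have h1 := φ.injective (Subtype.ext (h'.trans h.symm))
    have h2 := congrArg Subtype.val h1
    obtain ⟨a, ha⟩ := (Projectivization.mk_eq_mk_iff' ..).mp h2
    exact ⟨a, ha.symm⟩
  right_unique := by
    rintro w z z' ⟨hw, hz, hm, h⟩ ⟨hw', hz', hm', h'⟩
    obtain ⟨a, ha⟩ := (Projectivization.mk_eq_mk_iff' ..).mp (h'.symm.trans h)
    exact ⟨a, ha.symm⟩
  smul_left := by
    rintro w z a ha ⟨hw, hz, hm, h⟩
    have he : Projectivization.mk Ω (a • w) (smul_ne_zero ha hw) = Projectivization.mk Ω w hw := by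
      rw [Projectivization.mk_eq_mk_iff']
      exact ⟨a, rfl⟩
    refine ⟨smul_ne_zero ha hw, hz, by rwa [he], ?_⟩
    rw [← h]
    congr 3
  smul_right := by
    rintro w z a ha ⟨hw, hz, hm, h⟩
    refine ⟨hw, smul_ne_zero ha hz, hm, ?_⟩
    rw [h, eq_comm, Projectivization.mk_eq_mk_iff']
    exact ⟨a, rfl⟩
  poly w hw h1 h3 := by
    obtain ⟨f, hf, hfφ⟩ := exists_poly_of_isMorphism hφ.1 w hw ((mk_mem_segre hw).mpr ⟨h1, h3⟩)
    exact ⟨f, hf, fun v hv hv1 hv3 h => ⟨hv, h, (mk_mem_segre hv).mpr ⟨hv1, hv3⟩, hfφ v hv _ h⟩⟩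
  poly_symm z hz h1 h3 := by
    obtain ⟨f, hf, hfφ⟩ := exists_poly_of_isMorphism hφ.2 z hz ((mk_mem_segre hz).mpr ⟨h1, h3⟩)
    refine ⟨f, hf, fun v hv hv1 hv3 h => ?_⟩
    have hm := (mk_mem_segre (K := K) hv).mpr ⟨hv1, hv3⟩
    have h2 := hfφ v hv hm h
    have hm' : Projectivization.mk Ω (fun i => aeval v (f i)) h ∈ segre K Ω := by
      rw [← h2]
      exact (φ.symm _).2
    have h3 : φ.symm ⟨Projectivization.mk Ω v hv, hm⟩ = ⟨_, hm'⟩ := Subtype.ext h2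
    exact ⟨h, hv, hm', by rw [← h3, Equiv.apply_symm_apply]⟩

end AutRel

/-- The members of `quad` as polynomials. -/
noncomputable def quadPoly (Ω : Type*) [Field Ω] (i : Fin 6) : MvPolynomial (Fin 4) Ω :=
  quad (fun j => X j) i

theorem aeval_quadPoly {A : Type*} [CommRing A] [Algebra Ω A] (t : Fin 4 → A) (i : Fin 6) :
    aeval t (quadPoly Ω i) = quad t i := by
  rw [quadPoly, map_quad]
  simp

theorem eval_quadPoly (t : Fin 4 → Ω) (i : Fin 6) : eval t (quadPoly Ω i) = quad t i := by
  rw [quadPoly, map_quad]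
  simp

theorem quad_apply_ne [CharZero Ω] : ∃ i, quadPoly Ω i ≠ 0 := by
  refine ⟨0, fun h => ?_⟩
  have := congrArg (eval (![0, 1, 0, 1] : Fin 4 → Ω)) h
  rw [eval_quadPoly, map_zero] at this
  simp [quad] at this

namespace IsAutRel

variable {R : (Fin 6 → Ω) → (Fin 6 → Ω) → Prop}

theorem mul_eq_mul (hR : IsAutRel R) {w z z' : Fin 6 → Ω} (h : R w z) (h' : R w z') (i j : Fin 6) :
    z i * z' j = z j * z' i := by
  obtain ⟨a, rfl⟩ := hR.right_unique h h'
  simp only [Pi.smul_apply, smul_eq_mul]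
  ring

theorem mul_eq_mul_left (hR : IsAutRel R) {w w' z : Fin 6 → Ω} (h : R w z) (h' : R w' z)
    (i j : Fin 6) : w i * w' j = w j * w' i := by
  obtain ⟨a, rfl⟩ := hR.left_unique h h'
  simp only [Pi.smul_apply, smul_eq_mul]
  ring

theorem exists_local (hR : IsAutRel R) {t : Fin 4 → Ω} (ht : quad t ≠ 0) :
    ∃ h : Fin 6 → MvPolynomial (Fin 4) Ω, (fun i => eval t (h i)) ≠ 0 ∧
      ∀ s, quad s ≠ 0 → (fun i => eval s (h i)) ≠ 0 → R (quad s) fun i => eval s (h i) := by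
  obtain ⟨f, hf, hfR⟩ := hR.poly (quad t) ht (sum_quad t) (sum_quad_cube t)
  have he : ∀ s, (fun i => eval s (bind₁ (quadPoly Ω) (f i))) = fun i => aeval (quad s) (f i) := by
    intro s
    funext i
    rw [← coe_aeval_eq_eval, RingHom.coe_coe, aeval_bind₁]
    simp [aeval_quadPoly]
  refine ⟨fun i => bind₁ (quadPoly Ω) (f i), by rwa [he], fun s hs h => ?_⟩
  rw [he] at h ⊢
  exact hfR _ hs (sum_quad s) (sum_quad_cube s) h

/-- Multiplying by a nonzero member of `quadPoly` makes the values on the base locus irrelevant. -/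
theorem eq_of_eval_quad [CharZero Ω] {p p' : MvPolynomial (Fin 4) Ω}
    (h : ∀ t, quad t ≠ 0 → eval t p = eval t p') : p = p' := by
  obtain ⟨i, hi⟩ := quad_apply_ne (Ω := Ω)
  refine mul_right_cancel₀ hi (funext fun t => ?_)
  by_cases ht : quad t = 0
  · rw [map_mul, map_mul, eval_quadPoly, ht, Pi.zero_apply, mul_zero, mul_zero]
  · rw [map_mul, map_mul, h t ht]

/-- An automorphism of the Segre cubic, pulled back to the parameter space, is given by
polynomials without common factor. -/
theorem exists_global [CharZero Ω] (hR : IsAutRel R) : ∃ g : Fin 6 → MvPolynomial (Fin 4) Ω,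
    (∀ h : Fin 6 → MvPolynomial (Fin 4) Ω, (∀ i j, h i * g j = h j * g i) →
      ∃ c, ∀ i, h i = c * g i) ∧
    ∀ t, quad t ≠ 0 → R (quad t) fun i => eval t (g i) := by
  obtain ⟨hgcd⟩ : Nonempty (NormalizedGCDMonoid (MvPolynomial (Fin 4) Ω)) := inferInstance
  have ht₀ : quad (![0, 1, 0, 1] : Fin 4 → Ω) ≠ 0 := by
    intro h
    have := congrFun h 0
    simp [quad] at this
  obtain ⟨h₀, hne₀, hR₀⟩ := hR.exists_local ht₀
  -- One local representation stripped of its common factor serves everywhere: any other local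
  -- representation is proportional to it, so it is a polynomial multiple of the coprime tuple, and
  -- the multiplier is nonzero where that representation is.
  obtain ⟨g, hg, hg1⟩ := Finset.extract_gcd h₀ (Finset.univ_nonempty (α := Fin 6))
  set D := Finset.univ.gcd h₀ with hD
  have hcop : ∀ h : Fin 6 → MvPolynomial (Fin 4) Ω, (∀ i j, h i * g j = h j * g i) →
      ∃ c, ∀ i, h i = c * g i := fun h H => exists_mul_of_gcd_eq_one hg1 H
  have hD0 : D ≠ 0 := by
    intro h0
    apply hne₀
    funext i
    rw [hg i (Finset.mem_univ i), h0, zero_mul, map_zero, Pi.zero_apply]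
  refine ⟨g, hcop, fun t ht => ?_⟩
  obtain ⟨h, hne, hRh⟩ := hR.exists_local ht
  obtain ⟨c, hc⟩ := hcop h (fun i j => by
    refine mul_left_cancel₀ hD0 ?_
    have : h i * h₀ j = h j * h₀ i := by
      refine eq_of_eval_quad fun s hs => ?_
      rw [map_mul, map_mul]
      by_cases e1 : (fun i => eval s (h i)) = 0
      · have e1i := congrFun e1 i
        have e1j := congrFun e1 j
        simp only [Pi.zero_apply] at e1i e1j
        rw [e1i, e1j, zero_mul, zero_mul]
      by_cases e2 : (fun i => eval s (h₀ i)) = 0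
      · have e2i := congrFun e2 i
        have e2j := congrFun e2 j
        simp only [Pi.zero_apply] at e2i e2j
        rw [e2i, e2j, mul_zero, mul_zero]
      exact hR.mul_eq_mul (hRh s hs e1) (hR₀ s hs e2) i j
    rw [hg i (Finset.mem_univ i), hg j (Finset.mem_univ j)] at this
    linear_combination this)
  have h1 := hRh t ht hne
  have hct : eval t c ≠ 0 := by
    intro h0
    apply hne
    funext i
    rw [hc, map_mul, h0, zero_mul, Pi.zero_apply]
  have h2 := hR.smul_right (inv_ne_zero hct) h1
  convert h2 using 1
  funext i
  rw [Pi.smul_apply, hc, map_mul, smul_eq_mul, inv_mul_cancel_left₀ hct]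

theorem coeff_bind₁_smul {n : ℕ} (a : Ω) (p : MvPolynomial (Fin n) Ω) (s : Fin n →₀ ℕ) :
    coeff s (bind₁ (fun i => C a * X i) p) = a ^ s.degree * coeff s p := by
  induction p using MvPolynomial.induction_on' with
  | monomial u b =>
    have : bind₁ (fun i : Fin n => C a * X i) (monomial u b) = monomial u (a ^ u.degree * b) := by
      rw [bind₁_monomial, monomial_eq, Finsupp.prod, Finsupp.degree_apply]
      simp only [mul_pow, Finset.prod_mul_distrib, map_mul, map_pow, Finset.prod_pow_eq_pow_sum]
      ring
    rw [this, coeff_monomial, coeff_monomial]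
    split_ifs with h
    · rw [h]
    · rw [mul_zero]
  | add p q hp hq => rw [map_add, coeff_add, coeff_add, hp, hq, mul_add]

/-- The map is unchanged by `t ↦ 2 t`, so the coprime tuple is multiplied by some `c`, a constant
for degree reasons. Each monomial of degree `d` then satisfies `2 ^ d = c`, so all have the same
degree. -/
theorem exists_isHomogeneous [CharZero Ω] (hR : IsAutRel R) :
    ∃ (m : ℕ) (g : Fin 6 → MvPolynomial (Fin 4) Ω), m ≠ 0 ∧ (∀ i, (g i).IsHomogeneous m) ∧
      ∀ t, quad t ≠ 0 → R (quad t) fun i => eval t (g i) := by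
  obtain ⟨g, hcop, hg⟩ := hR.exists_global
  have he : ∀ t i, eval t (bind₁ (fun i => C (2 : Ω) * X i) (g i)) = eval ((2 : Ω) • t) (g i) := by
    intro t i
    rw [← coe_aeval_eq_eval, RingHom.coe_coe, aeval_bind₁, ← coe_aeval_eq_eval, RingHom.coe_coe]
    congr 2
    funext j
    simp
  obtain ⟨c, hc⟩ := hcop (fun i => bind₁ (fun i => C (2 : Ω) * X i) (g i)) (fun i j => by
    refine eq_of_eval_quad fun t ht => ?_
    rw [map_mul, map_mul, he, he]
    have h2 : quad ((2 : Ω) • t) ≠ 0 := by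
      rw [quad_smul]
      exact smul_ne_zero (by norm_num) ht
    have h3 := hg _ h2
    rw [quad_smul] at h3
    have h4 := hR.smul_left (a := ((2 : Ω) ^ 2)⁻¹) (by norm_num) h3
    rw [inv_smul_smul₀ (by norm_num)] at h4
    exact hR.mul_eq_mul h4 (hg t ht) i j)
  have ht₀ : quad (![0, 1, 0, 1] : Fin 4 → Ω) ≠ 0 := by
    intro h
    have := congrFun h 0
    simp [quad] at this
  have ht₁ : quad (![1, 0, 0, 1] : Fin 4 → Ω) ≠ 0 := by
    intro h
    have := congrFun h 1
    simp [quad] at this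
  obtain ⟨i₀, hi₀⟩ : ∃ i, g i ≠ 0 := by
    by_contra! h0
    apply hR.right_ne (hg _ ht₀)
    funext i
    simp [h0]
  have hdeg : (bind₁ (fun i => C (2 : Ω) * X i) (g i₀)).totalDegree = (g i₀).totalDegree := by
    have : (bind₁ (fun i => C (2 : Ω) * X i) (g i₀)).support = (g i₀).support := by
      ext s
      simp [mem_support_iff, coeff_bind₁_smul]
    rw [totalDegree, totalDegree, this]
  have hc0 : c ≠ 0 := by
    rintro rfl
    have := hc i₀
    rw [zero_mul] at this
    obtain ⟨s, hs⟩ := ne_zero_iff.mp hi₀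
    have h1 := congrArg (coeff s) this
    rw [coeff_bind₁_smul, coeff_zero] at h1
    exact hs ((mul_eq_zero.mp h1).resolve_left (by simp))
  have hcC : c = C (coeff 0 c) := by
    rw [← totalDegree_eq_zero_iff_eq_C]
    have := hc i₀
    rw [this, totalDegree_mul_of_isDomain hc0 hi₀] at hdeg
    omega
  have hcoef : ∀ i s, coeff s (g i) ≠ 0 → (2 : Ω) ^ s.degree = coeff 0 c := by
    intro i s hs
    have h1 := congrArg (coeff s) (hc i)
    rw [coeff_bind₁_smul, hcC, coeff_C_mul] at h1
    simpa using mul_right_cancel₀ hs h1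
  obtain ⟨s₀, hs₀⟩ := ne_zero_iff.mp hi₀
  have hpow : ∀ i s, coeff s (g i) ≠ 0 → s.degree = s₀.degree := by
    intro i s hs
    have h1 := (hcoef i s hs).trans (hcoef i₀ s₀ hs₀).symm
    have h2 : (2 : ℕ) ^ s.degree = 2 ^ s₀.degree := by exact_mod_cast h1
    exact Nat.pow_right_injective le_rfl h2
  have hhom : ∀ i, (g i).IsHomogeneous s₀.degree := by
    intro i s hs
    rw [← hpow i s hs, Finsupp.degree_eq_weight_one]
    rfl
  refine ⟨s₀.degree, g, fun h0 => ?_, hhom, hg⟩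
  -- In degree zero the automorphism would send two different points to the same one.
  have hconst : ∀ t i, eval t (g i) = coeff 0 (g i) := by
    intro t i
    have h1 := hhom i
    rw [h0, ← totalDegree_zero_iff_isHomogeneous, totalDegree_eq_zero_iff_eq_C] at h1
    rw [h1]
    simp
  have h1 := hg _ ht₀
  have h2 := hg _ ht₁
  simp only [hconst] at h1 h2
  have h3 := hR.mul_eq_mul_left h1 h2 0 1
  simp [quad] at h3
  norm_num at h3

end IsAutRel

end SegreCubic

/-! ### Injectivity of the differential of a lift, by dual numbers. -/

namespace SegreCubic

variable {Ω : Type*} [Field Ω]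

/-- Taylor expansion to first order: evaluation at `t + ε v` with `ε² = 0`. -/
theorem aeval_inl_add_inr {n : ℕ} (t v : Fin n → Ω) (p : MvPolynomial (Fin n) Ω) :
    aeval (fun a => (TrivSqZeroExt.inl (t a) + TrivSqZeroExt.inr (v a) : DualNumber Ω)) p =
      TrivSqZeroExt.inl (eval t p) + TrivSqZeroExt.inr (∑ a, v a * eval t (pderiv a p)) := by
  induction p using MvPolynomial.induction_on with
  | C r => simp [DualNumber, TrivSqZeroExt.algebraMap_eq_inl]
  | add p q hp hq =>
    rw [map_add, hp, hq]
    ext <;> simp [mul_add, Finset.sum_add_distrib]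
  | mul_X p i hp =>
    rw [map_mul, hp, aeval_X]
    ext
    · simp
    · simp [pderiv_X, Pi.single_apply, mul_add, Finset.sum_add_distrib, apply_ite]
      rw [Finset.sum_mul, add_comm]
      exact congrArg _ (Finset.sum_congr rfl fun _ _ => by ring)

theorem quad_inl_add_inr (t v : Fin 4 → Ω) (j : Fin 6) :
    quad (fun a => (TrivSqZeroExt.inl (t a) + TrivSqZeroExt.inr (v a) : DualNumber Ω)) j =
      TrivSqZeroExt.inl (quad t j) + TrivSqZeroExt.inr (quadPolar t v j) := by
  ext
  · fin_cases j <;> simp [quad]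
  · fin_cases j <;> simp [quad, quadPolar]

theorem sum_mul_pderiv_quadPoly (t v : Fin 4 → Ω) (i : Fin 6) :
    ∑ a, v a * eval t (pderiv a (quadPoly Ω i)) = quadPolar t v i := by
  have h := congrArg TrivSqZeroExt.snd (aeval_inl_add_inr t v (quadPoly Ω i))
  rw [aeval_quadPoly, quad_inl_add_inr] at h
  simpa using h.symm

namespace IsAutRel

variable {R : (Fin 6 → Ω) → (Fin 6 → Ω) → Prop}

/-- If `g` is constant to first order along `v`, so is the inverse automorphism applied to it, which
is proportional to `quad`. Thus `quadPolar t v` is a multiple of `quad t`, and `v` is a multiple of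
`t` because `quad` is an immersion. Euler's identity with `m ≠ 0` and `g t ≠ 0` excludes a nonzero
multiple. -/
theorem deriv_injective [CharZero Ω] (hR : IsAutRel R) {m : ℕ} {g : Fin 6 → MvPolynomial (Fin 4) Ω}
    (hm : m ≠ 0) (hg : ∀ i, (g i).IsHomogeneous m)
    (hgR : ∀ t, quad t ≠ 0 → R (quad t) fun i => eval t (g i)) {t v : Fin 4 → Ω} (ht : OffLines t)
    (hv : ∀ i, ∑ a, v a * eval t (pderiv a (g i)) = 0) : v = 0 := by
  have hqt := ht.quad_ne_zero
  have hRt := hgR t hqt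
  obtain ⟨f, hf, hfR⟩ := hR.poly_symm _ (hR.right_ne hRt) (hR.right_mem hRt).1 (hR.right_mem hRt).2
  have hev : ∀ s i, eval s (bind₁ g (f i)) = aeval (fun i => eval s (g i)) (f i) := by
    intro s i
    rw [← coe_aeval_eq_eval, RingHom.coe_coe, aeval_bind₁]
  have key : ∀ i j, bind₁ g (f i) * quadPoly Ω j = bind₁ g (f j) * quadPoly Ω i := by
    intro i j
    refine eq_of_eval_quad fun s hs => ?_
    rw [map_mul, map_mul, hev, hev, eval_quadPoly, eval_quadPoly]
    have hRs := hgR s hs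
    by_cases h0 : (fun i => aeval (fun i => eval s (g i)) (f i)) = 0
    · have hi := congrFun h0 i
      have hj := congrFun h0 j
      simp only [Pi.zero_apply] at hi hj
      rw [hi, hj, zero_mul, zero_mul]
    · exact hR.mul_eq_mul_left (hfR _ (hR.right_ne hRs) (hR.right_mem hRs).1 (hR.right_mem hRs).2 h0)
        hRs i j
  obtain ⟨i₀, hi₀⟩ := Function.ne_iff.mp hf
  rw [Pi.zero_apply] at hi₀
  set y : Fin 6 → Ω := fun i => aeval (fun i => eval t (g i)) (f i) with hy
  have hg' : (fun i => aeval (fun a => (TrivSqZeroExt.inl (t a) + TrivSqZeroExt.inr (v a) :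
      DualNumber Ω)) (g i)) = fun i => algebraMap Ω (DualNumber Ω) (eval t (g i)) := by
    funext i
    rw [aeval_inl_add_inr, hv, TrivSqZeroExt.inr_zero, add_zero]
    rfl
  have e : ∀ i j, y i * quad t j = y j * quad t i ∧ y i * quadPolar t v j = y j * quadPolar t v i := by
    intro i j
    have h := congrArg (aeval (fun a => (TrivSqZeroExt.inl (t a) + TrivSqZeroExt.inr (v a) :
      DualNumber Ω))) (key i j)
    have hF : ∀ i, aeval (fun a => (TrivSqZeroExt.inl (t a) + TrivSqZeroExt.inr (v a) :
        DualNumber Ω)) (bind₁ g (f i)) = TrivSqZeroExt.inl (y i) := by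
      intro i
      rw [aeval_bind₁, hg']
      exact aeval_algebraMap_apply (DualNumber Ω) (fun i => eval t (g i)) (f i)
    rw [map_mul, map_mul, hF, hF, aeval_quadPoly, aeval_quadPoly, quad_inl_add_inr,
      quad_inl_add_inr] at h
    have h1 := congrArg TrivSqZeroExt.fst h
    have h2 := congrArg TrivSqZeroExt.snd h
    simp at h1 h2
    exact ⟨h1, h2⟩
  have hq0 : quad t i₀ ≠ 0 := by
    intro h0
    apply hqt
    funext j
    have := (e i₀ j).1
    rw [h0, mul_zero] at this
    exact (mul_eq_zero.mp this).resolve_left hi₀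
  obtain ⟨μ, hμ⟩ : ∃ μ : Ω, quadPolar t v = (2 * μ) • quad t := by
    refine ⟨quadPolar t v i₀ / quad t i₀ / 2, ?_⟩
    funext j
    simp only [Pi.smul_apply, smul_eq_mul]
    rw [mul_div_cancel₀ _ two_ne_zero, div_mul_eq_mul_div, eq_div_iff hq0]
    refine mul_left_cancel₀ hi₀ ?_
    change y i₀ * _ = y i₀ * _
    linear_combination quad t i₀ * (e i₀ j).2 - quadPolar t v i₀ * (e i₀ j).1
  have hvt : v = μ • t := by
    have := ht.quadPolar_injective (v := v + (-μ) • t) (by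
      rw [quadPolar_add, quadPolar_smul, quadPolar_self, hμ, smul_smul]
      rw [← add_smul]
      simp [mul_comm])
    rw [neg_smul, ← sub_eq_add_neg] at this
    exact sub_eq_zero.mp this
  obtain ⟨i, hi⟩ := Function.ne_iff.mp (hR.right_ne hRt)
  have h1 : ∑ a, t a * eval t (pderiv a (g i)) = m * eval t (g i) := aeval_euler (hg i) t
  have h2 := hv i
  subst hvt
  simp only [Pi.smul_apply, smul_eq_mul, mul_assoc, ← Finset.mul_sum] at h2
  rw [h1, mul_eq_zero, mul_eq_zero, Nat.cast_eq_zero] at h2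
  rw [(h2.resolve_right (not_or.mpr ⟨hm, hi⟩)), zero_smul]

end IsAutRel

end SegreCubic

/-! ### General pencils and maximal minors. -/

namespace SegreCubic

section Pencils

variable {Ω : Type*} [Field Ω]

/-- Finitely many subspaces of dimension at most `2` are avoided by a two-dimensional subspace of
`Ω⁴`. -/
theorem exists_pencil [Infinite Ω] {κ : Type*} [Finite κ] (B : κ → Submodule Ω (Fin 4 → Ω))
    (hB : ∀ k, Module.finrank Ω (B k) ≤ 2) :
    ∃ P Q : Fin 4 → Ω, ∀ a b : Ω, (a ≠ 0 ∨ b ≠ 0) → ∀ k, a • P + b • Q ∉ B k := by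
  have avoid : ∀ D : κ → Submodule Ω (Fin 4 → Ω), (∀ k, Module.finrank Ω (D k) < 4) →
      ∃ x, ∀ k, x ∉ D k := by
    intro D hD
    by_contra! h
    obtain ⟨k, hk⟩ := Subspace.exists_eq_top_of_iUnion_eq_univ (p := D)
      (Set.eq_univ_of_forall fun x => Set.mem_iUnion.mpr (h x))
    have := hD k
    rw [hk, finrank_top, Module.finrank_fin_fun] at this
    exact lt_irrefl _ this
  -- `P` avoids every `B k`, and `Q` avoids every `B k + Ω P`, which has dimension at most three; a
  -- finite union of proper subspaces over an infinite field is not everything.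
  obtain ⟨P, hP⟩ := avoid B fun k => (hB k).trans_lt (by norm_num)
  obtain ⟨Q, hQ⟩ := avoid (fun k => B k ⊔ Submodule.span Ω {P}) fun k => by
    have h1 := Submodule.finrank_add_le_finrank_add_finrank (B k) (Submodule.span Ω {P})
    have h2 : Module.finrank Ω (Submodule.span Ω {P}) ≤ 1 :=
      (finrank_span_le_card (R := Ω) {P}).trans (by simp)
    have h3 := hB k
    omega
  refine ⟨P, Q, fun a b hab k hk => ?_⟩
  by_cases hb : b = 0
  · subst hb
    have ha := hab.resolve_right (not_not.mpr rfl)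
    rw [zero_smul, add_zero] at hk
    exact hP k ((Submodule.smul_mem_iff _ ha).mp hk)
  · refine hQ k ((Submodule.smul_mem_iff _ hb).mp ?_)
    have h1 : a • P ∈ B k ⊔ Submodule.span Ω {P} :=
      Submodule.mem_sup_right (Submodule.smul_mem _ _ (Submodule.mem_span_singleton_self P))
    have h2 := Submodule.sub_mem _ (Submodule.mem_sup_left hk) h1
    rwa [add_sub_cancel_left] at h2

end Pencils

section Minors

variable {R : Type*} [CommRing R]

/-- The maximal minors of a `4 × 5` matrix, with signs. -/
def minor (D : Fin 4 → Fin 5 → R) (j : Fin 5) : R :=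
  (Matrix.of (Fin.snoc D (Pi.single j 1) : Fin 5 → Fin 5 → R)).det

/-- Cramer's rule: the matrix bordered by the row `eⱼ` sends `N` to `N j` times the last basis
vector, and applying the adjugate gives the proportionality. -/
theorem minor_mul_eq_mul {D : Fin 4 → Fin 5 → R} {N : Fin 5 → R} (h : ∀ a, ∑ i, D a i * N i = 0)
    (i j : Fin 5) : minor D i * N j = minor D j * N i := by
  set B : Matrix (Fin 5) (Fin 5) R := Matrix.of (Fin.snoc D (Pi.single j 1)) with hB
  have h1 : B.mulVec N = Pi.single (Fin.last 4) (N j) := by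
    funext k
    induction k using Fin.lastCases with
    | last =>
      simp only [B, Matrix.mulVec, dotProduct, Matrix.of_apply, Fin.snoc_last, Pi.single_eq_same]
      simp [Pi.single_apply]
    | cast a =>
      simp only [B, Matrix.mulVec, dotProduct, Matrix.of_apply, Fin.snoc_castSucc]
      rw [h a, Pi.single_eq_of_ne (Fin.castSucc_lt_last a).ne]
  have h2 := congrArg B.adjugate.mulVec h1
  rw [Matrix.mulVec_mulVec, Matrix.adjugate_mul, Matrix.smul_mulVec, Matrix.one_mulVec] at h2
  have h3 := congrFun h2 i
  rw [Matrix.mulVec_single, Pi.smul_apply, Pi.smul_apply, Matrix.col_apply, Matrix.adjugate_apply] at h3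
  have h4 : B.updateRow (Fin.last 4) (Pi.single i 1) = Matrix.of (Fin.snoc D (Pi.single i 1)) := by
    funext k l
    induction k using Fin.lastCases with
    | last => simp only [Matrix.updateRow_self, Matrix.of_apply, Fin.snoc_last]
    | cast a =>
      rw [Matrix.updateRow_ne (Fin.castSucc_lt_last a).ne]
      simp only [B, Matrix.of_apply, Fin.snoc_castSucc]
  rw [h4] at h3
  simpa [minor, mul_comm] using h3.symm

theorem map_minor {S : Type*} [CommRing S] (f : R →+* S) (D : Fin 4 → Fin 5 → R) (j : Fin 5) :
    f (minor D j) = minor (fun a i => f (D a i)) j := by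
  rw [minor, minor, RingHom.map_det]
  congr 1
  funext k l
  induction k using Fin.lastCases with
  | last =>
    simp only [RingHom.mapMatrix_apply, Matrix.map_apply, Matrix.of_apply, Fin.snoc_last,
      Pi.single_apply, apply_ite f, map_one, map_zero]
  | cast a => simp

theorem minor_smul (c : R) (D : Fin 4 → Fin 5 → R) (j : Fin 5) :
    minor (fun a i => c * D a i) j = c ^ 4 * minor D j := by
  have h := Matrix.det_mul_column (Fin.snoc (fun _ => c) 1 : Fin 5 → R)
    (Matrix.of (Fin.snoc D (Pi.single j 1) : Fin 5 → Fin 5 → R))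
  rw [Fin.prod_univ_castSucc] at h
  simp only [Fin.snoc_castSucc, Fin.snoc_last, mul_one, Finset.prod_const, Finset.card_univ,
    Fintype.card_fin] at h
  rw [minor, minor, ← h]
  congr 1
  funext k l
  induction k using Fin.lastCases with
  | last => simp only [Matrix.of_apply, Fin.snoc_last, one_mul]
  | cast a => simp only [Matrix.of_apply, Fin.snoc_castSucc]

/-- Four independent rows of length five can be completed to a basis by some standard vector. -/
theorem exists_minor_ne_zero {Ω : Type*} [Field Ω] {D : Fin 4 → Fin 5 → Ω}
    (hD : LinearIndependent Ω D) : ∃ j, minor D j ≠ 0 := by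
  obtain ⟨j, hj⟩ : ∃ j, (Pi.single j 1 : Fin 5 → Ω) ∉ Submodule.span Ω (Set.range D) := by
    by_contra! h
    have htop : Submodule.span Ω (Set.range D) = ⊤ := by
      rw [eq_top_iff, ← (Pi.basisFun Ω (Fin 5)).span_eq, Submodule.span_le]
      rintro _ ⟨j, rfl⟩
      simpa using h j
    have h1 := finrank_range_le_card (R := Ω) D
    rw [Set.finrank, htop, finrank_top, Module.finrank_fin_fun, Fintype.card_fin] at h1
    omega
  refine ⟨j, ?_⟩
  have h1 := linearIndependent_finSnoc.mpr ⟨hD, hj⟩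
  have h2 := (Matrix.linearIndependent_rows_iff_isUnit
    (A := Matrix.of (Fin.snoc D (Pi.single j 1) : Fin 5 → Fin 5 → Ω))).mp h1
  exact ((Matrix.isUnit_iff_isUnit_det _).mp h2).ne_zero

end Minors

end SegreCubic

/-! ### The degree of a lift, by comparison with the Gauss map. -/

namespace SegreCubic

variable {Ω : Type*} [Field Ω]

theorem finrank_span_pair_le (x y : Fin 4 → Ω) : Module.finrank Ω (Submodule.span Ω {x, y}) ≤ 2 := by
  classical
  refine (finrank_span_le_card (R := Ω) {x, y}).trans ?_
  rw [Set.toFinset_insert, Set.toFinset_singleton]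
  exact Finset.card_le_two

/-- The polynomials `g`, of degree `m`, describe the relation `R` on the parameter space. -/
structure IsAutLift (R : (Fin 6 → Ω) → (Fin 6 → Ω) → Prop) (m : ℕ)
    (g : Fin 6 → MvPolynomial (Fin 4) Ω) : Prop where
  isAutRel : IsAutRel R
  ne_zero : m ≠ 0
  isHomogeneous : ∀ i, (g i).IsHomogeneous m
  rel : ∀ t, quad t ≠ 0 → R (quad t) fun i => eval t (g i)

theorem isAutLift_quadPoly [CharZero Ω] :
    IsAutLift (fun w z : Fin 6 → Ω => ∃ (hw : w ≠ 0) (hz : z ≠ 0)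
      (hm : Projectivization.mk Ω w hw ∈ segre Ω Ω),
      ((1 : Equiv.Perm (segre Ω Ω)) ⟨_, hm⟩).1 = Projectivization.mk Ω z hz) 2 (quadPoly Ω) where
  isAutRel := isAutRel_of_mem_autGroup (one_mem _)
  ne_zero := two_ne_zero
  isHomogeneous i := by
    have h : ∀ a b c : Fin 4, (X a * (X b - X c) : MvPolynomial (Fin 4) Ω).IsHomogeneous 2 :=
      fun a b c => (isHomogeneous_X Ω a).mul ((isHomogeneous_X Ω b).sub (isHomogeneous_X Ω c))
    fin_cases i
    · exact (((h 1 2 3).neg).add (h 2 0 3)).add (h 0 1 3)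
    · exact ((h 1 2 3).sub (h 2 0 3)).add (h 0 1 3)
    · exact ((h 1 2 3).add (h 2 0 3)).sub (h 0 1 3)
    · exact ((h 2 1 3).sub (h 0 2 3)).sub (h 1 0 3)
    · exact ((h 2 1 3).neg.add (h 0 2 3)).sub (h 1 0 3)
    · exact ((h 2 1 3).neg.sub (h 0 2 3)).add (h 1 0 3)
  rel t ht := by
    have h : (fun i => eval t (quadPoly Ω i)) = quad t := funext (eval_quadPoly t)
    rw [h]
    exact ⟨ht, ht, (mk_mem_segre ht).mpr ⟨sum_quad t, sum_quad_cube t⟩, rfl⟩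

/-- The derivative of the lift, as a matrix of polynomials. -/
noncomputable def jac (g : Fin 6 → MvPolynomial (Fin 4) Ω) (a : Fin 4) (i : Fin 5) :
    MvPolynomial (Fin 4) Ω := pderiv a (g i.castSucc)

/-- The Gauss map of the Segre cubic, composed with the lift. -/
noncomputable def normal (g : Fin 6 → MvPolynomial (Fin 4) Ω) (i : Fin 5) :
    MvPolynomial (Fin 4) Ω := g i.castSucc ^ 2 - g (Fin.last 5) ^ 2

namespace IsAutLift

variable {R : (Fin 6 → Ω) → (Fin 6 → Ω) → Prop} {m : ℕ} {g : Fin 6 → MvPolynomial (Fin 4) Ω}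

/-- The normal vector vanishes only where all squared coordinates agree, that is, at multiples of
sign vectors. The preimage of each of these finitely many points off the lines lies on a line
through the base point with index `3`, by `OffLines.mem_span_of_quad_eq`. -/
theorem exists_bad [CharZero Ω] (hg : IsAutLift R m g) :
    ∃ (κ : Type) (_ : Finite κ) (B : κ → Submodule Ω (Fin 4 → Ω)),
      (∀ k, Module.finrank Ω (B k) ≤ 2) ∧ ∀ t, (∀ k, t ∉ B k) →
        OffLines t ∧ ∃ i, eval t (g i) ^ 2 ≠ eval t (g (Fin.last 5)) ^ 2 := by
  classical
  let sgn : (Fin 6 → Bool) → Fin 6 → Ω := fun e i => if e i then 1 else -1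
  -- One chosen preimage for each sign vector; the default `0` is never met when a preimage exists.
  let p : (Fin 6 → Bool) → Fin 4 → Ω := fun e =>
    if h : ∃ t, OffLines t ∧ R (quad t) (sgn e) then h.choose else 0
  refine ⟨(Fin 5 × Fin 5) ⊕ (Fin 6 → Bool), inferInstance,
    Sum.elim (fun ij => Submodule.span Ω {basePt Ω ij.1, basePt Ω ij.2})
      (fun e => Submodule.span Ω {p e, basePt Ω 3}), ?_, ?_⟩
  · rintro (ij | e) <;> exact finrank_span_pair_le _ _
  intro t ht
  have hoff : OffLines t := fun i j => ht (Sum.inl (i, j))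
  refine ⟨hoff, ?_⟩
  by_contra! hall
  have hR := hg.rel t hoff.quad_ne_zero
  set l := eval t (g (Fin.last 5)) with hl
  have hl0 : l ≠ 0 := by
    intro h0
    apply hg.isAutRel.right_ne hR
    funext i
    have := hall i
    rw [h0, zero_pow two_ne_zero] at this
    exact pow_eq_zero_iff two_ne_zero |>.mp this
  let e : Fin 6 → Bool := fun i => eval t (g i) = l
  have he : (fun i => eval t (g i)) = l • sgn e := by
    funext i
    rcases sq_eq_sq_iff_eq_or_eq_neg.mp (hall i) with h | h
    · simp [sgn, e, h]
    · simp only [sgn, e, Pi.smul_apply, smul_eq_mul]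
      split_ifs with h1
      · simpa using h1
      · simpa using h
  rw [he] at hR
  have hRe : R (quad t) (sgn e) := by
    simpa [smul_smul, hl0] using hg.isAutRel.smul_right (inv_ne_zero hl0) hR
  have hex : ∃ t, OffLines t ∧ R (quad t) (sgn e) := ⟨t, hoff, hRe⟩
  have hp : p e = hex.choose := dif_pos hex
  have hps := hex.choose_spec
  rw [← hp] at hps
  obtain ⟨a, ha⟩ := hg.isAutRel.left_unique hRe hps.2
  exact ht (Sum.inr e) (hps.1.mem_span_of_quad_eq ha)

theorem sum_eq_zero [CharZero Ω] (hg : IsAutLift R m g) : ∑ i, g i = 0 := by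
  refine IsAutRel.eq_of_eval_quad fun t ht => ?_
  simpa using (hg.isAutRel.right_mem (hg.rel t ht)).1

theorem sum_cube_eq_zero [CharZero Ω] (hg : IsAutLift R m g) : ∑ i, g i ^ 3 = 0 := by
  refine IsAutRel.eq_of_eval_quad fun t ht => ?_
  simpa using (hg.isAutRel.right_mem (hg.rel t ht)).2

theorem sum_pderiv_eq_zero [CharZero Ω] (hg : IsAutLift R m g) (a : Fin 4) :
    ∑ i, pderiv a (g i) = 0 := by
  rw [← map_sum, hg.sum_eq_zero, map_zero]

/-- Differentiating `∑ gᵢ³ = 0` and eliminating the last derivative by `∑ gᵢ = 0` shows that the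
normal vector kills the rows of the Jacobian. -/
theorem sum_pderiv_mul_eq_zero [CharZero Ω] (hg : IsAutLift R m g) (a : Fin 4) :
    ∑ i : Fin 5, pderiv a (g i.castSucc) * (g i.castSucc ^ 2 - g (Fin.last 5) ^ 2) = 0 := by
  have h1 := congrArg (pderiv a) hg.sum_cube_eq_zero
  have h2 := hg.sum_pderiv_eq_zero a
  rw [map_sum, map_zero] at h1
  simp only [Derivation.leibniz_pow, Nat.add_one_sub_one, smul_eq_mul, nsmul_eq_mul,
    ← Finset.mul_sum] at h1
  have h1 := (mul_eq_zero.mp h1).resolve_left (by norm_num)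
  rw [Fin.sum_univ_castSucc] at h1 h2
  simp only [mul_sub, Finset.sum_sub_distrib, ← Finset.sum_mul]
  rw [eq_neg_of_add_eq_zero_left h2]
  simp only [mul_comm (pderiv a (g _))]
  linear_combination h1

theorem exists_minor_ne_zero [CharZero Ω] (hg : IsAutLift R m g) {t : Fin 4 → Ω} (ht : OffLines t) :
    ∃ j, minor (fun a i => eval t (jac g a i)) j ≠ 0 := by
  apply SegreCubic.exists_minor_ne_zero
  rw [Fintype.linearIndependent_iff]
  intro v hv
  have hv5 : ∀ i : Fin 5, ∑ a, v a * eval t (pderiv a (g i.castSucc)) = 0 := by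
    intro i
    simpa [jac] using congrFun hv i
  refine congrFun (hg.isAutRel.deriv_injective hg.ne_zero hg.isHomogeneous hg.rel ht (v := v) ?_)
  intro i
  induction i using Fin.lastCases with
  | cast i => exact hv5 i
  | last =>
    have h : ∑ i, ∑ a, v a * eval t (pderiv a (g i)) = 0 := by
      rw [Finset.sum_comm]
      refine Finset.sum_eq_zero fun a _ => ?_
      rw [← Finset.mul_sum, ← map_sum, hg.sum_pderiv_eq_zero a, map_zero, mul_zero]
    rw [Fin.sum_univ_castSucc, Finset.sum_eq_zero fun i _ => hv5 i, zero_add] at h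
    exact h

/-- Along the pencil the tuples of minors and of normal coordinates are proportional polynomials in
`z` without common zeros. Over an algebraically closed field both are therefore unimodular, and the
factor is a nonzero constant. -/
theorem exists_minor_eq [CharZero Ω] [IsAlgClosed Ω] (hg : IsAutLift R m g) {P Q : Fin 4 → Ω}
    (hoff : ∀ z : Ω, OffLines (P + z • Q)) (hN : ∀ z : Ω, ∃ i, eval (P + z • Q) (normal g i) ≠ 0) :
    ∃ c : Ω, c ≠ 0 ∧ ∀ (z : Ω) j, minor (fun a i => eval (P + z • Q) (jac g a i)) j =
      c * eval (P + z • Q) (normal g j) := by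
  obtain ⟨hgcd⟩ : Nonempty (NormalizedGCDMonoid (Polynomial Ω)) := inferInstance
  let ev : MvPolynomial (Fin 4) Ω →ₐ[Ω] Polynomial Ω :=
    aeval fun a => Polynomial.C (P a) + Polynomial.X * Polynomial.C (Q a)
  have hev : ∀ (z : Ω) p, (ev p).eval z = eval (P + z • Q) p := by
    intro z p
    have : ((Polynomial.aeval z).comp ev) = aeval (P + z • Q) := by
      apply MvPolynomial.algHom_ext
      intro a
      simpa [ev] using mul_comm _ _
    exact DFunLike.congr_fun this p
  have hevm : ∀ (z : Ω) j, (minor (fun a i => ev (jac g a i)) j).eval z =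
      minor (fun a i => eval (P + z • Q) (jac g a i)) j := by
    intro z j
    rw [← Polynomial.coe_evalRingHom, map_minor]
    simp only [Polynomial.coe_evalRingHom, hev]
  have hmn : ∀ i j, minor (fun a i => ev (jac g a i)) i * ev (normal g j) =
      minor (fun a i => ev (jac g a i)) j * ev (normal g i) := by
    intro i j
    refine minor_mul_eq_mul (N := fun i => ev (normal g i)) (fun a => ?_) i j
    simp only [← map_mul, ← map_sum]
    rw [show ∑ i, jac g a i * normal g i = 0 from hg.sum_pderiv_mul_eq_zero a, map_zero]
  have noroot : ∀ p : Polynomial Ω, (∀ z, p.eval z ≠ 0) → ∃ c, c ≠ 0 ∧ p = Polynomial.C c := by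
    intro p hp
    have hdeg : p.degree = 0 := by
      by_contra h
      obtain ⟨z, hz⟩ := IsAlgClosed.exists_root p h
      exact hp z hz
    have h1 := Polynomial.eq_C_of_degree_eq_zero hdeg
    refine ⟨_, fun h0 => ?_, h1⟩
    rw [h0, map_zero] at h1
    exact hp 0 (by rw [h1, Polynomial.eval_zero])
  obtain ⟨n, hn, hn1⟩ := Finset.extract_gcd (fun i => ev (normal g i))
    (Finset.univ_nonempty (α := Fin 5))
  generalize Finset.univ.gcd (fun i => ev (normal g i)) = d at hn
  obtain ⟨d, hd0, rfl⟩ := noroot d fun z hz => by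
    obtain ⟨i, hi⟩ := hN z
    rw [← hev, hn i (Finset.mem_univ i), Polynomial.eval_mul, hz, zero_mul] at hi
    exact hi rfl
  obtain ⟨c, hc⟩ := exists_mul_of_gcd_eq_one (h := minor fun a i => ev (jac g a i)) hn1
    fun i j => by
      have := hmn i j
      rw [hn i (Finset.mem_univ i), hn j (Finset.mem_univ j)] at this
      refine mul_left_cancel₀ (Polynomial.C_ne_zero.mpr hd0) ?_
      linear_combination this
  obtain ⟨c, hc0, rfl⟩ := noroot c fun z hz => by
    obtain ⟨j, hj⟩ := hg.exists_minor_ne_zero (hoff z)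
    rw [← hevm, hc, Polynomial.eval_mul, hz, zero_mul] at hj
    exact hj rfl
  refine ⟨c / d, div_ne_zero hc0 hd0, fun z j => ?_⟩
  rw [← hevm, ← hev, hc, hn j (Finset.mem_univ j)]
  simp only [Polynomial.eval_mul, Polynomial.eval_C]
  field_simp

/-- On a projective line missing the bad locus, the minors of degree `4 (m - 1)` are a constant
multiple of the normals of degree `2 m` in both affine charts. Agreement at a common point
identifies the two constants, so the degrees are equal. -/
theorem degree_eq_two [CharZero Ω] [IsAlgClosed Ω] (hg : IsAutLift R m g) : m = 2 := by
  obtain ⟨κ, _, B, hB, hgood⟩ := hg.exists_bad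
  obtain ⟨P, Q, hPQ⟩ := exists_pencil B hB
  have hoff : ∀ a b : Ω, (a ≠ 0 ∨ b ≠ 0) → OffLines (a • P + b • Q) := fun a b hab =>
    (hgood _ (hPQ a b hab)).1
  have hN : ∀ a b : Ω, (a ≠ 0 ∨ b ≠ 0) → ∃ i, eval (a • P + b • Q) (normal g i) ≠ 0 := by
    intro a b hab
    obtain ⟨i, hi⟩ := (hgood _ (hPQ a b hab)).2
    induction i using Fin.lastCases with
    | last => exact absurd rfl hi
    | cast i =>
      refine ⟨i, ?_⟩
      simpa [normal, sub_eq_zero] using hi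
  obtain ⟨c, hc0, hc⟩ := hg.exists_minor_eq (P := P) (Q := Q)
    (fun z => by simpa using hoff 1 z (Or.inl one_ne_zero))
    (fun z => by simpa using hN 1 z (Or.inl one_ne_zero))
  obtain ⟨d, hd0, hd⟩ := hg.exists_minor_eq (P := Q) (Q := P)
    (fun z => by simpa [add_comm] using hoff z 1 (Or.inr one_ne_zero))
    (fun z => by simpa [add_comm] using hN z 1 (Or.inr one_ne_zero))
  have hcd : c = d := by
    obtain ⟨i, hi⟩ := hN 1 1 (Or.inl one_ne_zero)
    rw [one_smul] at hi
    have h1 := hc 1 i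
    have h2 := hd 1 i
    rw [one_smul] at h1 h2 hi
    rw [add_comm Q P, h1] at h2
    exact mul_right_cancel₀ hi h2
  subst hcd
  obtain ⟨i, hi⟩ := hN 2⁻¹ 1 (Or.inr one_ne_zero)
  rw [one_smul, add_comm] at hi
  have h1 := hc 2 i
  have h2 := hd 2⁻¹ i
  have hs : P + (2 : Ω) • Q = (2 : Ω) • (Q + (2 : Ω)⁻¹ • P) := by
    rw [smul_add, smul_smul, mul_inv_cancel₀ two_ne_zero, one_smul, add_comm]
  have hev : ∀ {p : MvPolynomial (Fin 4) Ω} {n : ℕ}, p.IsHomogeneous n → ∀ t : Fin 4 → Ω,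
      eval ((2 : Ω) • t) p = 2 ^ n * eval t p := fun hp t => aeval_smul_of_isHomogeneous hp 2 t
  have hnorm : (normal g i).IsHomogeneous (m * 2) :=
    ((hg.isHomogeneous _).pow 2).sub ((hg.isHomogeneous _).pow 2)
  have hjac : ∀ a i, (jac g a i).IsHomogeneous (m - 1) := fun a i => (hg.isHomogeneous _).pderiv
  rw [hs, hev hnorm] at h1
  simp only [hev (hjac _ _)] at h1
  rw [minor_smul, h2] at h1
  -- The same point of the line is compared in the two charts, where its representatives differ by
  -- the factor `2`.
  have h3 : ((2 : Ω) ^ (m - 1)) ^ 4 = 2 ^ (m * 2) := by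
    refine mul_right_cancel₀ (mul_ne_zero hc0 hi) ?_
    linear_combination h1
  rw [← pow_mul] at h3
  have h4 : (2 : ℕ) ^ ((m - 1) * 4) = 2 ^ (m * 2) := by exact_mod_cast h3
  have h5 := Nat.pow_right_injective le_rfl h4
  have := hg.ne_zero
  omega

end IsAutLift

end SegreCubic

/-! ### The lift is linear in the parametrizing quadrics. -/

namespace SegreCubic

variable {Ω : Type*} [Field Ω]

/-- A quadratic form is given by its (constant) second derivatives. -/
theorem exists_eval_eq_sum [CharZero Ω] {p : MvPolynomial (Fin 4) Ω} (hp : p.IsHomogeneous 2) :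
    ∃ h : Fin 4 → Fin 4 → Ω, (∀ a b, h a b = h b a) ∧
      ∀ t, 2 * eval t p = ∑ a, t a * ∑ b, t b * h a b := by
  refine ⟨fun a b => eval 0 (pderiv b (pderiv a p)), fun a b => ?_, fun t => ?_⟩
  · simp only [pderiv_comm' a b]
  · have h1 : ∑ a, t a * eval t (pderiv a p) = (2 : ℕ) * eval t p := aeval_euler hp t
    rw [Nat.cast_ofNat] at h1
    rw [← h1]
    refine Finset.sum_congr rfl fun a _ => ?_
    have h2 : ∑ b, t b * eval t (pderiv b (pderiv a p)) = (1 : ℕ) * eval t (pderiv a p) :=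
      aeval_euler hp.pderiv t
    rw [Nat.cast_one, one_mul] at h2
    rw [← h2]
    congr 1
    refine Finset.sum_congr rfl fun b _ => ?_
    have h3 : ∀ s : Fin 4 → Ω, eval s (pderiv b (pderiv a p)) = coeff 0 (pderiv b (pderiv a p)) := by
      intro s
      exact aeval_of_isHomogeneous_zero (hp.pderiv (i := a)).pderiv s
    dsimp only
    rw [h3, h3]

/-- Two lines from one base point to others are contracted to different points. -/
theorem quadPolar_basePt_not_proportional [CharZero Ω] (i : Fin 5) : ∃ j k a b,
    quadPolar (basePt Ω i) (basePt Ω j) a * quadPolar (basePt Ω i) (basePt Ω k) b ≠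
      quadPolar (basePt Ω i) (basePt Ω j) b * quadPolar (basePt Ω i) (basePt Ω k) a := by
  fin_cases i
  · exact ⟨1, 2, 5, 3, by simp [quadPolar, basePt]; norm_num⟩
  · exact ⟨0, 2, 5, 4, by simp [quadPolar, basePt]; norm_num⟩
  · exact ⟨0, 1, 5, 4, by simp [quadPolar, basePt]; norm_num⟩
  · exact ⟨0, 1, 5, 3, by simp [quadPolar, basePt]; norm_num⟩
  · exact ⟨0, 1, 5, 4, by simp [quadPolar, basePt]; norm_num⟩

namespace IsAutLift

variable {R : (Fin 6 → Ω) → (Fin 6 → Ω) → Prop} {g : Fin 6 → MvPolynomial (Fin 4) Ω}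

theorem eval_add_smul [CharZero Ω] {p : MvPolynomial (Fin 4) Ω} (hp : p.IsHomogeneous 2)
    (t v : Fin 4 → Ω) :
    ∃ β, ∀ s : Ω, eval (t + s • v) p = eval t p + s * β + s ^ 2 * eval v p := by
  obtain ⟨h, -, hh⟩ := exists_eval_eq_sum hp
  refine ⟨(∑ a, t a * ∑ b, v b * h a b + ∑ a, v a * ∑ b, t b * h a b) / 2, fun s => ?_⟩
  refine mul_left_cancel₀ two_ne_zero ?_
  rw [mul_add, mul_add, hh, hh, mul_left_comm 2 (s ^ 2), hh]
  simp only [Pi.add_apply, Pi.smul_apply, smul_eq_mul, add_mul, Finset.sum_add_distrib, mul_add,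
    mul_assoc, ← Finset.mul_sum, mul_left_comm _ s]
  ring

/-- The parametrization contracts the line from base point `i` to base point `j`. If `g` were
nonzero at `i`, its value there would represent the image of the contracted point, by interpolation
along the line. Two lines with different contractions would contradict injectivity. -/
theorem eval_basePt [CharZero Ω] (hg : IsAutLift R 2 g) (i : Fin 5) (l : Fin 6) :
    eval (basePt Ω i) (g l) = 0 := by
  by_contra h0
  have key : ∀ j, quadPolar (basePt Ω i) (basePt Ω j) ≠ 0 →
      R (quadPolar (basePt Ω i) (basePt Ω j)) fun l => eval (basePt Ω i) (g l) := by
    intro j hj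
    have hR : ∀ s : Ω, s ≠ 0 → R (quadPolar (basePt Ω i) (basePt Ω j))
        fun l => eval (basePt Ω i + s • basePt Ω j) (g l) := by
      intro s hs
      have hq : quad (basePt Ω i + s • basePt Ω j) = s • quadPolar (basePt Ω i) (basePt Ω j) := by
        rw [quad_add_smul, quad_basePt, quad_basePt, smul_zero, zero_add, add_zero]
      have h1 := hg.rel (basePt Ω i + s • basePt Ω j) (by rw [hq]; exact smul_ne_zero hs hj)
      rw [hq] at h1
      simpa [smul_smul, hs] using hg.isAutRel.smul_left (inv_ne_zero hs) h1
    have h1 := hR 1 one_ne_zero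
    set z := fun l => eval (basePt Ω i + (1 : Ω) • basePt Ω j) (g l) with hz
    have hprop : ∀ a b, z a * eval (basePt Ω i) (g b) = z b * eval (basePt Ω i) (g a) := by
      intro a b
      obtain ⟨α, hα⟩ := eval_add_smul (hg.isHomogeneous a) (basePt Ω i) (basePt Ω j)
      obtain ⟨β, hβ⟩ := eval_add_smul (hg.isHomogeneous b) (basePt Ω i) (basePt Ω j)
      have e1 := hg.isAutRel.mul_eq_mul h1 (hR (-1) (by norm_num)) a b
      have e2 := hg.isAutRel.mul_eq_mul h1 (hR 2 (by norm_num)) a b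
      have e3 : z a * z b = z b * z a := mul_comm _ _
      have ea : z a = _ := hα 1
      have eb : z b = _ := hβ 1
      simp only [hα, hβ] at e1 e2
      linear_combination (z b) * ea - (z a) * eb + (e1 - e2) / 3
    obtain ⟨c, hc⟩ : ∃ c, (fun l => eval (basePt Ω i) (g l)) = c • z := by
      obtain ⟨a, ha⟩ := Function.ne_iff.mp (hg.isAutRel.right_ne h1)
      refine ⟨eval (basePt Ω i) (g a) / z a, ?_⟩
      funext b
      rw [Pi.smul_apply, smul_eq_mul, div_mul_eq_mul_div, eq_div_iff ha]
      linear_combination hprop a b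
    have hc0 : c ≠ 0 := by
      rintro rfl
      rw [zero_smul] at hc
      exact h0 (congrFun hc l)
    rw [hc]
    exact hg.isAutRel.smul_right hc0 h1
  obtain ⟨j, k, a, b, hab⟩ := quadPolar_basePt_not_proportional (Ω := Ω) i
  refine hab (hg.isAutRel.mul_eq_mul_left (key j fun h => hab ?_) (key k fun h => hab ?_) a b)
  all_goals simp [h]

theorem exists_linear [CharZero Ω] (hg : IsAutLift R 2 g) :
    ∃ A : (Fin 6 → Ω) →ₗ[Ω] (Fin 6 → Ω), ∀ t i, eval t (g i) = A (quad t) i := by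
  choose h hsymm hh using fun i => exists_eval_eq_sum (hg.isHomogeneous i)
  let x : Fin 6 → (Fin 6 → Ω) →ₗ[Ω] Ω := LinearMap.proj
  -- Vanishing at the coordinate points removes the squares, and vanishing at `(1, 1, 1, 1)` makes
  -- the mixed coefficients sum to zero. The five pair sums of `quad` used here are twice the
  -- successive differences in `t₁t₂, t₁t₃, t₀t₁, t₀t₃, t₀t₂, t₂t₃`, so the coefficients are partial
  -- sums.
  refine ⟨LinearMap.pi fun i => (2⁻¹ : Ω) • (h i 1 2 • (x 1 + x 2) + (h i 1 2 + h i 1 3) • (x 3 + x 4) +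
    (h i 1 2 + h i 1 3 + h i 0 1) • (x 0 + x 1) + (h i 1 2 + h i 1 3 + h i 0 1 + h i 0 3) • (x 3 + x 5) +
    (h i 1 2 + h i 1 3 + h i 0 1 + h i 0 3 + h i 0 2) • (x 0 + x 2)), fun t i => ?_⟩
  have hb : ∀ j, ∑ a, basePt Ω j a * ∑ b, basePt Ω j b * h i a b = 0 := by
    intro j
    rw [← hh, hg.eval_basePt, mul_zero]
  have h0 := hb 0
  have h1 := hb 1
  have h2 := hb 2
  have h3 := hb 3
  have h4 := hb 4
  have ht := hh i t
  simp [basePt, Fin.sum_univ_four] at h0 h1 h2 h3 h4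
  simp only [Fin.sum_univ_four, h0, h1, h2, h3, hsymm i 1 0, hsymm i 2 0, hsymm i 3 0, hsymm i 2 1,
    hsymm i 3 1, hsymm i 3 2] at ht h4
  refine mul_left_cancel₀ two_ne_zero (ht.trans ?_)
  simp [x, quad]
  linear_combination t 2 * t 3 * h4

end IsAutLift

end SegreCubic

/-! ### The linear map is a permutation up to scaling. -/

namespace SegreCubic

variable {Ω : Type*} [Field Ω]

/-- At a general point, the parametrization is a submersion onto the Segre cubic. -/
theorem OffLines.exists_quadPolar_eq [CharZero Ω] {t : Fin 4 → Ω} (ht : OffLines t) {i j : Fin 6}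
    (hij : quad t i ^ 2 ≠ quad t j ^ 2) {v : Fin 6 → Ω} (hv : ∑ k, v k = 0)
    (hv2 : ∑ k, quad t k ^ 2 * v k = 0) : ∃ w, quadPolar t w = v := by
  let D : (Fin 4 → Ω) →ₗ[Ω] (Fin 6 → Ω) :=
    { toFun := quadPolar t
      map_add' := quadPolar_add t
      map_smul' := fun a w => quadPolar_smul t w a }
  let L : (Fin 6 → Ω) →ₗ[Ω] Ω × Ω :=
    (∑ k, LinearMap.proj k).prod (∑ k, quad t k ^ 2 • LinearMap.proj k)
  have hL : ∀ x, L x = (∑ k, x k, ∑ k, quad t k ^ 2 * x k) := fun x => by simp [L]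
  have hDinj : LinearMap.ker D = ⊥ := by
    rw [LinearMap.ker_eq_bot']
    exact fun w hw => ht.quadPolar_injective hw
  have hLsurj : LinearMap.range L = ⊤ := by
    rw [LinearMap.range_eq_top]
    rintro ⟨x, y⟩
    have hne := sub_ne_zero.mpr hij
    refine ⟨((y - x * quad t j ^ 2) / (quad t i ^ 2 - quad t j ^ 2)) • Pi.single i 1 +
      ((x * quad t i ^ 2 - y) / (quad t i ^ 2 - quad t j ^ 2)) • Pi.single j 1, ?_⟩
    rw [map_add, map_smul, map_smul, hL, hL]
    ext
    · simp
      field_simp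
      ring
    · simp [Pi.single_apply]
      field_simp
      ring
  have hle : LinearMap.range D ≤ LinearMap.ker L := by
    rintro _ ⟨w, rfl⟩
    rw [LinearMap.mem_ker, hL, Prod.mk_eq_zero]
    exact ⟨sum_quadPolar t w, sum_quad_sq_mul_quadPolar t w⟩
  have h1 := LinearMap.finrank_range_of_inj (LinearMap.ker_eq_bot.mp hDinj)
  have h2 := L.finrank_range_add_finrank_ker
  rw [hLsurj, finrank_top, Module.finrank_prod, Module.finrank_self, Module.finrank_fin_fun] at h2
  rw [Module.finrank_fin_fun] at h1
  -- The differential has rank four, and the two independent conditions on six coordinates leave a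
  -- space of dimension four.
  have heq := Submodule.eq_of_le_of_finrank_eq hle (by omega)
  have hmem : v ∈ LinearMap.ker L := by
    rw [LinearMap.mem_ker, hL, hv, hv2]
    rfl
  rw [← heq] at hmem
  exact hmem

/-- Every hyperplane section through the Gauss map meets the locus of general points. -/
theorem exists_sum_quad_sq_mul_eq_zero [CharZero Ω] [IsAlgClosed Ω] (v : Fin 6 → Ω) :
    ∃ t : Fin 4 → Ω, OffLines t ∧ (∃ i, quad t i ^ 2 ≠ quad t (Fin.last 5) ^ 2) ∧
      ∑ k, quad t k ^ 2 * v k = 0 := by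
  obtain ⟨κ, _, B, hB, hgood⟩ := (isAutLift_quadPoly (Ω := Ω)).exists_bad
  simp only [eval_quadPoly] at hgood
  obtain ⟨P, Q, hPQ⟩ := exists_pencil B hB
  by_contra! hcon
  have hne : ∀ a b : Ω, (a ≠ 0 ∨ b ≠ 0) → ∑ k, quad (a • P + b • Q) k ^ 2 * v k ≠ 0 :=
    fun a b hab => hcon _ (hgood _ (hPQ a b hab)).1 (hgood _ (hPQ a b hab)).2
  have hconst : ∀ P Q : Fin 4 → Ω, (∀ z : Ω, ∑ k, quad (P + z • Q) k ^ 2 * v k ≠ 0) →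
      ∃ c, ∀ z : Ω, ∑ k, quad (P + z • Q) k ^ 2 * v k = c := by
    intro P Q h
    let p : Polynomial Ω := ∑ k,
      quad (fun a => Polynomial.C (P a) + Polynomial.X * Polynomial.C (Q a)) k ^ 2 * Polynomial.C (v k)
    have hp : ∀ z, p.eval z = ∑ k, quad (P + z • Q) k ^ 2 * v k := by
      intro z
      simp only [p, Polynomial.eval_finsetSum, Polynomial.eval_mul, Polynomial.eval_pow,
        Polynomial.eval_C]
      simp only [← Polynomial.coe_evalRingHom, map_quad]
      simp [Pi.add_def, Pi.smul_def, mul_comm z]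
    have hdeg : p.degree = 0 := by
      by_contra hd
      obtain ⟨z, hz⟩ := IsAlgClosed.exists_root p hd
      exact h z (by rw [← hp]; exact hz)
    refine ⟨p.coeff 0, fun z => ?_⟩
    rw [← hp, Polynomial.eq_C_of_degree_eq_zero hdeg]
    simp
  obtain ⟨c, hc⟩ := hconst P Q fun z => by simpa using hne 1 z (Or.inl one_ne_zero)
  obtain ⟨d, hd⟩ := hconst Q P fun z => by simpa [add_comm] using hne z 1 (Or.inr one_ne_zero)
  have hcd : c = d := by
    rw [← hc 1, ← hd 1, one_smul, one_smul, add_comm]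
  subst hcd
  have h2 := hc 2
  have hs : P + (2 : Ω) • Q = (2 : Ω) • (Q + (2 : Ω)⁻¹ • P) := by
    rw [smul_add, smul_smul, mul_inv_cancel₀ two_ne_zero, one_smul, add_comm]
  rw [hs, quad_smul] at h2
  simp only [Pi.smul_apply, smul_eq_mul, mul_pow, mul_assoc, ← Finset.mul_sum] at h2
  rw [hd] at h2
  -- A nowhere vanishing polynomial in the pencil parameter is constant, but the expression is a
  -- quartic form, so scaling by `2` gives `16 c = c`.
  have hc0 : c = 0 := by linear_combination h2 / 15
  refine hne 1 0 (Or.inl one_ne_zero) ?_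
  have := hc 0
  rw [zero_smul] at this
  rw [one_smul, zero_smul, this, hc0]

namespace IsAutLift

variable {R : (Fin 6 → Ω) → (Fin 6 → Ω) → Prop} {m : ℕ} {g : Fin 6 → MvPolynomial (Fin 4) Ω}
  {A : (Fin 6 → Ω) →ₗ[Ω] (Fin 6 → Ω)}

/-- A vector `v` of the hyperplane is tangent to the Segre cubic at some general point, so `v =
quadPolar t w`. Then `A v = 0` says that the lift has zero derivative along `w`. -/
theorem linear_injective [CharZero Ω] [IsAlgClosed Ω] (hg : IsAutLift R m g)
    (hA : ∀ t i, eval t (g i) = A (quad t) i) {v : Fin 6 → Ω} (hv : ∑ i, v i = 0) (hAv : A v = 0) :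
    v = 0 := by
  obtain ⟨t, ht, ⟨i, hi⟩, htv⟩ := exists_sum_quad_sq_mul_eq_zero v
  obtain ⟨w, rfl⟩ := ht.exists_quadPolar_eq hi hv htv
  have hAx : ∀ x i, A x i = ∑ j, x j * A (Pi.single j 1) i := by
    intro x i
    conv_lhs => rw [pi_eq_sum_univ' x, map_sum]
    simp [Finset.sum_apply]
  have hgA : ∀ i, g i = ∑ j, quadPoly Ω j * C (A (Pi.single j 1) i) := by
    intro i
    refine MvPolynomial.funext fun s => ?_
    rw [hA, hAx]
    simp [eval_quadPoly]
  have hw : w = 0 := by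
    refine hg.isAutRel.deriv_injective hg.ne_zero hg.isHomogeneous hg.rel ht fun i => ?_
    have h1 := congrFun hAv i
    rw [hAx, Pi.zero_apply] at h1
    rw [← h1]
    simp only [hgA, map_sum, Derivation.leibniz, pderiv_C, smul_eq_mul,
      Finset.mul_sum]
    rw [Finset.sum_comm]
    refine Finset.sum_congr rfl fun j _ => ?_
    rw [← sum_mul_pderiv_quadPoly, Finset.sum_mul]
    exact Finset.sum_congr rfl fun a _ => by
      rw [mul_zero, zero_add, map_mul, eval_C]
      ring
  rw [hw]
  simpa using quadPolar_smul t 0 0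

/-- This holds on the image of the parametrization by construction. At other points it follows along
a line whose points with `ε ≠ 0` are in the image up to scaling. -/
theorem map_mem [CharZero Ω] (hg : IsAutLift R m g)
    (hA : ∀ t i, eval t (g i) = A (quad t) i) {x : Fin 6 → Ω} (hx : ∑ i, x i = 0)
    (hx3 : ∑ i, x i ^ 3 = 0) : ∑ i, A x i = 0 ∧ ∑ i, A x i ^ 3 = 0 := by
  have hquad : ∀ t, ∑ i, A (quad t) i = 0 ∧ ∑ i, A (quad t) i ^ 3 = 0 := by
    intro t
    by_cases ht : quad t = 0
    · simp [ht]
    · have := hg.isAutRel.right_mem (hg.rel t ht)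
      simpa only [hA] using this
  obtain ⟨y, hy⟩ := exists_add_smul_eq_quad x hx hx3
  have hcurve : ∀ ε : Ω, ε ≠ 0 →
      ∑ i, (A x i + ε * A y i) = 0 ∧ ∑ i, (A x i + ε * A y i) ^ 3 = 0 := by
    intro ε hε
    obtain ⟨t, l, -, ht⟩ := hy ε hε
    have h1 : ∀ i, A x i + ε * A y i = l * A (quad t) i := by
      intro i
      have := congrFun (congrArg A ht) i
      simpa using this
    simp only [h1, mul_pow, ← Finset.mul_sum, hquad, mul_zero, and_self]
  have c1 := hcurve 1 one_ne_zero
  have c2 := hcurve 2 (by norm_num)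
  have c3 := hcurve 3 (by norm_num)
  have c4 := hcurve 4 (by norm_num)
  -- The fourth finite difference of a cubic polynomial vanishes, which recovers its value at `ε =
  -- 0` from those at `1, 2, 3, 4`.
  have e : ∀ i, A x i ^ 3 = 4 * (A x i + 1 * A y i) ^ 3 - 6 * (A x i + 2 * A y i) ^ 3 +
      4 * (A x i + 3 * A y i) ^ 3 - (A x i + 4 * A y i) ^ 3 := fun i => by ring
  have e' : ∀ i, A x i = 2 * (A x i + 1 * A y i) - (A x i + 2 * A y i) := fun i => by ring
  constructor
  · rw [Finset.sum_congr rfl fun i _ => e' i, Finset.sum_sub_distrib, ← Finset.mul_sum, c1.1, c2.1]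
    ring
  · rw [Finset.sum_congr rfl fun i _ => e i]
    simp only [Finset.sum_sub_distrib, Finset.sum_add_distrib, ← Finset.mul_sum]
    rw [c1.2, c2.2, c3.2, c4.2]
    ring

/-- The roots span the hyperplane and lie on the Segre cubic, so `A` preserves the hyperplane. It is
bijective there and pulls the cubic back to one vanishing on the Segre cubic, hence to a multiple.
-/
theorem exists_perm [CharZero Ω] [IsAlgClosed Ω] (hg : IsAutLift R m g)
    (hA : ∀ t i, eval t (g i) = A (quad t) i) :
    ∃ (κ : Ω) (π : Equiv.Perm (Fin 6)), κ ≠ 0 ∧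
      ∀ x : Fin 6 → Ω, ∑ i, x i = 0 → ∀ i, A x (π i) = κ * x i := by
  let W : Submodule Ω (Fin 6 → Ω) := LinearMap.ker (∑ i, LinearMap.proj i : (Fin 6 → Ω) →ₗ[Ω] Ω)
  have hW : ∀ x, x ∈ W ↔ ∑ i, x i = 0 := fun x => by simp [W]
  have hsum : ∀ x : Fin 6 → Ω, ∑ i, x i = 0 → ∑ i, A x i = 0 := by
    intro x hx
    have hx' : x = ∑ j, x j • rootVec Ω j 0 := by
      funext k
      simp [rootVec_apply, mul_sub, Finset.sum_sub_distrib, hx]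
    rw [hx', map_sum]
    simp only [Finset.sum_apply, map_smul, Pi.smul_apply]
    rw [Finset.sum_comm]
    refine Finset.sum_eq_zero fun j _ => ?_
    rw [← Finset.smul_sum, (hg.map_mem hA (sum_rootVec j 0) ?_).1, smul_zero]
    have : ∀ k, rootVec Ω j 0 k ^ 3 = rootVec Ω j 0 k := by
      intro k
      rw [rootVec_apply]
      split_ifs <;> norm_num
    simp only [this, sum_rootVec]
  have hf : IsSumZeroIso W.subtype :=
    ⟨fun w h => Subtype.ext h, fun w => (hW _).mp w.2, fun x hx => ⟨⟨x, (hW x).mpr hx⟩, rfl⟩⟩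
  have hAf : IsSumZeroIso (A ∘ₗ W.subtype) := by
    have hinj : ∀ w : W, A w = 0 → w = 0 := fun w h =>
      Subtype.ext (hg.linear_injective hA ((hW _).mp w.2) h)
    refine ⟨hinj, fun w => hsum _ ((hW _).mp w.2), fun x hx => ?_⟩
    let A' : W →ₗ[Ω] W := (A ∘ₗ W.subtype).codRestrict W fun w =>
      (hW _).mpr (hsum _ ((hW _).mp w.2))
    have hA' : Function.Injective A' := by
      rw [← LinearMap.ker_eq_bot, LinearMap.ker_eq_bot']
      exact fun w hw => hinj w (congrArg Subtype.val hw)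
    obtain ⟨w, hw⟩ := LinearMap.injective_iff_surjective.mp hA' ⟨x, (hW x).mpr hx⟩
    exact ⟨w, congrArg Subtype.val hw⟩
  obtain ⟨c, hc⟩ := exists_cube_eq_of_vanish (f := W.subtype) (g := A ∘ₗ W.subtype) hf
    fun w hw => (hg.map_mem hA ((hW _).mp w.2) hw).2
  obtain ⟨κ, π, hκ, hπ⟩ := exists_perm_of_tri_eq hf hAf (tri_eq_of_cube_eq hc)
  exact ⟨κ, π, hκ, fun x hx => hπ ⟨x, (hW x).mpr hx⟩⟩

/-- At a point outside the image, a local polynomial representation of the automorphism is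
proportional to `A` along a punctured line. Cancelling `X` extends the proportionality to the point
itself. -/
theorem rel_linear [CharZero Ω] [IsAlgClosed Ω] (hg : IsAutLift R m g)
    (hA : ∀ t i, eval t (g i) = A (quad t) i) {w : Fin 6 → Ω} (hw : w ≠ 0) (hw1 : ∑ i, w i = 0)
    (hw3 : ∑ i, w i ^ 3 = 0) : R w (A w) := by
  have hR := hg.isAutRel
  obtain ⟨f, hf, hfR⟩ := hR.poly w hw hw1 hw3
  obtain ⟨y, hy⟩ := exists_add_smul_eq_quad w hw1 hw3
  have hcurve : ∀ ε : Ω, ε ≠ 0 → ∀ i j, aeval (w + ε • y) (f i) * A (w + ε • y) j =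
      aeval (w + ε • y) (f j) * A (w + ε • y) i := by
    intro ε hε i j
    obtain ⟨t, l, hl, ht⟩ := hy ε hε
    by_cases hq : quad t = 0
    · simp [ht, hq]
    by_cases h0 : (fun i => aeval (w + ε • y) (f i)) = 0
    · have hi := congrFun h0 i
      have hj := congrFun h0 j
      simp only [Pi.zero_apply] at hi hj
      rw [hi, hj, zero_mul, zero_mul]
    · have h1 := hfR (w + ε • y) (by rw [ht]; exact smul_ne_zero hl hq)
        (by rw [ht]; simp [← Finset.mul_sum, sum_quad])
        (by rw [ht]; simp [mul_pow, ← Finset.mul_sum, sum_quad_cube]) h0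
      have h2 := hg.rel t hq
      simp only [hA] at h2
      have h3 := hR.smul_right hl (hR.smul_left hl h2)
      rw [← ht] at h3
      have h4 : l • (fun i => A (quad t) i) = A (w + ε • y) := by
        rw [ht, map_smul]
      rw [h4] at h3
      exact hR.mul_eq_mul h1 h3 i j
  have hw' : ∀ i j, aeval w (f i) * A w j = aeval w (f j) * A w i := by
    intro i j
    let F : Fin 6 → Polynomial Ω := fun i =>
      aeval (fun a => Polynomial.C (w a) + Polynomial.X * Polynomial.C (y a)) (f i)
    let G : Fin 6 → Polynomial Ω := fun i => Polynomial.C (A w i) + Polynomial.X * Polynomial.C (A y i)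
    have hF : ∀ (z : Ω) i, (F i).eval z = aeval (w + z • y) (f i) := by
      intro z i
      have : ((Polynomial.aeval z).comp (aeval fun a =>
          Polynomial.C (w a) + Polynomial.X * Polynomial.C (y a) :
            MvPolynomial (Fin 6) Ω →ₐ[Ω] Polynomial Ω)) = aeval (w + z • y) := by
        apply MvPolynomial.algHom_ext
        intro a
        simpa using mul_comm _ _
      exact DFunLike.congr_fun this (f i)
    have hG : ∀ (z : Ω) i, (G i).eval z = A (w + z • y) i := by
      intro z i
      simp [G, mul_comm z]
    have hzero : Polynomial.X * (F i * G j) = Polynomial.X * (F j * G i) := by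
      refine Polynomial.funext fun z => ?_
      simp only [Polynomial.eval_mul, Polynomial.eval_X, hF, hG]
      by_cases hz : z = 0
      · rw [hz, zero_mul, zero_mul]
      · rw [hcurve z hz]
    have h1 := congrArg (Polynomial.eval 0) (mul_left_cancel₀ Polynomial.X_ne_zero hzero)
    simpa only [Polynomial.eval_mul, hF, hG, zero_smul, add_zero] using h1
  have hRw := hfR w hw hw1 hw3 hf
  obtain ⟨i, hi⟩ := Function.ne_iff.mp hf
  rw [Pi.zero_apply] at hi
  have hAw : A w = (A w i / aeval w (f i)) • fun j => aeval w (f j) := by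
    funext j
    rw [Pi.smul_apply, smul_eq_mul, div_mul_eq_mul_div, eq_div_iff hi]
    linear_combination hw' i j
  rw [hAw]
  refine hR.smul_right (div_ne_zero (fun h0 => hw (hg.linear_injective hA hw1 ?_)) hi) hRw
  rw [hAw, h0, zero_div, zero_smul]

end IsAutLift

/-- The automorphisms of the Segre cubic are the permutations of the coordinates. -/
theorem exists_eq_segrePerm {K Ω : Type*} [Field K] [Field Ω] [Algebra K Ω] [CharZero Ω]
    [IsAlgClosed Ω] {φ : Equiv.Perm (segre K Ω)} (hφ : φ ∈ autGroup Ω (segre K Ω)) :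
    ∃ π, φ = segrePerm K Ω π := by
  have hR := isAutRel_of_mem_autGroup hφ
  obtain ⟨m, g, hm, hhom, hrel⟩ := hR.exists_isHomogeneous
  have hg : IsAutLift _ m g := ⟨hR, hm, hhom, hrel⟩
  obtain rfl := hg.degree_eq_two
  obtain ⟨A, hA⟩ := hg.exists_linear
  obtain ⟨κ, π, hκ, hπ⟩ := hg.exists_perm hA
  refine ⟨π, Equiv.ext fun p => Subtype.ext ?_⟩
  obtain ⟨p, hp⟩ := p
  induction p using Projectivization.ind with
  | h v hv =>
    obtain ⟨h1, h3⟩ := (mk_mem_segre hv).mp hp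
    obtain ⟨_, hz, _, hφv⟩ := hg.rel_linear hA hv h1 h3
    rw [hφv]
    change _ = Projectivization.mk Ω (LinearMap.funLeft Ω Ω π.symm v) _
    rw [Projectivization.mk_eq_mk_iff']
    refine ⟨κ, ?_⟩
    funext i
    rw [Pi.smul_apply, LinearMap.funLeft_apply, smul_eq_mul, ← hπ v h1, Equiv.apply_symm_apply]

end SegreCubic

/-! ### Automorphisms over `K`, cocycles, and the conclusion. -/

namespace SegreCubic

section Automorphisms

variable {K Ω : Type*} [Field K] [Field Ω] [Algebra K Ω]

theorem segrePerm_mem_autGroup (k : Type*) [Field k] [Algebra k Ω] (π : Equiv.Perm (Fin 6)) :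
    segrePerm K Ω π ∈ autGroup k (segre K Ω) := by
  have key : ∀ π : Equiv.Perm (Fin 6), IsMorphism k (segrePerm K Ω π) := by
    intro π
    refine isMorphism_of_matrix (fun j i => if i = π.symm j then 1 else 0) fun q => ?_
    have he : (fun j => ∑ i, algebraMap k Ω (if i = π.symm j then 1 else 0) * q.1.rep i) =
        LinearMap.funLeft Ω Ω π.symm q.1.rep := by
      funext j
      simp [apply_ite (algebraMap k Ω), LinearMap.funLeft_apply]
    have hne : LinearMap.funLeft Ω Ω π.symm q.1.rep ≠ 0 := by
      rw [Ne, map_eq_zero_iff _ (LinearMap.funLeft_injective_of_surjective _ _ _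
        π.symm.surjective)]
      exact q.1.rep_nonzero
    refine ⟨by rwa [he], ?_⟩
    change permPoint π q.1 = _
    conv_lhs => rw [← q.1.mk_rep]
    rw [permPoint, Projectivization.map_mk]
    congr 1
    exact he.symm
  refine ⟨key π, ?_⟩
  have := key π⁻¹
  rwa [map_inv] at this

/-- A permutation acting trivially fixes the point of each `eᵢ - eⱼ`, so it sends `i` to `i` or `j`.
Two choices of `j` leave only `i`. -/
theorem segrePerm_injective [CharZero Ω] : Function.Injective (segrePerm K Ω) := by
  refine (injective_iff_map_eq_one _).mpr fun π hπ => Equiv.ext fun i => ?_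
  have key : ∀ j, j ≠ i → π i = i ∨ π i = j := by
    intro j hj
    have hne : rootVec Ω i j ≠ 0 := by
      intro h0
      have := congrFun h0 i
      simp [rootVec_apply, hj.symm] at this
    have hmem : Projectivization.mk Ω _ hne ∈ segre K Ω := by
      rw [mk_mem_segre]
      refine ⟨sum_rootVec i j, ?_⟩
      have : ∀ k, rootVec Ω i j k ^ 3 = rootVec Ω i j k := by
        intro k
        rw [rootVec_apply]
        split_ifs <;> norm_num
      simp only [this, sum_rootVec]
    have h1 := congrArg (fun f : Equiv.Perm (segre K Ω) => (f ⟨_, hmem⟩).1) hπ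
    change Projectivization.mk Ω (LinearMap.funLeft Ω Ω π.symm (rootVec Ω i j)) _ =
      Projectivization.mk Ω (rootVec Ω i j) _ at h1
    rw [Projectivization.mk_eq_mk_iff'] at h1
    obtain ⟨a, ha⟩ := h1
    have h2 := congrFun ha (π i)
    by_contra! hcon
    simp [LinearMap.funLeft_apply, rootVec_apply, hcon.1, hcon.2, hj.symm] at h2
  have hex : ∀ i : Fin 6, ∃ j k : Fin 6, j ≠ i ∧ k ≠ i ∧ j ≠ k := by decide
  obtain ⟨j, k, hj, hk, hjk⟩ := hex i
  rcases key j hj with h | h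
  · exact h
  · rcases key k hk with h' | h'
    · exact h'
    · exact absurd (h.symm.trans h') hjk

theorem galPerm_mul_segrePerm (σ : Ω ≃ₐ[K] Ω) (π : Equiv.Perm (Fin 6)) :
    galPerm (segreEqs K) σ * segrePerm K Ω π = segrePerm K Ω π * galPerm (segreEqs K) σ := by
  refine Equiv.ext fun p => Subtype.ext ?_
  obtain ⟨p, hp⟩ := p
  induction p using Projectivization.ind with
  | h v hv => rfl

/-- One inclusion is extension of scalars. For the other, every geometric automorphism is a
permutation of coordinates, whose matrix has entries `0` and `1`. -/
theorem autGroup_segre [CharZero Ω] [IsAlgClosed Ω] :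
    autGroup K (segre K Ω) = autGroup Ω (segre K Ω) := by
  apply le_antisymm
  · have key : ∀ φ : Equiv.Perm (segre K Ω), IsMorphism K φ → IsMorphism Ω φ := by
      intro φ h p
      obtain ⟨d, f, hf, hfp, hφ⟩ := h p
      refine ⟨d, fun j => map (algebraMap K Ω) (f j), fun j => (hf j).map _, ?_, fun q hq => ?_⟩
      · simpa [aeval_map_algebraMap] using hfp
      · simp only [aeval_map_algebraMap] at hq ⊢
        exact hφ q hq
    exact fun φ hφ => ⟨key _ hφ.1, key _ hφ.2⟩
  · intro φ hφ
    obtain ⟨π, rfl⟩ := exists_eq_segrePerm hφ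
    exact segrePerm_mem_autGroup K π

/-- The automorphism group of the Segre cubic is the symmetric group. -/
noncomputable def segreAutEquiv (K Ω : Type*) [Field K] [Field Ω] [Algebra K Ω] [CharZero Ω]
    [IsAlgClosed Ω] : Equiv.Perm (Fin 6) ≃* autGroup Ω (segre K Ω) :=
  MulEquiv.ofBijective
    ((segrePerm K Ω).codRestrict (autGroup Ω (segre K Ω)) (segrePerm_mem_autGroup Ω))
    ⟨fun π π' h => segrePerm_injective (K := K) (Ω := Ω) (congrArg Subtype.val h), fun φ => by
      obtain ⟨π, hπ⟩ := exists_eq_segrePerm φ.2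
      exact ⟨π, Subtype.ext hπ.symm⟩⟩

theorem coe_segreAutEquiv [CharZero Ω] [IsAlgClosed Ω] (π : Equiv.Perm (Fin 6)) :
    (segreAutEquiv K Ω π : Equiv.Perm (segre K Ω)) = segrePerm K Ω π := rfl

/-- Galois acts trivially on the automorphism group, since coordinate permutations commute with the
coordinatewise action. -/
theorem IsOneCocycle.map_mul [CharZero Ω] [IsAlgClosed Ω]
    {c : (Ω ≃ₐ[K] Ω) → autGroup Ω (zeros Ω (segreEqs K))} (hc : IsOneCocycle (segreEqs K) c)
    (σ τ : Ω ≃ₐ[K] Ω) : c (σ * τ) = c σ * c τ := by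
  apply Subtype.ext
  rw [hc, Subgroup.coe_mul]
  congr 1
  obtain ⟨π, hπ⟩ := exists_eq_segrePerm (c τ).2
  rw [hπ, galPerm_mul_segrePerm, mul_assoc, mul_inv_cancel, mul_one]

end Automorphisms

end SegreCubic

theorem lemma7p1 {K : Type u} [Field K] [CharZero K] :
    SegreCubic.autGroup K (SegreCubic.segre K (AlgebraicClosure K)) =
        SegreCubic.autGroup (AlgebraicClosure K) (SegreCubic.segre K (AlgebraicClosure K)) ∧
    ∃ e : Equiv.Perm (Fin 6) ≃*
        SegreCubic.autGroup (AlgebraicClosure K) (SegreCubic.segre K (AlgebraicClosure K)),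
      (∀ π, (e π : Equiv.Perm (SegreCubic.segre K (AlgebraicClosure K))) =
        SegreCubic.segrePerm K (AlgebraicClosure K) π) ∧
      (∀ c : (AlgebraicClosure K ≃ₐ[K] AlgebraicClosure K) →
          SegreCubic.autGroup (AlgebraicClosure K) (SegreCubic.segre K (AlgebraicClosure K)),
        SegreCubic.IsOneCocycle (SegreCubic.segreEqs K) c → ∀ σ τ, c (σ * τ) = c σ * c τ) ∧
      (∀ F : MvPolynomial (Fin 5) K, SegreCubic.IsTenNodalCubic F →
        ∃ ρ : (AlgebraicClosure K ≃ₐ[K] AlgebraicClosure K) →* Equiv.Perm (Fin 6),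
          IsOpen (ρ.ker : Set (AlgebraicClosure K ≃ₐ[K] AlgebraicClosure K)) ∧
          SegreCubic.IsTwist (SegreCubic.segreEqs K) {F} (fun σ => e (ρ σ)) ∧
          ∃ (L : Type u) (_ : CommRing L) (_ : Algebra K L),
            Algebra.Etale K L ∧ Module.finrank K L = 6 ∧
            (∃ b : Fin 6 ≃ (L →ₐ[K] AlgebraicClosure K), ∀ σ i,
              b (ρ σ i) = (σ : AlgebraicClosure K →ₐ[K] AlgebraicClosure K).comp (b i)) ∧
            SegreCubic.IsTraceCubic F L) := by
  have : CharZero (AlgebraicClosure K) := charZero_of_injective_algebraMap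
    (algebraMap K (AlgebraicClosure K)).injective
  exact ⟨SegreCubic.autGroup_segre, SegreCubic.segreAutEquiv K (AlgebraicClosure K),
    SegreCubic.coe_segreAutEquiv, fun c hc => hc.map_mul,
    fun F hF => hF.exists_twist SegreCubic.coe_segreAutEquiv⟩
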